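/- **Model.** Let $1\le k\le n$ be integers, $\lambda,\mu_0,\mu_1>0$ and $p\in[0,1]$. Queries arrive according to a Poisson process of rate $\lambda$. Each query is forked to all $n$ servers, and each server works FCFS. When a server $j$ begins the service of a query $l$ it selects the high rate $\mu_1$ if $\xi_{j,l}=1$ and the low rate $\mu_0$ if $\xi_{j,l}=0$, where the $\xi_{j,l}$ are i.i.d. Bernoulli($p$); the service time is then exponential with the selected rate. Upon its $k$-th response a query leaves the system and is instantly dropped by all other servers, each of which proceeds to its next query (with a new service and rate selection) or becomes idle. Arrivals, service requirements (i.i.d. exponential with mean one, divided by the selected rate to give the service time) and rate selections are independent, and independent of the initial configuration, which is arbitrary: a finite FCFS-ordered list of queries, each with the set of fewer than $k$ servers that have responded to it (these sets decrease along the list, oldest query first), and the rates of the services under way (whose residual times are exponential with those rates). For $0\le i<k$ let $Y_i(t)$ be the number of queries in the system at time $t$ with exactly $i$ responses, $H_i(t)$ the number of servers working at the high rate on a query with exactly $i$ responses (at stage $i$), and $Z(t)=((Y_i(t),H_i(t)))_{0\le i<k}$. For $z=((y_i,h_i))_{i<k}$ put $N_{k-1}(y)=n-k+1$ and $N_i(y)=1+N_{i+1}(y)\mathbf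 1\{y_{i+1}=0\}$ for $i<k-1$. Let $\mathscr Z$ be the countable set of all $z$ with $y_i,h_i\in\mathbb Z_+$, $h_i\le N_i(y)$, and $h_i=0$ whenever $y_i=0$. **Theorem.** $(Z(t))_{t\ge0}$ is a time-homogeneous continuous-time Markov chain with state space $\mathscr Z$. That is, every $Z(t)$ is a random variable; almost surely the path stays in $\mathscr Z$ and is a right-continuous step function with left limits in the discrete topology; and there is a stochastic transition function $(P_t)_{t\ge0}$ on $\mathscr Z$ (stochastic matrices with $P_0=I$, $P_{s+t}=P_sP_t$) such that, for all $s,t\ge0$, $z,z'\in\mathscr Z$ and every event $A$ determined by $(Z(u))_{u\le s}$, $$\Pr(A,\,Z(s)=z,\,Z(s+t)=z')=\Pr(A,\,Z(s)=z)\,P_t(z,z').$$ Moreover $\lim_{t\downarrow0}(P_t(z,z')-P_0(z,z'))/t=Q(z,z')$ for all $z,z'\in\mathscr Z$, where $Q(z,z')$ for $z'\ne z$ is the total rate of the following transitions from $z=(y,h)$ that lead to $z'$, and $Q(z,z)=-\sum_{z'\ne z}Q(z,z')$: * *Arrival*, at rate $\lambda$: $y_0$ increases by $1$. If $y_0$ was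 $0$, then $h_0$ increases by $B$, where $B$ is binomial with parameters $(N_0(y),p)$; otherwise $h$ does not change. * *Response at stage $i$*, for each $i$ with $y_i>0$: by a high-rate server ($r=1$) at rate $h_i\mu_1$, and by a low-rate server ($r=0$) at rate $(N_i(y)-h_i)\mu_0$. Then $y_i$ decreases by $1$ and $h_i$ is set to $0$. If $i<k-1$, then moreover $y_{i+1}$ increases by $1$ and $h_{i+1}$ increases by the former value of $h_i$ minus $r$ (truncated at $0$), and $f=1$ server is freed; if $i=k-1$, $f=n-k+1$ servers are freed. Finally, if some stage $m\le i$ is non-empty after this change of $y$, then for the largest such $m$, $h_m$ increases by $B$, where $B$ is binomial with parameters $(f,p)$; otherwise the freed servers become idle. -/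

import Mathlib

open MeasureTheory ProbabilityTheory Filter Topology
open scoped NNReal

noncomputable section

namespace ForkJoin

/-! ### Sample paths of the `(n, k)` fork-join system -/

/-- A snapshot of the system, used as initial condition. `queries` lists, oldest first, the queries
present, each given by the set of servers that have already responded to it. Under FCFS these sets
decrease along the list, and every query present has fewer than `k` responses. `rate j` tells
whether the service under way at server `j` is a high-rate one (irrelevant if `j` is idle). -/
structure Config (n k : ℕ) where
  queries : List (Finset (Fin n))
  rate : Fin n → Bool
  nested : queries.Pairwise (fun s s' => s' ⊆ s)
  card_lt : ∀ s ∈ queries, s.card < k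

instance (n k : ℕ) : MeasurableSpace (Config n k) := ⊤

/-- One realisation of all the randomness. Queries are numbered `0, 1, 2, …` in FCFS order,
those present at time `0` first. -/
structure Input (n k : ℕ) where
  /-- the snapshot at time `0` -/
  init : Config n k
  /-- interarrival times of the queries that arrive after time `0` -/
  gap : ℕ → ℝ
  /-- `work (j, l)`: service requirement of query `l` at server `j` -/
  work : Fin n × ℕ → ℝ
  /-- `coin (j, l)`: is the service of query `l` at server `j` a high-rate one? -/
  coin : Fin n × ℕ → Bool

namespace Input

variable {n k : ℕ}

/-- The number of queries present at time `0`. -/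
def initCount (w : Input n k) : ℕ := w.init.queries.length

/-- At time `0` server `j` has already responded to query `l`. -/
def respondedAtZero (w : Input n k) (j : Fin n) (l : ℕ) : Prop :=
  ∃ s, w.init.queries[l]? = some s ∧ j ∈ s

/-- At time `0` server `j` is in the middle of serving query `l`: this is the oldest query present
to which `j` has not responded. -/
def servedAtZero (w : Input n k) (j : Fin n) (l : ℕ) : Prop :=
  l < w.initCount ∧ ¬ w.respondedAtZero j l ∧ ∀ l' < l, w.respondedAtZero j l'

/-- Arrival time of query `l` (time `0` for the queries present initially). -/
def arrival (w : Input n k) (l : ℕ) : ℝ :=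
  if l < w.initCount then 0 else ∑ m ∈ Finset.range (l - w.initCount + 1), w.gap m

open Classical in
/-- Is query `l` served at the high rate at server `j`? The choice is made by the coin, except for
the services already under way at time `0`. -/
def isHigh (w : Input n k) (j : Fin n) (l : ℕ) : Bool :=
  if w.servedAtZero j l then w.init.rate j else w.coin (j, l)

open Classical in
/-- (Remaining) service time of query `l` at server `j`: the service requirement divided by the
service rate, and `0` if the response was already given before time `0`. -/
def service (μ₀ μ₁ : ℝ) (w : Input n k) (j : Fin n) (l : ℕ) : ℝ :=
  if w.respondedAtZero j l then 0
  else w.work (j, l) / (if w.isHigh j l then μ₁ else μ₀)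

/-- The `k`-th smallest of the numbers `x j`. -/
def kthSmallest (k : ℕ) (x : Fin n → ℝ) : ℝ :=
  sInf {t : ℝ | k ≤ {j | x j ≤ t}.ncard}

/-- `free l j`: the time from which server `j` is done with all queries `0, …, l - 1`, each of
which it has completed, or dropped at the time of the `k`-th response to that query. -/
def free (μ₀ μ₁ : ℝ) (w : Input n k) : ℕ → Fin n → ℝ
  | 0, _ => 0
  | l + 1, j =>
      let c : Fin n → ℝ := fun j' =>
        max (w.arrival l) (free μ₀ μ₁ w l j') + w.service μ₀ μ₁ j' l
      min (c j) (kthSmallest k c)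

/-- The time at which server `j` begins the service of query `l` (FCFS). -/
def start (μ₀ μ₁ : ℝ) (w : Input n k) (l : ℕ) (j : Fin n) : ℝ :=
  max (w.arrival l) (w.free μ₀ μ₁ l j)

/-- The time at which server `j` responds to query `l`, unless that query is dropped before. -/
def completion (μ₀ μ₁ : ℝ) (w : Input n k) (l : ℕ) (j : Fin n) : ℝ :=
  w.start μ₀ μ₁ l j + w.service μ₀ μ₁ j l

/-- The time of the `k`-th response to query `l`, at which it leaves the system. -/
def departure (μ₀ μ₁ : ℝ) (w : Input n k) (l : ℕ) : ℝ :=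
  kthSmallest k (w.completion μ₀ μ₁ l)

/-- Query `l` is in the system at time `t` and has received exactly `i` responses. -/
def atStage (μ₀ μ₁ : ℝ) (w : Input n k) (t : ℝ) (i l : ℕ) : Prop :=
  w.arrival l ≤ t ∧ t < w.departure μ₀ μ₁ l ∧ {j | w.completion μ₀ μ₁ l j ≤ t}.ncard = i

/-- Server `j` is working on query `l` at time `t`. -/
def serving (μ₀ μ₁ : ℝ) (w : Input n k) (t : ℝ) (j : Fin n) (l : ℕ) : Prop :=
  w.start μ₀ μ₁ l j ≤ t ∧ t < w.completion μ₀ μ₁ l j ∧ t < w.departure μ₀ μ₁ l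

/-- `Y_i(t)`: the number of queries with exactly `i` responses. -/
def Y (μ₀ μ₁ : ℝ) (w : Input n k) (t : ℝ) (i : ℕ) : ℕ :=
  {l | w.atStage μ₀ μ₁ t i l}.ncard

/-- `H_i(t)`: the number of servers working at the high rate on a query with exactly `i`
responses. -/
def H (μ₀ μ₁ : ℝ) (w : Input n k) (t : ℝ) (i : ℕ) : ℕ :=
  {j | ∃ l, w.serving μ₀ μ₁ t j l ∧ w.atStage μ₀ μ₁ t i l ∧ w.isHigh j l = true}.ncard

end Input

/-- States `((y_i, h_i))_{i < k}`. -/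
abbrev State (k : ℕ) := Fin k → ℕ × ℕ

/-- `Z(t) = ((Y_i(t), H_i(t)))_{i < k}`. -/
def Input.Z {n k : ℕ} (μ₀ μ₁ : ℝ) (w : Input n k) (t : ℝ≥0) : State k :=
  fun i => (w.Y μ₀ μ₁ t i, w.H μ₀ μ₁ t i)

/-! ### The random input -/

/-- Poisson arrivals of rate `lam` (i.i.d. exponential interarrival times), i.i.d. exponential
service requirements of mean one (so that a service at rate `μ` lasts an exponential time of
mean `1/μ`), i.i.d. Bernoulli(`p`) rate selections, and an arbitrary random initial snapshot,
all independent. -/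
structure IsRandomInput {Ω : Type*} [MeasurableSpace Ω] (Pr : Measure Ω) {n k : ℕ} (lam p : ℝ)
    (W : Ω → Input n k) : Prop where
  measurable_init : Measurable fun ω => (W ω).init
  measurable_coin : ∀ a, Measurable fun ω => (W ω).coin a
  measurable_gap : ∀ m, Measurable fun ω => (W ω).gap m
  measurable_work : ∀ a, Measurable fun ω => (W ω).work a
  law_gap : ∀ m, Pr.map (fun ω => (W ω).gap m) = expMeasure lam
  law_work : ∀ a, Pr.map (fun ω => (W ω).work a) = expMeasure 1
  law_coin : ∀ a, Pr.real {ω | (W ω).coin a = true} = p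
  indep_gap : iIndepFun (fun m ω => (W ω).gap m) Pr
  indep_work : iIndepFun (fun a ω => (W ω).work a) Pr
  indep_coin : iIndepFun (fun a ω => (W ω).coin a) Pr
  indep_work_coin : IndepFun (fun ω => (W ω).work) (fun ω => (W ω).coin) Pr
  indep_gap_rest : IndepFun (fun ω => (W ω).gap) (fun ω => ((W ω).work, (W ω).coin)) Pr
  indep_init_rest :
    IndepFun (fun ω => (W ω).init) (fun ω => ((W ω).gap, (W ω).work, (W ω).coin)) Pr

/-! ### Continuous-time Markov chains -/

/-- `P` is a stochastic transition function on the countable state space `V`, with transition rates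
`Q` (right derivative at time `0`). -/
structure IsTransitionFunction {S : Type*} (V : Set S) (Q : S → S → ℝ)
    (P : ℝ≥0 → V → V → ℝ) : Prop where
  nonneg : ∀ t x y, 0 ≤ P t x y
  sum_one : ∀ t x, HasSum (fun y => P t x y) 1
  zero_self : ∀ x, P 0 x x = 1
  zero_ne : ∀ x y, x ≠ y → P 0 x y = 0
  chapman_kolmogorov : ∀ s t x y, HasSum (fun u => P s x u * P t u y) (P (s + t) x y)
  rates : ∀ x y,
    Tendsto (fun t : ℝ≥0 => (P t x y - P 0 x y) / (t : ℝ)) (𝓝[>] 0) (𝓝 (Q x y))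

/-- The `σ`-algebra of the events determined by the process up to time `s`. -/
@[reducible] def history {Ω S : Type*} [MeasurableSpace S] (X : ℝ≥0 → Ω → S) (s : ℝ≥0) : MeasurableSpace Ω :=
  ⨆ u : Set.Iic s, MeasurableSpace.comap (X u) inferInstance

/-- `X` is a (time-homogeneous, regular) continuous-time Markov chain with countable state space `V`
and transition rates `Q`: almost surely its paths stay in `V` and are right-continuous step
functions with left limits (for the discrete topology), and given the whole past up to
time `s`, the state at time `s + t` is distributed according to `P t (X s)`, for a stochastic
transition function `P` with rates `Q`. -/
structure IsCTMC {Ω S : Type*} [MeasurableSpace Ω] [MeasurableSpace S] (Pr : Measure Ω)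
    (X : ℝ≥0 → Ω → S) (V : Set S) (Q : S → S → ℝ) : Prop where
  countable : V.Countable
  measurable : ∀ t, Measurable (X t)
  mem_states : ∀ᵐ ω ∂Pr, ∀ t, X t ω ∈ V
  right_cont : ∀ᵐ ω ∂Pr, ∀ t, ∀ᶠ u in 𝓝[≥] t, X u ω = X t ω
  left_lim : ∀ᵐ ω ∂Pr, ∀ t, ∃ x, ∀ᶠ u in 𝓝[<] t, X u ω = x
  markov : ∃ P : ℝ≥0 → V → V → ℝ, IsTransitionFunction V Q P ∧
    ∀ (s t : ℝ≥0) (A : Set Ω), MeasurableSet[history X s] A → ∀ x y : V,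
      Pr.real (A ∩ {ω | X s ω = x} ∩ {ω | X (s + t) ω = y}) =
        Pr.real (A ∩ {ω | X s ω = x}) * P t x y

/-! ### State space and transition rates of the aggregate process -/

/-- `N_i(y)`: the number of servers available to stage `i` when the occupancies are `y`:
`n - k + 1` for `i = k - 1`, and `1 + N_{i+1}(y) 1{y_{i+1} = 0}` for `i < k - 1`. -/
def numServers (n : ℕ) {k : ℕ} (y : Fin k → ℕ) (i : Fin k) : ℕ :=
  if h : i.val + 1 < k then
    1 + (if y ⟨i.val + 1, h⟩ = 0 then numServers n y ⟨i.val + 1, h⟩ else 0)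
  else n - k + 1
termination_by k - i.val

/-- The number of servers available to stage `i` in state `z`. -/
def N (n : ℕ) {k : ℕ} (z : State k) (i : Fin k) : ℕ := numServers n (fun m => (z m).1) i

/-- The possible states: at a stage without queries there are no high-rate servers, and at every
stage there are at most as many as there are servers available. -/
def states (n k : ℕ) : Set (State k) :=
  {z | ∀ i, (z i).2 ≤ N n z i ∧ ((z i).1 = 0 → (z i).2 = 0)}

/-- Probability that a binomial variable with parameters `f`, `p` takes the value `b`. -/
def binomialWeight (f : ℕ) (p : ℝ) (b : ℕ) : ℝ := (f.choose b : ℝ) * p ^ b * (1 - p) ^ (f - b)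

/-- The stage of the oldest query with at most `i` responses, if there is any. -/
def nextStage {k : ℕ} (z : State k) (i : Fin k) : WithBot (Fin k) :=
  (Finset.univ.filter fun m => m ≤ i ∧ 0 < (z m).1).max

/-- `b` high-rate services begin at stage `m` (nothing happens if there is no such stage). -/
def addHigh {k : ℕ} (z : State k) (m : WithBot (Fin k)) (b : ℕ) : State k :=
  fun i => if m = (i : WithBot (Fin k)) then ((z i).1, (z i).2 + b) else z i

/-- Probability that state `z` turns into `z'` when `f` servers begin to serve the query at stage
`m`, each of them at the high rate with probability `p`. -/
def selectProb {k : ℕ} (p : ℝ) (f : ℕ) (z : State k) (m : WithBot (Fin k)) (z' : State k) : ℝ :=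
  ∑ b ∈ Finset.range (f + 1), binomialWeight f p b * (if z' = addHigh z m b then 1 else 0)

/-- A query joins stage `0`. -/
def afterArrival {k : ℕ} [NeZero k] (z : State k) : State k :=
  Function.update z 0 ((z 0).1 + 1, (z 0).2)

/-- The rate of going from `z` to `z'` by an arrival: if stage `0` was empty, all servers available
to it begin to serve the new query. -/
def arrivalRate (n : ℕ) {k : ℕ} [NeZero k] (lam p : ℝ) (z z' : State k) : ℝ :=
  lam * selectProb p (if (z 0).1 = 0 then N n z 0 else 0) (afterArrival z) (0 : Fin k) z'

/-- The head query of stage `i` gets a response from a server of high rate (`r = 1`) or low rate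
(`r = 0`). It moves on to stage `i + 1`, together with the other servers working on it; if
`i = k - 1` it leaves and all the servers working on it stop. -/
def afterResponse {k : ℕ} (z : State k) (i : Fin k) (r : ℕ) : State k := fun m =>
  if m = i then ((z i).1 - 1, 0)
  else if m.val = i.val + 1 then ((z m).1 + 1, (z m).2 + ((z i).2 - r))
  else z m

/-- The number of servers that are freed by a response at stage `i`: one if `i < k - 1`, and all
the `n - k + 1` servers that were working on the query if `i = k - 1`. -/
def freed (n : ℕ) {k : ℕ} (i : Fin k) : ℕ := if i.val + 1 < k then 1 else n - k + 1

/-- The rate of going from `z` to `z'` by a response at stage `i`: the servers that are freed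
begin to serve the oldest query with at most `i` responses. -/
def responseRate (n : ℕ) {k : ℕ} (μ₀ μ₁ p : ℝ) (z : State k) (i : Fin k) (z' : State k) : ℝ :=
  if (z i).1 = 0 then 0
  else
    (z i).2 * μ₁ *
        selectProb p (freed n i) (afterResponse z i 1) (nextStage (afterResponse z i 1) i) z' +
      ((N n z i : ℝ) - (z i).2) * μ₀ *
        selectProb p (freed n i) (afterResponse z i 0) (nextStage (afterResponse z i 0) i) z'

/-- The total rate of leaving state `z`. -/
def exitRate (n : ℕ) {k : ℕ} (lam μ₀ μ₁ : ℝ) (z : State k) : ℝ :=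
  lam + ∑ i, if (z i).1 = 0 then 0 else (z i).2 * μ₁ + ((N n z i : ℝ) - (z i).2) * μ₀

/-- The transition rate matrix. -/
def Q (n : ℕ) {k : ℕ} [NeZero k] (lam μ₀ μ₁ p : ℝ) (z z' : State k) : ℝ :=
  arrivalRate n lam p z z' + ∑ i, responseRate n μ₀ μ₁ p z i z' -
    (if z' = z then exitRate n lam μ₀ μ₁ z else 0)

end ForkJoin

end

open scoped ENNReal

noncomputable section

namespace ForkJoin

/-! ### Order statistics -/

/-! The full snapshot of the system (the response set of each query present and the rate of each
service under way) evolves by memoryless clocks and fresh coins, and the aggregate state is a strong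
lumping of it. Under FCFS the response sets form a chain, so queries with equally many responses
have the same response set, and all servers at a stage work on one query. Hence the occupancies
alone determine how many servers work at each stage (`Config.ncard_onStage`), and both the total
event rate and the law of the aggregate state after the next event depend on the snapshot only
through its aggregate state (`totalRate_eq_exitRate`, `jumpMean_toState`).

Paths are explicit functions of the initial snapshot and the noise, and the link to Markov arguments
is a pathwise restart. If nothing happens before time `r`, the system seen from `r` is again such a
system, with an updated snapshot and shortened clocks, because the recursion for service times is
built from operations compatible with the monotone map `after r` (`Input.IsRestart.stateAt_eq`).
Integrating over the first event, by memorylessness of the clocks and independence of the coins,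
gives the renewal equation `expect_renewal` for the mean of a path functional after time `s`,
started from a snapshot.

All rates are bounded by `maxRate`, so on a bounded time interval the renewal equation contracts
differences by a factor below one. With lumpability this gives `expect_eq_of_zero`: if the means of
two functionals agree at time zero for any two snapshots with the same aggregate state, they agree
in this sense at all times. Such pairs (`LumpEq`) are therefore stable under shifting the path, and
also under multiplication by a function of the initial state; alternating the two operations inserts
an arbitrary finite past (`LumpEq.cylinder`). The Markov property is this applied to
`lumpEq_transition`, which at time zero is just the definition of the transition function, followed
by a π-λ argument. Chapman–Kolmogorov and almost sure confinement to `states` at fixed times come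
from the same principle, and the rates come from expanding the renewal equation to first order.

Regularity of the paths is deterministic once finitely many queries arrive in bounded time: the
state then depends on time only through comparison with finitely many instants. -/

lemma kthSmallest_le_iff {n k : ℕ} (hk : 1 ≤ k) (hkn : k ≤ n) (x : Fin n → ℝ) (t : ℝ) :
    Input.kthSmallest k x ≤ t ↔ k ≤ {j | x j ≤ t}.ncard := by
  have hn : Nonempty (Fin n) := ⟨⟨0, by omega⟩⟩
  set S : Set ℝ := {t : ℝ | k ≤ {j | x j ≤ t}.ncard} with hS
  have hmono : ∀ s t, s ≤ t → s ∈ S → t ∈ S := fun s t hst hs =>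
    le_trans (b := {j | x j ≤ s}.ncard) hs
      (Set.ncard_le_ncard (fun j (hj : x j ≤ s) => hj.trans hst) (Set.toFinite _))
  -- Closedness makes the infimum attained. The set is a finite union, over index sets with at least
  -- `k` elements, of finite intersections of closed half-lines.
  have hclosed : IsClosed S := by
    have : S = ⋃ T ∈ (Finset.univ.filter fun T : Finset (Fin n) => k ≤ T.card),
        ⋂ j ∈ T, Set.Ici (x j) := by
      ext t
      simp only [hS, Set.mem_ofPred_eq, Finset.mem_filter, Finset.mem_univ, true_and,
        Set.mem_iUnion, Set.mem_iInter, Set.mem_Ici, exists_prop]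
      constructor
      · intro h
        refine ⟨{j | x j ≤ t}.toFinite.toFinset, ?_, by simp⟩
        rwa [← Set.ncard_eq_toFinset_card]
      · rintro ⟨T, hT, hle⟩
        refine hT.trans ?_
        rw [← Set.ncard_coe_finset]
        exact Set.ncard_le_ncard (fun j hj => hle j hj) (Set.toFinite _)
    rw [this]
    exact Set.Finite.isClosed_biUnion (Finset.finite_toSet _) fun T _ =>
      isClosed_biInter fun j _ => isClosed_Ici
  -- For `k = 0` the set would be all of `ℝ`; `1 ≤ k` forces some `x j ≤ s`.
  have hbdd : BddBelow S := by
    obtain ⟨j₀, hj₀⟩ := Finite.exists_min x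
    refine ⟨x j₀, fun s hs => ?_⟩
    have : {j | x j ≤ s}.Nonempty := by
      rw [← Set.ncard_pos]
      exact lt_of_lt_of_le hk hs
    obtain ⟨j, hj⟩ := this
    exact (hj₀ j).trans hj
  have hne : S.Nonempty := by
    obtain ⟨j₀, hj₀⟩ := Finite.exists_max x
    refine ⟨x j₀, ?_⟩
    have : {j | x j ≤ x j₀} = Set.univ := Set.eq_univ_of_forall hj₀
    simpa [hS, this] using hkn
  exact ⟨fun h => hmono _ _ h (hclosed.csInf_mem hne hbdd), fun h => csInf_le hbdd h⟩

/-- The instant `x`, seen from time `r`; instants before `r` are moved to `r`. -/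
def after (r x : ℝ) : ℝ := max (x - r) 0

lemma after_nonneg (r x : ℝ) : 0 ≤ after r x := le_max_right _ _

lemma after_le_iff {r x t : ℝ} (ht : 0 ≤ t) : after r x ≤ t ↔ x ≤ r + t := by
  rw [after, max_le_iff]
  constructor
  · rintro ⟨h, -⟩; linarith
  · intro h; exact ⟨by linarith, ht⟩

lemma lt_after_iff {r x t : ℝ} (ht : 0 ≤ t) : t < after r x ↔ r + t < x := by
  rw [← not_le, after_le_iff ht, not_le]

lemma after_monotone (r : ℝ) : Monotone (after r) := fun x y h => by
  unfold after; gcongr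

lemma after_of_le {r x : ℝ} (h : x ≤ r) : after r x = 0 := by
  rw [after, max_eq_right]; linarith

lemma after_of_ge {r x : ℝ} (h : r ≤ x) : after r x = x - r := by
  rw [after, max_eq_left]; linarith

/-- An order statistic commutes with a nondecreasing map. This is checked on lower half-lines; for
negative `t` both sides fail, since `after r` is nonnegative and `k` positive. -/
lemma kthSmallest_after {n k : ℕ} (hk : 1 ≤ k) (hkn : k ≤ n) (r : ℝ) (x : Fin n → ℝ) :
    Input.kthSmallest k (fun j => after r (x j)) = after r (Input.kthSmallest k x) := by
  refine eq_of_forall_ge_iff fun t => ?_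
  rw [kthSmallest_le_iff hk hkn]
  rcases le_or_gt 0 t with ht | ht
  · simp only [after_le_iff ht, kthSmallest_le_iff hk hkn]
  · have h1 : ∀ y, ¬ after r y ≤ t := fun y h => by
      have := after_nonneg r y; linarith
    simp only [h1, Set.ofPred_false, Set.ncard_empty, iff_false]
    omega

/-! ### Restarting the system at a later time -/

namespace Input

variable {n k : ℕ} {μ₀ μ₁ : ℝ}

/-- The aggregate state at a real time. -/
def stateAt (μ₀ μ₁ : ℝ) (w : Input n k) (t : ℝ) : State k :=
  fun i => (w.Y μ₀ μ₁ t i, w.H μ₀ μ₁ t i)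

lemma free_succ (w : Input n k) (l : ℕ) (j : Fin n) :
    w.free μ₀ μ₁ (l + 1) j = min (w.completion μ₀ μ₁ l j) (w.departure μ₀ μ₁ l) := rfl

lemma free_zero (w : Input n k) (j : Fin n) : w.free μ₀ μ₁ 0 j = 0 := rfl

/-- `w'` describes the system `w` from time `r` on, the first `d` queries of `w` having left. -/
structure IsRestart (μ₀ μ₁ : ℝ) (w w' : Input n k) (r : ℝ) (d : ℕ) : Prop where
  free_le : ∀ j, w.free μ₀ μ₁ d j ≤ r
  departure_le : ∀ l < d, w.departure μ₀ μ₁ l ≤ r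
  arrival_eq : ∀ l, w'.arrival l = after r (w.arrival (l + d))
  service_eq : ∀ l j, after r (w.start μ₀ μ₁ (l + d) j) + w'.service μ₀ μ₁ j l =
    after r (w.completion μ₀ μ₁ (l + d) j)
  isHigh_eq : ∀ l j, w'.service μ₀ μ₁ j l ≠ 0 → w'.isHigh j l = w.isHigh j (l + d)

namespace IsRestart

variable {w w' : Input n k} {r : ℝ} {d : ℕ}

/-- The recursion for `free` uses `max`, `min`, the `k`-th smallest value and the addition of
service times. The first three commute with `after r` and the last is covered by `service_eq`, so
the recursion of the restarted system is the image of the original one. -/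
lemma free_eq (hk : 1 ≤ k) (hkn : k ≤ n) (h : IsRestart μ₀ μ₁ w w' r d) (l : ℕ) (j : Fin n) :
    w'.free μ₀ μ₁ l j = after r (w.free μ₀ μ₁ (l + d) j) := by
  induction l generalizing j with
  | zero => rw [free_zero, zero_add, after_of_le (h.free_le j)]
  | succ l ih =>
    have hc : ∀ j, w'.completion μ₀ μ₁ l j = after r (w.completion μ₀ μ₁ (l + d) j) := by
      intro j
      rw [← h.service_eq, completion, start, h.arrival_eq, ih,
        ← (after_monotone r).map_max]
      rfl
    rw [free_succ, show l + 1 + d = l + d + 1 by ring, free_succ, (after_monotone r).map_min, hc]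
    congr 1
    rw [departure, departure, ← kthSmallest_after hk hkn]
    exact congrArg _ (funext hc)

lemma start_eq (hk : 1 ≤ k) (hkn : k ≤ n) (h : IsRestart μ₀ μ₁ w w' r d) (l : ℕ) (j : Fin n) :
    w'.start μ₀ μ₁ l j = after r (w.start μ₀ μ₁ (l + d) j) := by
  rw [start, start, h.arrival_eq, h.free_eq hk hkn, (after_monotone r).map_max]

lemma completion_eq (hk : 1 ≤ k) (hkn : k ≤ n) (h : IsRestart μ₀ μ₁ w w' r d) (l : ℕ)
    (j : Fin n) :
    w'.completion μ₀ μ₁ l j = after r (w.completion μ₀ μ₁ (l + d) j) := by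
  rw [← h.service_eq, completion, h.start_eq hk hkn]

lemma departure_eq (hk : 1 ≤ k) (hkn : k ≤ n) (h : IsRestart μ₀ μ₁ w w' r d) (l : ℕ) :
    w'.departure μ₀ μ₁ l = after r (w.departure μ₀ μ₁ (l + d)) := by
  rw [departure, departure, ← kthSmallest_after hk hkn]
  exact congrArg _ (funext (h.completion_eq hk hkn l))

lemma atStage_iff (hk : 1 ≤ k) (hkn : k ≤ n) (h : IsRestart μ₀ μ₁ w w' r d) {t : ℝ}
    (ht : 0 ≤ t) (i l : ℕ) :
    w'.atStage μ₀ μ₁ t i l ↔ w.atStage μ₀ μ₁ (r + t) i (l + d) := by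
  simp only [atStage, h.completion_eq hk hkn, h.departure_eq hk hkn, h.arrival_eq,
    after_le_iff ht, lt_after_iff ht]

lemma serving_iff (hk : 1 ≤ k) (hkn : k ≤ n) (h : IsRestart μ₀ μ₁ w w' r d) {t : ℝ}
    (ht : 0 ≤ t) (j : Fin n) (l : ℕ) :
    w'.serving μ₀ μ₁ t j l ↔ w.serving μ₀ μ₁ (r + t) j (l + d) := by
  simp only [serving, h.completion_eq hk hkn, h.departure_eq hk hkn, h.start_eq hk hkn,
    after_le_iff ht, lt_after_iff ht]

/-- All instants of the restarted system are images under `after r` of the original ones, so their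
comparisons with `t ≥ 0` are those of the originals with `r + t`. The first `d` queries have left by
time `r` and contribute nothing; the remaining ones are relabelled by `d`. -/
lemma stateAt_eq (hk : 1 ≤ k) (hkn : k ≤ n) (h : IsRestart μ₀ μ₁ w w' r d) {t : ℝ}
    (ht : 0 ≤ t) : w'.stateAt μ₀ μ₁ t = w.stateAt μ₀ μ₁ (r + t) := by
  have hd : ∀ i l, w.atStage μ₀ μ₁ (r + t) i l → ∃ l', l = l' + d := by
    intro i l hl
    by_contra hcon
    have hld : l < d := by
      by_contra h'
      exact hcon ⟨l - d, by omega⟩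
    have h1 := h.departure_le l hld
    have h2 := hl.2.1
    linarith
  funext i
  refine Prod.ext ?_ ?_
  · change w'.Y μ₀ μ₁ t i = w.Y μ₀ μ₁ (r + t) i
    have : {l | w.atStage μ₀ μ₁ (r + t) i l} = (· + d) '' {l | w'.atStage μ₀ μ₁ t i l} := by
      ext l
      simp only [Set.mem_ofPred_eq, Set.mem_image, h.atStage_iff hk hkn ht]
      constructor
      · intro hl
        obtain ⟨l', rfl⟩ := hd i l hl
        exact ⟨l', hl, rfl⟩
      · rintro ⟨l', hl', rfl⟩
        exact hl'
    rw [Y, Y, this, Set.ncard_image_of_injective _ (add_left_injective d)]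
  · change w'.H μ₀ μ₁ t i = w.H μ₀ μ₁ (r + t) i
    rw [H, H]
    congr 1
    ext j
    simp only [Set.mem_ofPred_eq]
    -- The selected rates may disagree where the service time vanishes, but then the server is never
    -- serving that query.
    have hne : ∀ l, w'.serving μ₀ μ₁ t j l → w'.isHigh j l = w.isHigh j (l + d) := by
      intro l hl
      refine h.isHigh_eq l j fun h0 => ?_
      have h1 := hl.1
      have h2 := hl.2.1
      rw [completion, h0] at h2
      linarith
    constructor
    · rintro ⟨l, hl1, hl2, hl3⟩
      exact ⟨l + d, (h.serving_iff hk hkn ht j l).1 hl1, (h.atStage_iff hk hkn ht i l).1 hl2,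
        by rw [← hne l hl1, hl3]⟩
    · rintro ⟨l, hl1, hl2, hl3⟩
      obtain ⟨l', rfl⟩ := hd i l hl2
      have hs := (h.serving_iff hk hkn ht j l').2 hl1
      exact ⟨l', hs, (h.atStage_iff hk hkn ht i l').2 hl2, by rw [hne l' hs, hl3]⟩

end IsRestart

end Input
end ForkJoin

/-! ### Snapshots and periods without events -/

namespace ForkJoin

/-- The service rate selected by a coin. -/
def speed (μ₀ μ₁ : ℝ) (b : Bool) : ℝ := if b then μ₁ else μ₀

lemma speed_pos {μ₀ μ₁ : ℝ} (h₀ : 0 < μ₀) (h₁ : 0 < μ₁) (b : Bool) : 0 < speed μ₀ μ₁ b := by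
  unfold speed; split_ifs <;> assumption

namespace Config

variable {n k : ℕ}

/-- Server `j` has responded to query `l` of the snapshot. -/
def responded (c : Config n k) (j : Fin n) (l : ℕ) : Prop :=
  ∃ s, c.queries[l]? = some s ∧ j ∈ s

/-- Server `j` is serving query `l` of the snapshot. -/
def served (c : Config n k) (j : Fin n) (l : ℕ) : Prop :=
  l < c.queries.length ∧ ¬ c.responded j l ∧ ∀ l' < l, c.responded j l'

lemma responded_iff_of_lt {c : Config n k} {j : Fin n} {l : ℕ} (hl : l < c.queries.length) :
    c.responded j l ↔ j ∈ c.queries[l] := by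
  simp [responded, List.getElem?_eq_getElem hl]

lemma responded_lt {c : Config n k} {j : Fin n} {l : ℕ} (h : c.responded j l) :
    l < c.queries.length := by
  obtain ⟨s, hs, -⟩ := h
  exact (List.getElem?_eq_some_iff.1 hs).1

lemma subset_of_le (c : Config n k) {l l' : ℕ} (h : l' ≤ l) (hl : l < c.queries.length) :
    c.queries[l] ⊆ c.queries[l']'(h.trans_lt hl) := by
  rcases h.eq_or_lt with rfl | h
  · exact Finset.Subset.refl _
  · exact List.pairwise_iff_getElem.1 c.nested l' l _ hl h

/-- Response sets decrease along the list. The queries answered by a server thus form an initial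
segment, and it serves the first query beyond that segment. -/
lemma responded_of_le {c : Config n k} {j : Fin n} {l l' : ℕ} (h : c.responded j l)
    (hl : l' ≤ l) : c.responded j l' := by
  have h1 := responded_lt h
  rw [responded_iff_of_lt h1] at h
  rw [responded_iff_of_lt (hl.trans_lt h1)]
  exact c.subset_of_le hl h1 h

lemma served_unique {c : Config n k} {j : Fin n} {l l' : ℕ} (h : c.served j l)
    (h' : c.served j l') : l = l' := by
  rcases lt_trichotomy l l' with hl | hl | hl
  · exact absurd (h'.2.2 l hl) h.2.1
  · exact hl
  · exact absurd (h.2.2 l' hl) h'.2.1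

/-- The position of the query served by server `j`; the number of queries if `j` is idle. -/
def servedIdx (c : Config n k) (j : Fin n) : ℕ := c.queries.findIdx fun s => decide (j ∉ s)

lemma served_iff {c : Config n k} {j : Fin n} {l : ℕ} :
    c.served j l ↔ l < c.queries.length ∧ l = c.servedIdx j := by
  have key : ∀ hl : c.servedIdx j < c.queries.length, c.served j (c.servedIdx j) := by
    intro hl
    refine ⟨hl, ?_, fun l' hl' => ?_⟩
    · rw [responded_iff_of_lt hl]
      simpa [servedIdx] using List.findIdx_getElem (w := hl)
    · rw [responded_iff_of_lt (hl'.trans hl)]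
      simpa using List.not_of_lt_findIdx hl'
  constructor
  · intro h
    refine ⟨h.1, ?_⟩
    have hle : c.servedIdx j ≤ l := by
      by_contra hcon
      push Not at hcon
      have := List.not_of_lt_findIdx hcon
      apply h.2.1
      rw [responded_iff_of_lt h.1]
      simpa using this
    exact served_unique h (key (hle.trans_lt h.1))
  · rintro ⟨h1, rfl⟩
    exact key h1

/-- The coordinates of the services under way. -/
def active (c : Config n k) : Finset (Fin n × ℕ) :=
  (Finset.univ.filter fun j => c.servedIdx j < c.queries.length).image fun j => (j, c.servedIdx j)

lemma mem_active {c : Config n k} {j : Fin n} {l : ℕ} : (j, l) ∈ c.active ↔ c.served j l := by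
  rw [served_iff]
  simp only [active, Finset.mem_image, Finset.mem_filter, Finset.mem_univ, true_and,
    Prod.mk.injEq]
  constructor
  · rintro ⟨j, h, rfl, rfl⟩; exact ⟨h, rfl⟩
  · rintro ⟨h, rfl⟩; exact ⟨j, h, rfl, rfl⟩

end Config

namespace Input

variable {n k : ℕ} {μ₀ μ₁ : ℝ}

lemma service_of_responded {w : Input n k} {j : Fin n} {l : ℕ} (h : w.init.responded j l) :
    w.service μ₀ μ₁ j l = 0 := if_pos h

lemma service_of_not_responded {w : Input n k} {j : Fin n} {l : ℕ}
    (h : ¬ w.init.responded j l) :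
    w.service μ₀ μ₁ j l = w.work (j, l) / speed μ₀ μ₁ (w.isHigh j l) := if_neg h

lemma isHigh_of_served {w : Input n k} {j : Fin n} {l : ℕ} (h : w.init.served j l) :
    w.isHigh j l = w.init.rate j := if_pos h

lemma isHigh_of_not_served {w : Input n k} {j : Fin n} {l : ℕ} (h : ¬ w.init.served j l) :
    w.isHigh j l = w.coin (j, l) := if_neg h

/-- Nothing happens before time `r`. -/
structure IsQuiet (μ₀ μ₁ : ℝ) (w : Input n k) (r : ℝ) : Prop where
  nonneg : 0 ≤ r
  le_gap : r ≤ w.gap 0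
  gap_nonneg : ∀ m, 0 ≤ w.gap m
  work_nonneg : ∀ a, 0 ≤ w.work a
  le_work : ∀ j l, w.init.served j l → r ≤ w.work (j, l) / speed μ₀ μ₁ (w.init.rate j)

namespace IsQuiet

variable {w : Input n k} {r : ℝ}

lemma le_arrival (h : IsQuiet μ₀ μ₁ w r) {l : ℕ} (hl : w.initCount ≤ l) : r ≤ w.arrival l := by
  rw [arrival, if_neg (by omega)]
  refine h.le_gap.trans ?_
  exact Finset.single_le_sum (f := w.gap) (fun m _ => h.gap_nonneg m) (by simp)

lemma arrival_nonneg (h : IsQuiet μ₀ μ₁ w r) (l : ℕ) : 0 ≤ w.arrival l := by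
  rcases lt_or_ge l w.initCount with hl | hl
  · rw [arrival, if_pos hl]
  · exact h.nonneg.trans (h.le_arrival hl)

lemma service_nonneg (h₀ : 0 < μ₀) (h₁ : 0 < μ₁) (h : IsQuiet μ₀ μ₁ w r) (j : Fin n) (l : ℕ) :
    0 ≤ w.service μ₀ μ₁ j l := by
  by_cases hr : w.init.responded j l
  · rw [service_of_responded hr]
  · rw [service_of_not_responded hr]
    exact div_nonneg (h.work_nonneg _) (speed_pos h₀ h₁ _).le

lemma arrival_of_responded {j : Fin n} {l : ℕ} (hl : w.init.responded j l) :
    w.arrival l = 0 := if_pos (Config.responded_lt hl)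

lemma completion_of_responded_of_free {j : Fin n} {l : ℕ} (hl : w.init.responded j l)
    (hf : w.free μ₀ μ₁ l j = 0) : w.completion μ₀ μ₁ l j = 0 := by
  rw [completion, start, hf, arrival_of_responded hl, service_of_responded hl]
  simp

/-- A missing response cannot come before `r` for one of three reasons: the server is held by an
older query, the service is under way and its clock outlasts `r`, or the query has not arrived
before `r`. -/
lemma le_completion_of_free (h₀ : 0 < μ₀) (h₁ : 0 < μ₁) (h : IsQuiet μ₀ μ₁ w r) {j : Fin n}
    {l : ℕ} (hf : (∃ l' < l, ¬ w.init.responded j l') → r ≤ w.free μ₀ μ₁ l j)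
    (hl : ¬ w.init.responded j l) : r ≤ w.completion μ₀ μ₁ l j := by
  have hs := h.service_nonneg h₀ h₁ j l
  rw [completion]
  by_cases hex : ∃ l' < l, ¬ w.init.responded j l'
  · have := hf hex
    have := le_max_right (w.arrival l) (w.free μ₀ μ₁ l j)
    rw [start]; linarith
  · push Not at hex
    rcases lt_or_ge l w.initCount with hlt | hge
    · have hsv : w.init.served j l := ⟨hlt, hl, hex⟩
      rw [service_of_not_responded hl, isHigh_of_served hsv]
      have := h.le_work j l hsv
      have := le_max_left (w.arrival l) (w.free μ₀ μ₁ l j)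
      have := h.arrival_nonneg l
      rw [start]; linarith
    · have := h.le_arrival hge
      have := le_max_left (w.arrival l) (w.free μ₀ μ₁ l j)
      rw [start]; linarith

/-- Strictly before `r` only the responses recorded in the snapshot can count, and these are fewer
than `k`. -/
lemma le_departure_of_completion (hk : 1 ≤ k) (hkn : k ≤ n) {l : ℕ}
    (hc : ∀ j, ¬ w.init.responded j l → r ≤ w.completion μ₀ μ₁ l j) :
    r ≤ w.departure μ₀ μ₁ l := by
  by_contra hcon
  push Not at hcon
  obtain ⟨t, ht1, ht2⟩ := exists_between hcon
  have h1 := (kthSmallest_le_iff hk hkn _ _).1 ht1.le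
  have h2 : {j | w.completion μ₀ μ₁ l j ≤ t} ⊆ {j | w.init.responded j l} := by
    intro j hj
    by_contra hr
    have := hc j hr
    have hj' : w.completion μ₀ μ₁ l j ≤ t := hj
    linarith
  have h3 := h1.trans (Set.ncard_le_ncard h2 (Set.toFinite _))
  rcases lt_or_ge l w.init.queries.length with hl | hl
  · have h4 : {j | w.init.responded j l} = (w.init.queries[l] : Set (Fin n)) := by
      ext j; simp [Config.responded_iff_of_lt hl]
    rw [h4, Set.ncard_coe_finset] at h3
    exact absurd (w.init.card_lt _ (List.getElem_mem hl)) (by omega)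
  · have h4 : {j | w.init.responded j l} = ∅ := by
      ext j
      simp only [Set.mem_ofPred_eq, Set.mem_empty_iff_false, iff_false]
      intro hr
      exact absurd (Config.responded_lt hr) (by omega)
    rw [h4, Set.ncard_empty] at h3
    omega

/-- The two alternatives are proved together by induction on the query number: the bound on the
completions of a query, for all servers, bounds its departure, and both bound the time at which a
server turns to the next query. -/
lemma free_early (hk : 1 ≤ k) (hkn : k ≤ n) (h₀ : 0 < μ₀) (h₁ : 0 < μ₁)
    (h : IsQuiet μ₀ μ₁ w r) (l : ℕ) (j : Fin n) :
    ((∀ l' < l, w.init.responded j l') → w.free μ₀ μ₁ l j = 0) ∧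
      ((∃ l' < l, ¬ w.init.responded j l') → r ≤ w.free μ₀ μ₁ l j) := by
  induction l generalizing j with
  | zero => exact ⟨fun _ => rfl, by rintro ⟨l', hl', -⟩; omega⟩
  | succ l ih =>
    have hcomp : ∀ j, ¬ w.init.responded j l → r ≤ w.completion μ₀ μ₁ l j := fun j hj =>
      h.le_completion_of_free h₀ h₁ (ih j).2 hj
    have hdep := le_departure_of_completion hk hkn hcomp
    rw [free_succ]
    constructor
    · intro hall
      rw [completion_of_responded_of_free (hall l (by omega))
        ((ih j).1 fun l' hl' => hall l' (by omega))]
      exact min_eq_left (h.nonneg.trans hdep)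
    · rintro ⟨l', hl', hr⟩
      refine le_min (hcomp j fun hrl => hr ?_) hdep
      exact Config.responded_of_le hrl (by omega)

variable (hk : 1 ≤ k) (hkn : k ≤ n) (h₀ : 0 < μ₀) (h₁ : 0 < μ₁) (h : IsQuiet μ₀ μ₁ w r)

include hk hkn h₀ h₁ h

lemma start_of_responded {j : Fin n} {l : ℕ} (hl : w.init.responded j l) :
    w.start μ₀ μ₁ l j = 0 := by
  rw [start, arrival_of_responded hl, (h.free_early hk hkn h₀ h₁ l j).1
    fun l' hl' => Config.responded_of_le hl hl'.le]
  simp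

lemma completion_of_responded {j : Fin n} {l : ℕ} (hl : w.init.responded j l) :
    w.completion μ₀ μ₁ l j = 0 := by
  rw [completion, h.start_of_responded hk hkn h₀ h₁ hl, service_of_responded hl, add_zero]

lemma start_of_served {j : Fin n} {l : ℕ} (hl : w.init.served j l) :
    w.start μ₀ μ₁ l j = 0 := by
  rw [start, (h.free_early hk hkn h₀ h₁ l j).1 hl.2.2, arrival,
    if_pos (show l < w.initCount from hl.1)]
  simp

lemma completion_of_served {j : Fin n} {l : ℕ} (hl : w.init.served j l) :
    w.completion μ₀ μ₁ l j = w.work (j, l) / speed μ₀ μ₁ (w.init.rate j) := by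
  rw [completion, h.start_of_served hk hkn h₀ h₁ hl, zero_add, service_of_not_responded hl.2.1,
    isHigh_of_served hl]

lemma le_completion {j : Fin n} {l : ℕ} (hl : ¬ w.init.responded j l) :
    r ≤ w.completion μ₀ μ₁ l j :=
  h.le_completion_of_free h₀ h₁ (h.free_early hk hkn h₀ h₁ l j).2 hl

lemma le_start {j : Fin n} {l : ℕ} (hl : ¬ w.init.responded j l) (hl' : ¬ w.init.served j l) :
    r ≤ w.start μ₀ μ₁ l j := by
  rcases lt_or_ge l w.initCount with hlt | hge
  · refine le_trans ((h.free_early hk hkn h₀ h₁ l j).2 ?_) (le_max_right _ _)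
    by_contra hcon
    push Not at hcon
    exact hl' ⟨hlt, hl, hcon⟩
  · exact (h.le_arrival hge).trans (le_max_left _ _)

lemma le_departure (l : ℕ) : r ≤ w.departure μ₀ μ₁ l :=
  le_departure_of_completion hk hkn fun _ hj => h.le_completion hk hkn h₀ h₁ hj

omit hk hkn h₀ h₁ h

/-- Criterion for a restart at a time `r` before which nothing happens; the responses `D` are
given at time `r`. -/
lemma isRestart (hk : 1 ≤ k) (hkn : k ≤ n) (h₀ : 0 < μ₀) (h₁ : 0 < μ₁) (h : IsQuiet μ₀ μ₁ w r)
    {w' : Input n k} {d : ℕ} {D : Fin n → ℕ → Prop}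
    (hfree : ∀ j, w.free μ₀ μ₁ d j ≤ r) (hdep : ∀ l < d, w.departure μ₀ μ₁ l ≤ r)
    (harr : ∀ l, w'.arrival l = after r (w.arrival (l + d)))
    (hresp : ∀ j l, w'.init.responded j l ↔ w.init.responded j (l + d) ∨ D j (l + d))
    (hlen : w.initCount ≤ w'.initCount + d)
    (hD : ∀ j l, D j l → w.init.served j l ∧
      w.work (j, l) / speed μ₀ μ₁ (w.init.rate j) = r)
    (hrate : ∀ j l, w'.init.served j l → w.init.served j (l + d) →
      w'.init.rate j = w.init.rate j)
    (hrate' : ∀ j l, w'.init.served j l → ¬ w.init.served j (l + d) →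
      w'.init.rate j = w.coin (j, l + d))
    (hcoin : ∀ j l, ¬ w'.init.served j l → w'.coin (j, l) = w.coin (j, l + d))
    (hwork : ∀ j l, ¬ w'.init.responded j l → w.init.served j (l + d) →
      w'.work (j, l) = w.work (j, l + d) - r * speed μ₀ μ₁ (w.init.rate j))
    (hwork' : ∀ j l, ¬ w'.init.responded j l → ¬ w.init.served j (l + d) →
      w'.work (j, l) = w.work (j, l + d)) :
    IsRestart μ₀ μ₁ w w' r d := by
  -- A service under way that does not end at `r` stays under way: all older queries keep their
  -- recorded responses, so the first unanswered query of the server is unchanged.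
  have hserved : ∀ j l, ¬ w'.init.responded j l → w.init.served j (l + d) →
      w'.init.served j l := by
    intro j l hr hs
    refine ⟨?_, hr, fun l' hl' => (hresp j l').2 (Or.inl (hs.2.2 _ (by omega)))⟩
    have h1 := hs.1
    change l < w'.initCount
    change l + d < w.initCount at h1
    omega
  have hhigh : ∀ j l, ¬ w'.init.responded j l → w'.isHigh j l = w.isHigh j (l + d) := by
    intro j l hr
    by_cases hs' : w'.init.served j l
    · rw [isHigh_of_served hs']
      by_cases hs : w.init.served j (l + d)
      · rw [isHigh_of_served hs, hrate j l hs' hs]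
      · rw [isHigh_of_not_served hs, hrate' j l hs' hs]
    · have hs : ¬ w.init.served j (l + d) := fun hs => hs' (hserved j l hr hs)
      rw [isHigh_of_not_served hs', isHigh_of_not_served hs, hcoin j l hs']
  refine ⟨hfree, hdep, harr, fun l j => ?_, fun l j hne => ?_⟩
  · by_cases hr' : w'.init.responded j l
    · rw [service_of_responded hr', add_zero]
      rcases (hresp j l).1 hr' with hr | hd
      · rw [h.start_of_responded hk hkn h₀ h₁ hr, h.completion_of_responded hk hkn h₀ h₁ hr]
      -- A response given exactly at `r`: the service began at `0` and ends at `r`, and both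
      -- instants are sent to `0`, in accordance with a vanishing service time.
      · obtain ⟨hs, hw⟩ := hD _ _ hd
        rw [h.start_of_served hk hkn h₀ h₁ hs, h.completion_of_served hk hkn h₀ h₁ hs, hw,
          after_of_le h.nonneg, after_of_le le_rfl]
    · have hr : ¬ w.init.responded j (l + d) := fun hr => hr' ((hresp j l).2 (Or.inl hr))
      rw [service_of_not_responded hr', hhigh j l hr']
      by_cases hs : w.init.served j (l + d)
      · have hsp := (speed_pos h₀ h₁ (w.init.rate j)).ne'
        rw [h.start_of_served hk hkn h₀ h₁ hs, after_of_le h.nonneg, hwork j l hr' hs,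
          after_of_ge (h.le_completion hk hkn h₀ h₁ hr), h.completion_of_served hk hkn h₀ h₁ hs,
          isHigh_of_served hs]
        field_simp
        ring
      · have hst := h.le_start hk hkn h₀ h₁ hr hs
        have hsv := h.service_nonneg h₀ h₁ j (l + d)
        rw [hwork' j l hr' hs, after_of_ge hst,
          after_of_ge (by rw [completion]; linarith), completion, service_of_not_responded hr]
        ring
  · refine hhigh j l fun hr => hne (service_of_responded hr)

end IsQuiet

end Input
end ForkJoin

/-! ### The snapshot after an arrival or a response, and the corresponding restarts -/

namespace ForkJoin

/-- Clocks `i ∈ A` running at speed `v i` for a time `r`. -/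
def shiftOn {ι : Type*} [DecidableEq ι] (A : Finset ι) (v : ι → ℝ) (r : ℝ) (x : ι → ℝ) : ι → ℝ :=
  fun i => if i ∈ A then x i - r * v i else x i

namespace Config

variable {n k : ℕ}

/-- The list of queries after an arrival (`none`) or a response by server `j` (`some j`). -/
def nextQueries (c : Config n k) : Option (Fin n) → List (Finset (Fin n))
  | none => c.queries ++ [∅]
  | some j => match c.queries[c.servedIdx j]? with
    | none => c.queries
    | some s => if s.card + 1 < k then c.queries.set (c.servedIdx j) (insert j s)
        else c.queries.tail

/-- The number of queries that leave at an event. -/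
def offset (c : Config n k) : Option (Fin n) → ℕ
  | none => 0
  | some j => match c.queries[c.servedIdx j]? with
    | none => 0
    | some s => if s.card + 1 < k then 0 else 1

lemma getElem?_servedIdx {c : Config n k} {j : Fin n} {l : ℕ} (h : c.served j l) :
    c.queries[c.servedIdx j]? = some (c.queries[l]'h.1) := by
  obtain ⟨h1, rfl⟩ := served_iff.1 h
  exact List.getElem?_eq_getElem h1

lemma nextQueries_of_lt {c : Config n k} {j : Fin n} {l : ℕ} (h : c.served j l)
    (hk : (c.queries[l]'h.1).card + 1 < k) :
    c.nextQueries (some j) = c.queries.set l (insert j (c.queries[l]'h.1)) := by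
  simp only [nextQueries, ← (served_iff.1 h).2, List.getElem?_eq_getElem h.1, if_pos hk]

lemma nextQueries_of_ge {c : Config n k} {j : Fin n} {l : ℕ} (h : c.served j l)
    (hk : k ≤ (c.queries[l]'h.1).card + 1) : c.nextQueries (some j) = c.queries.tail := by
  simp only [nextQueries, getElem?_servedIdx h, if_neg (not_lt.2 hk)]

lemma offset_of_lt {c : Config n k} {j : Fin n} {l : ℕ} (h : c.served j l)
    (hk : (c.queries[l]'h.1).card + 1 < k) : c.offset (some j) = 0 := by
  simp only [offset, getElem?_servedIdx h, if_pos hk]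

lemma offset_of_ge {c : Config n k} {j : Fin n} {l : ℕ} (h : c.served j l)
    (hk : k ≤ (c.queries[l]'h.1).card + 1) : c.offset (some j) = 1 := by
  simp only [offset, getElem?_servedIdx h, if_neg (not_lt.2 hk)]

lemma nextQueries_some (c : Config n k) (j : Fin n) :
    c.nextQueries (some j) = c.queries ∨ ∃ l, c.served j l := by
  by_cases h : c.servedIdx j < c.queries.length
  · exact Or.inr ⟨_, served_iff.2 ⟨h, rfl⟩⟩
  · left
    simp only [nextQueries, List.getElem?_eq_none (not_lt.1 h)]

/-- The responding server has already answered every older query, so enlarging this response set by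
it preserves the chain. -/
lemma nested_set {c : Config n k} {j : Fin n} {l : ℕ} (h : c.served j l) :
    (c.queries.set l (insert j (c.queries[l]'h.1))).Pairwise (fun s s' => s' ⊆ s) := by
  rw [List.pairwise_iff_getElem]
  intro a b ha hb hab
  simp only [List.length_set] at ha hb
  have hsub := c.subset_of_le hab.le hb
  rw [List.getElem_set, List.getElem_set]
  by_cases h1 : l = b
  · subst h1
    rw [if_pos rfl, if_neg (by omega)]
    refine Finset.insert_subset ?_ hsub
    exact (responded_iff_of_lt ha).1 (h.2.2 a hab)
  · rw [if_neg h1]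
    by_cases h2 : l = a
    · subst h2
      rw [if_pos rfl]
      exact hsub.trans (Finset.subset_insert _ _)
    · rwa [if_neg h2]

/-- Were there an older query, `j₀` would have answered it but not this one; the oldest response set
would then be strictly larger, hence have at least `k` elements. So only the oldest query can
receive its `k`-th response. -/
lemma served_eq_zero {c : Config n k} {j₀ : Fin n} {l₀ : ℕ}
    (h : c.served j₀ l₀) (hk : k ≤ (c.queries[l₀]'h.1).card + 1) : l₀ = 0 := by
  by_contra hne
  have hpos : 0 < l₀ := Nat.pos_of_ne_zero hne
  have h0 : 0 < c.queries.length := hpos.trans h.1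
  have h1 := c.subset_of_le (Nat.zero_le l₀) h.1
  have h2 := (responded_iff_of_lt h0).1 (h.2.2 0 hpos)
  have h3 : j₀ ∉ c.queries[l₀]'h.1 := fun h' => h.2.1 ((responded_iff_of_lt h.1).2 h')
  have h4 := Finset.card_lt_card (Finset.ssubset_iff_subset_ne.2 ⟨h1, fun he => h3 (he ▸ h2)⟩)
  have h5 := c.card_lt _ (List.getElem_mem h0)
  omega

lemma nested_next (c : Config n k) (a : Option (Fin n)) :
    (c.nextQueries a).Pairwise (fun s s' => s' ⊆ s) := by
  cases a with
  | none =>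
    rw [nextQueries, List.pairwise_append]
    exact ⟨c.nested, List.pairwise_singleton _ _, by simp⟩
  | some j =>
    rcases c.nextQueries_some j with h | ⟨l, h⟩
    · rw [h]; exact c.nested
    · rcases lt_or_ge ((c.queries[l]'h.1).card + 1) k with hk | hk
      · rw [nextQueries_of_lt h hk]; exact nested_set h
      · rw [nextQueries_of_ge h hk]; exact c.nested.tail

lemma card_lt_next [NeZero k] (c : Config n k) (a : Option (Fin n)) :
    ∀ s ∈ c.nextQueries a, s.card < k := by
  cases a with
  | none =>
    intro s hs
    rw [nextQueries, List.mem_append, List.mem_singleton] at hs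
    rcases hs with hs | rfl
    · exact c.card_lt s hs
    · simpa using NeZero.pos k
  | some j =>
    rcases c.nextQueries_some j with h | ⟨l, h⟩
    · rw [h]; exact c.card_lt
    · rcases lt_or_ge ((c.queries[l]'h.1).card + 1) k with hk | hk
      · rw [nextQueries_of_lt h hk]
        intro s hs
        rcases List.mem_or_eq_of_mem_set hs with hs | rfl
        · exact c.card_lt s hs
        · exact (Finset.card_insert_le _ _).trans_lt hk
      · rw [nextQueries_of_ge h hk]
        exact fun s hs => c.card_lt s (List.mem_of_mem_tail hs)

/-- The position, among the queries after the event, of the one that `j` will serve. -/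
def nextIdx (c : Config n k) (a : Option (Fin n)) (j : Fin n) : ℕ :=
  (c.nextQueries a).findIdx fun s => decide (j ∉ s)

open Classical in
/-- The snapshot after an event, where `ρ` gives the rates of the services that begin. -/
def next [NeZero k] (c : Config n k) (a : Option (Fin n)) (ρ : Fin n → Bool) : Config n k where
  queries := c.nextQueries a
  rate j := if c.served j (c.nextIdx a j + c.offset a) then c.rate j else ρ j
  nested := c.nested_next a
  card_lt := c.card_lt_next a

variable [NeZero k]

lemma next_queries (c : Config n k) (a : Option (Fin n)) (ρ : Fin n → Bool) :
    (c.next a ρ).queries = c.nextQueries a := rfl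

lemma rate_next_of_served {c : Config n k} {a : Option (Fin n)} {ρ : Fin n → Bool} {j : Fin n}
    {l : ℕ} (h : (c.next a ρ).served j l) (h' : c.served j (l + c.offset a)) :
    (c.next a ρ).rate j = c.rate j := by
  refine if_pos ?_
  rwa [(served_iff.1 h).2] at h'

lemma rate_next_of_not_served {c : Config n k} {a : Option (Fin n)} {ρ : Fin n → Bool}
    {j : Fin n} {l : ℕ} (h : (c.next a ρ).served j l) (h' : ¬ c.served j (l + c.offset a)) :
    (c.next a ρ).rate j = ρ j := by
  refine if_neg ?_
  rwa [(served_iff.1 h).2] at h'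

lemma responded_next_none {c : Config n k} {ρ : Fin n → Bool} {j : Fin n} {l : ℕ} :
    (c.next none ρ).responded j l ↔ c.responded j l := by
  simp only [responded, next_queries, nextQueries]
  constructor
  · rintro ⟨s, hs, hj⟩
    rw [List.getElem?_append] at hs
    split_ifs at hs with hl
    · exact ⟨s, hs, hj⟩
    · have := List.mem_of_getElem? hs
      simp only [List.mem_singleton] at this
      simp [this] at hj
  · rintro ⟨s, hs, hj⟩
    refine ⟨s, ?_, hj⟩
    rw [List.getElem?_append_left (List.getElem?_eq_some_iff.1 hs).1, hs]

lemma responded_next_of_lt {c : Config n k} {ρ : Fin n → Bool} {j₀ : Fin n} {l₀ : ℕ}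
    (h : c.served j₀ l₀) (hk : (c.queries[l₀]'h.1).card + 1 < k) {j : Fin n} {l : ℕ} :
    (c.next (some j₀) ρ).responded j l ↔ c.responded j l ∨ (j = j₀ ∧ l = l₀) := by
  have h0 := h.1
  simp only [responded, next_queries, nextQueries_of_lt h hk]
  by_cases hl : l₀ = l
  · subst hl
    simp only [List.getElem?_set_self h0, List.getElem?_eq_getElem h0, Option.some.injEq,
      exists_eq_left', Finset.mem_insert, and_true]
    tauto
  · rw [List.getElem?_set_ne hl]
    have : ¬ l = l₀ := fun h => hl h.symm
    simp [this]

lemma responded_next_of_ge {c : Config n k} {ρ : Fin n → Bool} {j₀ : Fin n} {l₀ : ℕ}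
    (h : c.served j₀ l₀) (hk : k ≤ (c.queries[l₀]'h.1).card + 1) {j : Fin n} {l : ℕ} :
    (c.next (some j₀) ρ).responded j l ↔ c.responded j (l + 1) := by
  simp only [responded, next_queries, nextQueries_of_ge h hk, List.getElem?_tail]

end Config

namespace Input

variable {n k : ℕ} {μ₀ μ₁ : ℝ}

/-- The first gap occurs in the arrival time of every query still to come, so shortening it alone by
`r` shifts all of these arrivals. -/
lemma arrival_shift {w w' : Input n k} {r : ℝ} {d : ℕ} (h : IsQuiet μ₀ μ₁ w r)
    (hcount : w'.initCount + d = w.initCount)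
    (hgap : w'.gap = shiftOn {0} (fun _ => 1) r w.gap) (l : ℕ) :
    w'.arrival l = after r (w.arrival (l + d)) := by
  rcases lt_or_ge l w'.initCount with hl | hl
  · rw [arrival, arrival, if_pos hl, if_pos (by omega), after_of_le h.nonneg]
  · rw [after_of_ge (h.le_arrival (by omega)), arrival, arrival, if_neg (by omega),
      if_neg (by omega), show l + d - w.initCount = l - w'.initCount by omega,
      Finset.sum_range_succ', Finset.sum_range_succ', hgap]
    simp [shiftOn]
    ring

lemma isRestart_quiet (hk : 1 ≤ k) (hkn : k ≤ n) (h₀ : 0 < μ₀) (h₁ : 0 < μ₁) {c : Config n k}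
    {g : ℕ → ℝ} {w : Fin n × ℕ → ℝ} {b : Fin n × ℕ → Bool} {r : ℝ}
    (h : IsQuiet μ₀ μ₁ ⟨c, g, w, b⟩ r) :
    IsRestart μ₀ μ₁ ⟨c, g, w, b⟩ ⟨c, shiftOn {0} (fun _ => 1) r g,
      shiftOn c.active (fun a => speed μ₀ μ₁ (c.rate a.1)) r w, b⟩ r 0 := by
  refine h.isRestart hk hkn h₀ h₁ (D := fun _ _ => False) (fun j => h.nonneg)
    (fun l hl => absurd hl (Nat.not_lt_zero l)) (arrival_shift h rfl rfl)
    (by simp) le_rfl (by simp) (fun _ _ _ _ => rfl) (fun j l h1 h2 => absurd h1 h2)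
    (fun _ _ _ => rfl) (fun j l _ hs => ?_) (fun j l _ hs => ?_)
  · exact if_pos (Config.mem_active.2 hs)
  · exact if_neg fun h => hs (Config.mem_active.1 h)

variable [NeZero k]

/-- Coins of services under way after the event have become rates of the snapshot and are not read
again, so `b'` is arbitrary there. The gap `g 0` is used up, and the remaining gaps are relabelled.
-/
lemma isRestart_arrival (hkn : k ≤ n) (h₀ : 0 < μ₀) (h₁ : 0 < μ₁) {c : Config n k}
    {g : ℕ → ℝ} {w : Fin n × ℕ → ℝ} {b b' : Fin n × ℕ → Bool} {ρ : Fin n → Bool}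
    (h : IsQuiet μ₀ μ₁ ⟨c, g, w, b⟩ (g 0))
    (hb : ∀ j l, (c.next none ρ).served j l → b (j, l) = ρ j)
    (hb' : ∀ j l, ¬ (c.next none ρ).served j l → b (j, l) = b' (j, l)) :
    IsRestart μ₀ μ₁ ⟨c, g, w, b⟩ ⟨c.next none ρ, fun m => g (m + 1),
      shiftOn c.active (fun a => speed μ₀ μ₁ (c.rate a.1)) (g 0) w, b'⟩ (g 0) 0 := by
  have hcount : (⟨c.next none ρ, fun m => g (m + 1),
      shiftOn c.active (fun a => speed μ₀ μ₁ (c.rate a.1)) (g 0) w, b'⟩ : Input n k).initCount =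
      (⟨c, g, w, b⟩ : Input n k).initCount + 1 := by
    simp [initCount, Config.next_queries, Config.nextQueries]
  refine h.isRestart (NeZero.pos k) hkn h₀ h₁ (D := fun _ _ => False) (fun j => h.nonneg)
    (fun l hl => absurd hl (Nat.not_lt_zero l)) (fun l => ?_)
    (fun j l => by simpa using Config.responded_next_none) (by omega) (by simp)
    (fun j l hs hs' => Config.rate_next_of_served hs hs')
    (fun j l hs hs' => (Config.rate_next_of_not_served hs hs').trans (hb j l hs).symm)
    (fun j l hs => (hb' j l hs).symm) (fun j l _ hs => ?_) (fun j l _ hs => ?_)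
  · rw [add_zero]
    rcases lt_trichotomy l (⟨c, g, w, b⟩ : Input n k).initCount with hl | hl | hl
    · rw [arrival, arrival, if_pos (by omega), if_pos hl, after_of_le h.nonneg]
    -- The arriving query has number `initCount` and arrives at `g 0`, which becomes `0`: in the
    -- restarted system it belongs to the snapshot.
    · rw [arrival, arrival, if_pos (by omega), if_neg (by omega), hl]
      simp [after_of_le]
    · rw [after_of_ge (h.le_arrival hl.le), arrival, arrival, if_neg (by omega),
        if_neg (by omega)]
      rw [show l - (⟨c, g, w, b⟩ : Input n k).initCount = l - (⟨c.next none ρ, fun m => g (m + 1),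
        shiftOn c.active (fun a => speed μ₀ μ₁ (c.rate a.1)) (g 0) w, b'⟩ :
          Input n k).initCount + 1 by omega, Finset.sum_range_succ' g]
      simp
  · exact if_pos (Config.mem_active.2 hs)
  · exact if_neg fun h => hs (Config.mem_active.1 h)

/-- The requirement of the finished service is irrelevant after `r`, since its response is recorded
or its query has left. Hence `w'` may differ from `w` at `(j₀, l₀)`, which later allows that clock
to be integrated separately from the others. -/
lemma isRestart_response (hkn : k ≤ n) (h₀ : 0 < μ₀) (h₁ : 0 < μ₁) {c : Config n k}
    {g : ℕ → ℝ} {w w' : Fin n × ℕ → ℝ} {b b' : Fin n × ℕ → Bool} {ρ : Fin n → Bool}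
    {j₀ : Fin n} {l₀ : ℕ} {r : ℝ} (hs : c.served j₀ l₀)
    (h : IsQuiet μ₀ μ₁ ⟨c, g, w, b⟩ r) (hr : w (j₀, l₀) / speed μ₀ μ₁ (c.rate j₀) = r)
    (hw : ∀ a, a ≠ (j₀, l₀) → w a = w' a)
    (hb : ∀ j l, (c.next (some j₀) ρ).served j l → b (j, l + c.offset (some j₀)) = ρ j)
    (hb' : ∀ j l, ¬ (c.next (some j₀) ρ).served j l →
      b (j, l + c.offset (some j₀)) = b' (j, l + c.offset (some j₀))) :
    IsRestart μ₀ μ₁ ⟨c, g, w, b⟩ ⟨c.next (some j₀) ρ, shiftOn {0} (fun _ => 1) r g,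
      fun a => shiftOn (c.active.erase (j₀, l₀)) (fun a => speed μ₀ μ₁ (c.rate a.1)) r w'
        (a.1, a.2 + c.offset (some j₀)),
      fun a => b' (a.1, a.2 + c.offset (some j₀))⟩ r (c.offset (some j₀)) := by
  have hk : 1 ≤ k := NeZero.pos k
  have hwork : ∀ j l, c.served j l → (j, l) ≠ (j₀, l₀) →
      shiftOn (c.active.erase (j₀, l₀)) (fun a => speed μ₀ μ₁ (c.rate a.1)) r w' (j, l) =
      w (j, l) - r * speed μ₀ μ₁ (c.rate j) := by
    intro j l h1 h2
    rw [shiftOn, if_pos (Finset.mem_erase.2 ⟨h2, Config.mem_active.2 h1⟩), hw _ h2]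
  have hwork' : ∀ j l, ¬ c.served j l →
      shiftOn (c.active.erase (j₀, l₀)) (fun a => speed μ₀ μ₁ (c.rate a.1)) r w' (j, l) =
      w (j, l) := by
    intro j l h1
    rw [shiftOn, if_neg fun h => h1 (Config.mem_active.1 (Finset.mem_of_mem_erase h)), hw]
    rintro h2
    rw [Prod.mk.injEq] at h2
    rw [h2.1, h2.2] at h1
    exact h1 hs
  rcases lt_or_ge ((c.queries[l₀]'hs.1).card + 1) k with hlt | hge
  · have hd := Config.offset_of_lt hs hlt
    have hresp : ∀ j l, (c.next (some j₀) ρ).responded j l ↔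
        c.responded j l ∨ (j = j₀ ∧ l = l₀) := fun j l => Config.responded_next_of_lt hs hlt
    have hlen : (c.next (some j₀) ρ).queries.length = c.queries.length := by
      rw [Config.next_queries, Config.nextQueries_of_lt hs hlt, List.length_set]
    have hrn : ∀ j l, (c.next (some j₀) ρ).served j l → c.served j (l + c.offset (some j₀)) →
      (c.next (some j₀) ρ).rate j = c.rate j := fun j l => Config.rate_next_of_served
    have hrn' : ∀ j l, (c.next (some j₀) ρ).served j l → ¬ c.served j (l + c.offset (some j₀)) →
      (c.next (some j₀) ρ).rate j = ρ j := fun j l => Config.rate_next_of_not_served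
    simp only [hd, add_zero] at hb hb' hrn hrn' ⊢
    refine h.isRestart hk hkn h₀ h₁ (D := fun j l => j = j₀ ∧ l = l₀) (fun j => h.nonneg)
      (fun l hl => absurd hl (Nat.not_lt_zero l)) (arrival_shift h hlen rfl)
      (fun j l => hresp j l) hlen.ge ?_ (fun j l h1 h2 => hrn j l h1 h2)
      (fun j l h1 h2 => (hrn' j l h1 h2).trans (hb j l h1).symm)
      (fun j l h1 => (hb' j l h1).symm)
      (fun j l h1 h2 => hwork j l h2 ?_) (fun j l _ h2 => hwork' j l h2)
    · rintro j l ⟨rfl, rfl⟩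
      exact ⟨hs, hr⟩
    · intro he
      rw [Prod.mk.injEq] at he
      exact h1 ((hresp j l).2 (Or.inr he))
  · have hd := Config.offset_of_ge hs hge
    have hl₀ := Config.served_eq_zero hs hge
    subst hl₀
    have hresp : ∀ j l, (c.next (some j₀) ρ).responded j l ↔ c.responded j (l + 1) :=
      fun j l => Config.responded_next_of_ge hs hge
    have hlen : (c.next (some j₀) ρ).queries.length + 1 = c.queries.length := by
      rw [Config.next_queries, Config.nextQueries_of_ge hs hge, List.length_tail]
      have := hs.1
      omega
    have hrn : ∀ j l, (c.next (some j₀) ρ).served j l → c.served j (l + c.offset (some j₀)) →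
      (c.next (some j₀) ρ).rate j = c.rate j := fun j l => Config.rate_next_of_served
    have hrn' : ∀ j l, (c.next (some j₀) ρ).served j l → ¬ c.served j (l + c.offset (some j₀)) →
      (c.next (some j₀) ρ).rate j = ρ j := fun j l => Config.rate_next_of_not_served
    -- The `k - 1` recorded responses count from time `0` and that of `j₀` from time `r`, which
    -- makes `k` completions by time `r`.
    have hdep : (⟨c, g, w, b⟩ : Input n k).departure μ₀ μ₁ 0 ≤ r := by
      rw [departure, kthSmallest_le_iff hk hkn]
      have hj₀ : j₀ ∉ c.queries[0]'hs.1 :=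
        fun h' => hs.2.1 ((Config.responded_iff_of_lt hs.1).2 h')
      refine hge.trans ?_
      rw [← Finset.card_insert_of_notMem hj₀, ← Set.ncard_coe_finset]
      refine Set.ncard_le_ncard (fun j hj => ?_) (Set.toFinite _)
      rw [Finset.mem_coe, Finset.mem_insert] at hj
      rcases hj with rfl | hj
      · exact (h.completion_of_served hk hkn h₀ h₁ hs).trans_le hr.le
      · exact (h.completion_of_responded hk hkn h₀ h₁
          ((Config.responded_iff_of_lt hs.1).2 hj)).trans_le h.nonneg
    simp only [hd] at hb hb' hrn hrn' ⊢
    -- No new response needs recording, because the query that received it leaves the list; every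
    -- server is done with it by its departure time.
    refine h.isRestart hk hkn h₀ h₁ (D := fun _ _ => False)
      (fun j => (min_le_right _ _).trans hdep)
      (fun l hl => by rwa [Nat.lt_one_iff.1 hl]) (arrival_shift h hlen rfl)
      (fun j l => by simpa using hresp j l) hlen.ge (by simp) (fun j l h1 h2 => hrn j l h1 h2)
      (fun j l h1 h2 => (hrn' j l h1 h2).trans (hb j l h1).symm)
      (fun j l h1 => (hb' j l h1).symm)
      (fun j l h1 h2 => hwork j (l + 1) h2 ?_) (fun j l _ h2 => hwork' j (l + 1) h2)
    simp

end Input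
end ForkJoin

/-! ### Aggregation: stages of a snapshot and the aggregate state after an event -/

namespace ForkJoin

namespace Config

variable {n k : ℕ}

/-- Server `j` is serving a query with `i` responses. -/
def onStage (c : Config n k) (j : Fin n) (i : ℕ) : Prop :=
  (∃ s ∈ c.queries, s.card = i ∧ j ∉ s) ∧ ∀ s ∈ c.queries, i < s.card → j ∈ s

/-- The aggregate state of a snapshot. -/
def toState (c : Config n k) : State k := fun i =>
  (c.queries.countP fun s => decide (s.card = i.val), {j | c.onStage j i.val ∧ c.rate j = true}.ncard)

/-- In a chain, inclusion is decided by cardinality. In particular queries at the same stage have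
equal response sets, on which the whole aggregation rests. -/
lemma subset_of_card_le (c : Config n k) {s s' : Finset (Fin n)} (hs : s ∈ c.queries)
    (hs' : s' ∈ c.queries) (h : s.card ≤ s'.card) : s ⊆ s' := by
  obtain ⟨a, ha, rfl⟩ := List.getElem_of_mem hs
  obtain ⟨b, hb, rfl⟩ := List.getElem_of_mem hs'
  rcases le_total a b with hab | hab
  · exact (Finset.eq_of_subset_of_card_le (c.subset_of_le hab hb) h).ge
  · exact c.subset_of_le hab ha

lemma exists_served {c : Config n k} {j : Fin n} {s : Finset (Fin n)} (hs : s ∈ c.queries)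
    (hj : j ∉ s) : ∃ l, c.served j l :=
  ⟨_, served_iff.2 ⟨List.findIdx_lt_length_of_exists ⟨s, hs, by simpa using hj⟩, rfl⟩⟩

lemma not_mem_of_served {c : Config n k} {j : Fin n} {l : ℕ} (h : c.served j l) :
    j ∉ c.queries[l]'h.1 := fun h' => h.2.1 ((responded_iff_of_lt h.1).2 h')

lemma onStage_unique {c : Config n k} {j : Fin n} {i i' : ℕ} (h : c.onStage j i)
    (h' : c.onStage j i') : i = i' := by
  obtain ⟨⟨s, hs, rfl, hj⟩, h2⟩ := h
  obtain ⟨⟨s', hs', rfl, hj'⟩, h2'⟩ := h'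
  rcases lt_trichotomy s.card s'.card with hl | hl | hl
  · exact absurd (h2 s' hs' hl) hj'
  · exact hl
  · exact absurd (h2' s hs hl) hj

lemma onStage_of_served {c : Config n k} {j : Fin n} {l : ℕ} (h : c.served j l) :
    c.onStage j (c.queries[l]'h.1).card := by
  refine ⟨⟨_, List.getElem_mem h.1, rfl, not_mem_of_served h⟩, fun s hs hlt => ?_⟩
  obtain ⟨a, ha, rfl⟩ := List.getElem_of_mem hs
  have hal : a < l := by
    by_contra hcon
    exact absurd (Finset.card_le_card (c.subset_of_le (not_lt.1 hcon) ha)) (by omega)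
  exact (responded_iff_of_lt ha).1 (h.2.2 a hal)

lemma onStage_iff {c : Config n k} {j : Fin n} {i : ℕ} :
    c.onStage j i ↔ ∃ l, ∃ h : c.served j l, (c.queries[l]'h.1).card = i := by
  constructor
  · intro h
    obtain ⟨s, hs, -, hj⟩ := h.1
    obtain ⟨l, hl⟩ := exists_served hs hj
    exact ⟨l, hl, onStage_unique (onStage_of_served hl) h⟩
  · rintro ⟨l, h, rfl⟩
    exact onStage_of_served h

lemma toState_fst_pos {c : Config n k} {i : Fin k} :
    0 < (c.toState i).1 ↔ ∃ s ∈ c.queries, s.card = i := by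
  simp [toState, List.countP_pos_iff]

lemma toState_fst_pos_of_onStage {c : Config n k} {j : Fin n} {i : Fin k}
    (h : c.onStage j i) : 0 < (c.toState i).1 := by
  obtain ⟨s, hs, hi, -⟩ := h.1
  exact toState_fst_pos.2 ⟨s, hs, hi⟩

/-- Downward induction from the top stage, where all `n = (k - 1) + (n - k + 1)` servers qualify. If
stage `i + 1` is non-empty, the servers done with all higher stages are exactly the `i + 1`
responders of its queries. If it is empty, the condition is the one for `i + 1`, and `(i + 1) +
N_{i+1} = i + (1 + N_{i+1})`. -/
lemma ncard_available (hkn : k ≤ n) (c : Config n k) (i : Fin k) :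
    {j | ∀ s ∈ c.queries, i.val < s.card → j ∈ s}.ncard = i + N n c.toState i := by
  obtain ⟨m, hm⟩ : ∃ m, k - i.val = m := ⟨_, rfl⟩
  induction m generalizing i with
  | zero => have := i.2; omega
  | succ m ih =>
    rw [N, numServers]
    split_ifs with h h0
    · have := ih ⟨i.val + 1, h⟩ (by simp only; omega)
      rw [N] at this
      simp only at this
      rw [← add_assoc, ← this]
      congr 1
      ext j
      simp only [Set.mem_ofPred_eq]
      refine forall₂_congr fun s hs => ?_
      have hne : s.card ≠ i.val + 1 := by
        intro he
        have : 0 < (c.toState ⟨i.val + 1, h⟩).1 := toState_fst_pos.2 ⟨s, hs, he⟩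
        omega
      rw [show i.val < s.card ↔ i.val + 1 < s.card by omega]
    · obtain ⟨s, hs, hc⟩ := (toState_fst_pos (i := ⟨i.val + 1, h⟩)).1 (Nat.pos_of_ne_zero h0)
      have : {j | ∀ s ∈ c.queries, i.val < s.card → j ∈ s} = (s : Set (Fin n)) := by
        ext j
        simp only [Set.mem_ofPred_eq, Finset.mem_coe]
        constructor
        · intro hj
          exact hj s hs (by simp only at hc; omega)
        · intro hj s' hs' hlt
          exact c.subset_of_card_le hs hs' (by simp only at hc; omega) hj
      rw [this, Set.ncard_coe_finset, hc]
    · have : {j | ∀ s ∈ c.queries, i.val < s.card → j ∈ s} = Set.univ := by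
        refine Set.eq_univ_of_forall fun j s hs hlt => ?_
        have := c.card_lt s hs
        omega
      rw [this, Set.ncard_univ, Nat.card_eq_fintype_card, Fintype.card_fin]
      have := i.2
      omega

/-- The servers at a non-empty stage `i` are those done with all higher stages, minus the `i`
responders common to the queries of stage `i`. -/
lemma ncard_onStage (hkn : k ≤ n) {c : Config n k} {i : Fin k} (hi : 0 < (c.toState i).1) :
    {j | c.onStage j i}.ncard = N n c.toState i := by
  obtain ⟨s, hs, hc⟩ := toState_fst_pos.1 hi
  have h1 : {j | c.onStage j i} = {j | ∀ s ∈ c.queries, i.val < s.card → j ∈ s} \ s := by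
    ext j
    simp only [onStage, Set.mem_sdiff, Set.mem_ofPred_eq, Finset.mem_coe]
    constructor
    · rintro ⟨⟨s', hs', hc', hj⟩, h2⟩
      exact ⟨h2, fun h => hj (c.subset_of_card_le hs hs' (by omega) h)⟩
    · rintro ⟨h2, hj⟩
      exact ⟨⟨s, hs, hc, hj⟩, h2⟩
  have h2 : (s : Set (Fin n)) ⊆ {j | ∀ s ∈ c.queries, i.val < s.card → j ∈ s} :=
    fun j hj s' hs' hlt => c.subset_of_card_le hs hs' (by omega) hj
  rw [h1, Set.ncard_sdiff h2 (Set.toFinite _), ncard_available hkn, Set.ncard_coe_finset, hc]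
  omega

lemma toState_mem (hkn : k ≤ n) (c : Config n k) : c.toState ∈ states n k := by
  intro i
  have h0 : (c.toState i).1 = 0 → (c.toState i).2 = 0 := by
    intro h
    have : {j | c.onStage j i ∧ c.rate j = true} = ∅ := by
      ext j
      simp only [Set.mem_ofPred_eq, Set.mem_empty_iff_false, iff_false]
      rintro ⟨hj, -⟩
      have := toState_fst_pos_of_onStage hj
      omega
    simp [toState, this]
  refine ⟨?_, h0⟩
  rcases Nat.eq_zero_or_pos (c.toState i).1 with h | h
  · rw [h0 h]; exact Nat.zero_le _
  · rw [← ncard_onStage hkn h]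
    exact Set.ncard_le_ncard (fun j hj => hj.1) (Set.toFinite _)

lemma nextStage_congr {z z' : State k} (h : ∀ m, (z m).1 = (z' m).1) (i : Fin k) :
    nextStage z i = nextStage z' i := by
  simp only [nextStage, h]

lemma nextStage_eq_iff {z : State k} {i m : Fin k} :
    nextStage z i = m ↔ (m ≤ i ∧ 0 < (z m).1) ∧ ∀ m' ≤ i, 0 < (z m').1 → m' ≤ m := by
  rw [nextStage]
  constructor
  · intro h
    have h1 := Finset.mem_of_max h
    rw [Finset.mem_filter] at h1
    refine ⟨h1.2, fun m' h2 h3 => Finset.le_max_of_eq ?_ h⟩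
    exact Finset.mem_filter.2 ⟨Finset.mem_univ _, h2, h3⟩
  · rintro ⟨h1, h2⟩
    refine le_antisymm (Finset.max_le fun m' hm' => ?_)
      (Finset.le_max (Finset.mem_filter.2 ⟨Finset.mem_univ _, h1⟩))
    rw [Finset.mem_filter] at hm'
    exact WithBot.coe_le_coe.2 (h2 m' hm'.2.1 hm'.2.2)

/-- A server that has answered precisely the queries with more than `i` responses turns to the
oldest of the others, and this one sits at the highest non-empty stage not above `i`. Freed servers
are of this kind. -/
lemma onStage_iff_nextStage {c : Config n k} {j : Fin n} {i : Fin k}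
    (hj : ∀ s ∈ c.queries, j ∈ s ↔ i.val < s.card) (m : Fin k) :
    c.onStage j m ↔ nextStage c.toState i = m := by
  rw [nextStage_eq_iff]
  constructor
  · rintro ⟨⟨s, hs, hm, hjs⟩, h2⟩
    refine ⟨⟨?_, toState_fst_pos.2 ⟨s, hs, hm⟩⟩, fun m' hm' hpos => ?_⟩
    · rw [hj s hs, hm] at hjs
      exact Fin.le_def.2 (by omega)
    · obtain ⟨s', hs', hc'⟩ := toState_fst_pos.1 hpos
      by_contra hcon
      rw [not_le, Fin.lt_def] at hcon
      have := (hj s' hs').1 (h2 s' hs' (by omega))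
      rw [Fin.le_def] at hm'
      omega
  · rintro ⟨⟨hmi, hpos⟩, h2⟩
    obtain ⟨s, hs, hc⟩ := toState_fst_pos.1 hpos
    rw [Fin.le_def] at hmi
    refine ⟨⟨s, hs, hc, fun h => ?_⟩, fun s' hs' hlt => ?_⟩
    · have := (hj s hs).1 h
      omega
    · rw [hj s' hs']
      by_contra hcon
      have h3 := h2 ⟨s'.card, by have := i.2; omega⟩ (Fin.le_def.2 (by simp only; omega))
        (toState_fst_pos.2 ⟨s', hs', rfl⟩)
      rw [Fin.le_def] at h3
      simp only at h3
      omega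

section next

variable [NeZero k]

/-- The aggregate state after an event, `F` being the set of servers that are freed. -/
lemma toState_next {c : Config n k} {a : Option (Fin n)} {ρ : Fin n → Bool} {F : Set (Fin n)}
    {z' : State k} {i : Fin k} (hy : ∀ m, ((c.next a ρ).toState m).1 = (z' m).1)
    (hF : ∀ j l, (c.next a ρ).served j l → (c.served j (l + c.offset a) ↔ j ∉ F))
    (hst : ∀ j ∈ F, ∀ s ∈ c.nextQueries a, j ∈ s ↔ i.val < s.card)
    (hh : ∀ m : Fin k,
      {j | j ∉ F ∧ (c.next a ρ).onStage j m ∧ c.rate j = true}.ncard = (z' m).2) :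
    (c.next a ρ).toState = addHigh z' (nextStage z' i) {j | j ∈ F ∧ ρ j = true}.ncard := by
  have hrate : ∀ j ∉ F, ∀ m, (c.next a ρ).onStage j m → (c.next a ρ).rate j = c.rate j := by
    intro j hj m hm
    obtain ⟨l, hl, -⟩ := onStage_iff.1 hm
    exact rate_next_of_served hl ((hF j l hl).2 hj)
  have hrate' : ∀ j ∈ F, ∀ m, (c.next a ρ).onStage j m → (c.next a ρ).rate j = ρ j := by
    intro j hj m hm
    obtain ⟨l, hl, -⟩ := onStage_iff.1 hm
    exact rate_next_of_not_served hl fun h => (hF j l hl).1 h hj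
  have hF' : ∀ j ∈ F, ∀ m : Fin k, (c.next a ρ).onStage j m ↔ nextStage z' i = m := by
    intro j hj m
    rw [onStage_iff_nextStage (hst j hj), nextStage_congr hy]
  funext m
  -- Servers outside `F` keep their rates, while those in `F` all go to one stage, with the new
  -- rates `ρ`.
  have hsplit : {j | (c.next a ρ).onStage j m ∧ (c.next a ρ).rate j = true} =
      {j | j ∉ F ∧ (c.next a ρ).onStage j m ∧ c.rate j = true} ∪
        {j | j ∈ F ∧ nextStage z' i = m ∧ ρ j = true} := by
    ext j
    simp only [Set.mem_ofPred_eq, Set.mem_union]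
    by_cases hj : j ∈ F
    · simp only [hj, not_true_eq_false, false_and, false_or, true_and]
      rw [← hF' j hj]
      refine and_congr_right fun h => ?_
      rw [hrate' j hj m h]
    · simp only [hj, not_false_eq_true, true_and, false_and, or_false]
      refine and_congr_right fun h => ?_
      rw [hrate j hj m h]
  have hsnd : ((c.next a ρ).toState m).2 =
      (z' m).2 + {j | j ∈ F ∧ nextStage z' i = m ∧ ρ j = true}.ncard := by
    rw [toState, hsplit, Set.ncard_union_eq _ (Set.toFinite _) (Set.toFinite _), hh]
    rw [Set.disjoint_left]
    rintro j ⟨h1, -⟩ ⟨h2, -⟩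
    exact h1 h2
  rw [addHigh]
  split_ifs with hm
  · exact Prod.ext (hy m) (by simpa [hm] using hsnd)
  · exact Prod.ext (hy m) (by simpa [hm] using hsnd)

lemma served_next_none {c : Config n k} {ρ : Fin n → Bool} {j : Fin n} {l : ℕ}
    (h : c.served j l) : (c.next none ρ).served j l := by
  refine ⟨?_, fun h' => h.2.1 (responded_next_none.1 h'),
    fun l' hl' => responded_next_none.2 (h.2.2 l' hl')⟩
  have := h.1
  simp only [next_queries, nextQueries, List.length_append]
  omega

/-- Idle servers play the part of the freed ones. Each has answered all old queries but not the new
one, hence exactly those with at least one response: the pattern of a server freed at stage `0`. -/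
lemma toState_next_none {c : Config n k} {ρ : Fin n → Bool} :
    (c.next none ρ).toState = addHigh (afterArrival c.toState) ((0 : Fin k) : WithBot (Fin k))
      {j | (∀ s ∈ c.queries, j ∈ s) ∧ ρ j = true}.ncard := by
  have h0 : nextStage (afterArrival c.toState) 0 = ((0 : Fin k) : WithBot (Fin k)) := by
    rw [nextStage_eq_iff]
    refine ⟨⟨le_rfl, by simp [afterArrival]⟩, fun m h _ => h⟩
  rw [← h0]
  refine toState_next (F := {j | ∀ s ∈ c.queries, j ∈ s}) (fun m => ?_) (fun j l hl => ?_)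
    (fun j hj s hs => ?_) (fun m => ?_)
  · rw [toState, afterArrival, next_queries, nextQueries, List.countP_append]
    rcases eq_or_ne m 0 with rfl | hm
    · simp [toState]
    · have : ¬ (0 = m.val) := fun h => hm (Fin.ext (by simp [← h]))
      simp [toState, Function.update_of_ne hm, this]
  · change c.served j l ↔ _
    constructor
    · intro h hj
      exact not_mem_of_served h (hj _ (List.getElem_mem h.1))
    · intro hj
      simp only [Set.mem_ofPred_eq, not_forall] at hj
      obtain ⟨s, hs, hjs⟩ := hj
      obtain ⟨l', hl'⟩ := exists_served hs hjs
      rwa [served_unique hl (served_next_none hl')]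
  · rw [nextQueries, List.mem_append, List.mem_singleton] at hs
    rcases hs with hs | rfl
    · have := hj s hs
      exact iff_of_true this (Finset.card_pos.2 ⟨j, this⟩)
    · simp
  · have hset : {j | j ∉ {j | ∀ s ∈ c.queries, j ∈ s} ∧ (c.next none ρ).onStage j m ∧
        c.rate j = true} = {j | c.onStage j m ∧ c.rate j = true} := by
      ext j
      simp only [Set.mem_ofPred_eq, ← and_assoc]
      refine and_congr_left fun _ => ?_
      simp only [onStage, next_queries, nextQueries, List.mem_append, List.mem_singleton]
      constructor
      · rintro ⟨h1, ⟨s, hs, hm, hjs⟩, h2⟩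
        refine ⟨?_, fun s hs => h2 s (Or.inl hs)⟩
        rcases hs with hs | rfl
        · exact ⟨s, hs, hm, hjs⟩
        · push Not at h1
          obtain ⟨s, hs, hjs⟩ := h1
          refine ⟨s, hs, ?_, hjs⟩
          by_contra hne
          rw [Finset.card_empty] at hm
          exact hjs (h2 s (Or.inl hs) (by omega))
      · rintro ⟨⟨s, hs, hm, hjs⟩, h2⟩
        refine ⟨fun h => hjs (h s hs), ⟨s, Or.inl hs, hm, hjs⟩, fun s' hs' hlt => ?_⟩
        rcases hs' with hs' | rfl
        · exact h2 s' hs' hlt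
        · simp at hlt
    rw [hset, afterArrival]
    rcases eq_or_ne m 0 with rfl | hm
    · simp [toState]
    · simp [toState, Function.update_of_ne hm]

/-- A query without responses keeps every server busy. If there is none, having answered everything
is the same as being available to stage `0`. -/
lemma ncard_idle (hkn : k ≤ n) (c : Config n k) :
    {j | ∀ s ∈ c.queries, j ∈ s}.ncard =
      if (c.toState 0).1 = 0 then N n c.toState 0 else 0 := by
  split_ifs with h0
  · have := ncard_available hkn c 0
    rw [Fin.val_zero, zero_add] at this
    rw [← this]
    congr 1
    ext j
    simp only [Set.mem_ofPred_eq]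
    refine forall₂_congr fun s hs => ?_
    have : 0 < s.card := by
      by_contra hcon
      have : 0 < (c.toState 0).1 := toState_fst_pos.2 ⟨s, hs, by simp; simpa using hcon⟩
      omega
    simp [this]
  · obtain ⟨s, hs, hc⟩ := toState_fst_pos.1 (Nat.pos_of_ne_zero h0)
    rw [Set.ncard_eq_zero]
    ext j
    simp only [Set.mem_ofPred_eq, Set.mem_empty_iff_false, iff_false]
    intro h
    have h1 := h s hs
    have h2 : s = ∅ := Finset.card_eq_zero.1 (by simpa using hc)
    rw [h2] at h1
    simp at h1

/-- The stage at which server `j` is working. -/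
def servedStage (c : Config n k) {j : Fin n} {l : ℕ} (h : c.served j l) : Fin k :=
  ⟨(c.queries[l]'h.1).card, c.card_lt _ (List.getElem_mem h.1)⟩

/-- The set of servers freed by a response of server `j` to query `l`. -/
def freedSet (c : Config n k) {j : Fin n} {l : ℕ} (h : c.served j l) : Set (Fin n) :=
  if (c.queries[l]'h.1).card + 1 < k then {j} else {j' | j' ∉ c.queries[l]'h.1}

omit [NeZero k] in
lemma ncard_freedSet {c : Config n k} {j : Fin n} {l : ℕ} (hkn : k ≤ n) (h : c.served j l) :
    (c.freedSet h).ncard = freed n (c.servedStage h) := by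
  rw [freedSet, freed, servedStage]
  simp only
  split_ifs with hlt
  · exact Set.ncard_singleton j
  · have hc := c.card_lt _ (List.getElem_mem h.1)
    have h1 : {j' | j' ∉ c.queries[l]'h.1} = ((c.queries[l]'h.1 : Finset (Fin n)) : Set (Fin n))ᶜ := rfl
    rw [h1, ← Finset.coe_compl, Set.ncard_coe_finset, Finset.card_compl, Fintype.card_fin]
    omega

/-- All servers at the stage of the responder work on this very query, so the whole group except
`j₀` moves up one stage, and `j₀` alone is freed. -/
lemma toState_next_of_lt {c : Config n k} {ρ : Fin n → Bool} {j₀ : Fin n} {l₀ : ℕ}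
    (h : c.served j₀ l₀) (hk : (c.queries[l₀]'h.1).card + 1 < k) :
    (c.next (some j₀) ρ).toState =
      addHigh (afterResponse c.toState (c.servedStage h) (if c.rate j₀ then 1 else 0))
        (nextStage (afterResponse c.toState (c.servedStage h) (if c.rate j₀ then 1 else 0))
          (c.servedStage h)) {j | j ∈ ({j₀} : Set (Fin n)) ∧ ρ j = true}.ncard := by
  have hq := nextQueries_of_lt h hk
  have hoff := offset_of_lt h hk
  have hi : (c.servedStage h).val = (c.queries[l₀]'h.1).card := rfl
  have hj₀ := not_mem_of_served h
  have hresp : ∀ j l, (c.next (some j₀) ρ).responded j l ↔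
      c.responded j l ∨ (j = j₀ ∧ l = l₀) := fun j l => responded_next_of_lt h hk
  have hlen : (c.next (some j₀) ρ).queries.length = c.queries.length := by
    rw [next_queries, hq, List.length_set]
  have hsv : ∀ j l, j ≠ j₀ → ((c.next (some j₀) ρ).served j l ↔ c.served j l) := by
    intro j l hj
    simp only [served, hlen, hresp, hj, false_and, or_false]
  have hstage : ∀ j m, j ≠ j₀ → ((c.next (some j₀) ρ).onStage j m ↔
      (m ≠ (c.queries[l₀]'h.1).card ∧ c.onStage j m) ∨
      (m = (c.queries[l₀]'h.1).card + 1 ∧ c.onStage j (c.queries[l₀]'h.1).card)) := by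
    intro j m hj
    -- Another query at this stage would have the same response set; but the server serving the
    -- younger of the two has answered the older one, hence would also have answered the one it is
    -- serving.
    have hone : ∀ l (hl : c.served j l), l ≠ l₀ →
        (c.queries[l]'hl.1).card ≠ (c.queries[l₀]'h.1).card := by
      intro l hl hne he
      have h1 : c.queries[l]'hl.1 = c.queries[l₀]'h.1 :=
        (c.subset_of_card_le (List.getElem_mem _) (List.getElem_mem _) he.le).antisymm
          (c.subset_of_card_le (List.getElem_mem _) (List.getElem_mem _) he.ge)
      rcases lt_or_gt_of_ne hne with hlt | hlt
      · have := (responded_iff_of_lt hl.1).1 (h.2.2 l hlt)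
        rw [h1] at this
        exact hj₀ this
      · have := (responded_iff_of_lt h.1).1 (hl.2.2 l₀ hlt)
        rw [← h1] at this
        exact not_mem_of_served hl this
    rw [onStage_iff]
    constructor
    · rintro ⟨l, hl, rfl⟩
      have hl' := (hsv j l hj).1 hl
      simp only [next_queries, hq, List.getElem_set]
      split_ifs with he
      · subst he
        right
        exact ⟨Finset.card_insert_of_notMem hj₀, onStage_of_served hl'⟩
      · left
        exact ⟨hone l hl' (Ne.symm he), onStage_of_served hl'⟩
    · rintro (⟨hm, hs⟩ | ⟨rfl, hs⟩)
      · obtain ⟨l, hl, rfl⟩ := onStage_iff.1 hs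
        refine ⟨l, (hsv j l hj).2 hl, ?_⟩
        simp only [next_queries, hq, List.getElem_set]
        rw [if_neg]
        rintro rfl
        exact hm rfl
      · obtain ⟨l, hl, he⟩ := onStage_iff.1 hs
        have hll : l = l₀ := by
          by_contra hne
          exact hone l hl hne he
        subst hll
        refine ⟨l, (hsv j l hj).2 hl, ?_⟩
        simp only [next_queries, hq, List.getElem_set_self]
        exact Finset.card_insert_of_notMem hj₀
  have hon₀ := onStage_of_served h
  refine toState_next (F := {j₀}) (fun m => ?_) (fun j l hl => ?_) (fun j hj s hs => ?_)
    (fun m => ?_)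
  · simp only [toState, afterResponse, next_queries, hq, List.countP_set h.1, decide_eq_true_eq,
      Finset.card_insert_of_notMem hj₀, ← hi, Fin.val_inj]
    split_ifs <;> grind
  · rw [hoff, add_zero]
    by_cases hj : j = j₀
    · subst hj
      simp only [Set.mem_singleton_iff, not_true_eq_false, iff_false]
      intro hs
      have := served_unique hs h
      exact hl.2.1 ((hresp j l).2 (Or.inr ⟨rfl, this⟩))
    · simp only [Set.mem_singleton_iff, hj, not_false_eq_true, iff_true]
      exact (hsv j l hj).1 hl
  · rw [Set.mem_singleton_iff] at hj
    subst hj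
    rw [hi]
    rw [hq] at hs
    obtain ⟨a, ha, rfl⟩ := List.getElem_of_mem hs
    rw [List.length_set] at ha
    rw [List.getElem_set]
    split_ifs with he
    · rw [Finset.card_insert_of_notMem hj₀]
      simp
    · rcases lt_or_gt_of_ne he with hlt | hlt
      · have hsub := c.subset_of_le hlt.le ha
        refine iff_of_false (fun h' => hj₀ (hsub h')) ?_
        exact not_lt.2 (Finset.card_le_card hsub)
      · have hmem := (responded_iff_of_lt ha).1 (h.2.2 a hlt)
        refine iff_of_true hmem (Finset.card_lt_card (Finset.ssubset_iff_subset_ne.2 ⟨c.subset_of_le hlt.le h.1, fun he => ?_⟩))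
        rw [← he] at hmem
        exact hj₀ hmem
  · have hset : {j | j ∉ ({j₀} : Set (Fin n)) ∧ (c.next (some j₀) ρ).onStage j m ∧
        c.rate j = true} = {j | j ≠ j₀ ∧ ((m.val ≠ (c.queries[l₀]'h.1).card ∧ c.onStage j m) ∨
      (m.val = (c.queries[l₀]'h.1).card + 1 ∧ c.onStage j (c.queries[l₀]'h.1).card)) ∧
        c.rate j = true} := by
      ext j
      simp only [Set.mem_ofPred_eq, Set.mem_singleton_iff]
      refine and_congr_right fun hj => ?_
      rw [hstage j m hj]
    rw [hset, afterResponse]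
    split_ifs with h1 h2 h3
    · rw [Set.ncard_eq_zero]
      ext j
      subst h1
      simp [servedStage]
    -- A high-rate responder is counted among the `h_i` but does not move on, which is the `r = 1`
    -- subtracted in `afterResponse`.
    · change _ = _ + (_ - 1)
      have hu : {j | j ≠ j₀ ∧ ((m.val ≠ (c.queries[l₀]'h.1).card ∧ c.onStage j m) ∨
          (m.val = (c.queries[l₀]'h.1).card + 1 ∧ c.onStage j (c.queries[l₀]'h.1).card)) ∧
          c.rate j = true} = {j | c.onStage j m ∧ c.rate j = true} ∪
          ({j | c.onStage j (c.queries[l₀]'h.1).card ∧ c.rate j = true} \ {j₀}) := by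
        ext j
        have : c.onStage j m → j ≠ j₀ := by
          rintro hj rfl
          have := onStage_unique hj hon₀
          omega
        simp only [Set.mem_ofPred_eq, Set.mem_union, Set.mem_sdiff, Set.mem_singleton_iff]
        rw [hi] at h2
        simp only [h2] at this ⊢
        have h3 : (c.queries[l₀]'h.1).card + 1 ≠ (c.queries[l₀]'h.1).card := by omega
        tauto
      rw [hu, Set.ncard_union_eq _ (Set.toFinite _) (Set.toFinite _),
        Set.ncard_sdiff_singleton_of_mem]
      · rfl
      · exact ⟨hon₀, h3⟩
      · rw [Set.disjoint_left]
        rintro j ⟨hj, -⟩ ⟨⟨hj', -⟩, -⟩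
        have := onStage_unique hj hj'
        omega
    · change _ = _ + (_ - 0)
      have hu : {j | j ≠ j₀ ∧ ((m.val ≠ (c.queries[l₀]'h.1).card ∧ c.onStage j m) ∨
          (m.val = (c.queries[l₀]'h.1).card + 1 ∧ c.onStage j (c.queries[l₀]'h.1).card)) ∧
          c.rate j = true} = {j | c.onStage j m ∧ c.rate j = true} ∪
          {j | c.onStage j (c.queries[l₀]'h.1).card ∧ c.rate j = true} := by
        ext j
        have h4 : c.rate j = true → j ≠ j₀ := by
          rintro hj rfl
          exact h3 hj
        simp only [Set.mem_ofPred_eq, Set.mem_union]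
        rw [hi] at h2
        simp only [h2]
        have h3 : (c.queries[l₀]'h.1).card + 1 ≠ (c.queries[l₀]'h.1).card := by omega
        tauto
      rw [hu, Set.ncard_union_eq _ (Set.toFinite _) (Set.toFinite _)]
      · rfl
      · rw [Set.disjoint_left]
        rintro j ⟨hj, -⟩ ⟨hj', -⟩
        have := onStage_unique hj hj'
        omega
    all_goals
      change _ = {j | c.onStage j m ∧ c.rate j = true}.ncard
      congr 1
      ext j
      have h1' : m.val ≠ (c.queries[l₀]'h.1).card := fun he => h1 (Fin.ext he)
      have : c.onStage j m → j ≠ j₀ := by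
        rintro hj rfl
        exact h1' (onStage_unique hj hon₀)
      simp only [Set.mem_ofPred_eq]
      rw [hi] at h2
      tauto

/-- The departing query has `k - 1` responders, the largest number possible, so every remaining
response set is contained in its own. A server outside it has therefore answered none of the
remaining queries and is freed. As there is no stage `k`, the value of `r` has no effect. -/
lemma toState_next_of_ge {c : Config n k} {ρ : Fin n → Bool} {j₀ : Fin n} {l₀ : ℕ} (r : ℕ)
    (h : c.served j₀ l₀) (hk : k ≤ (c.queries[l₀]'h.1).card + 1) :
    (c.next (some j₀) ρ).toState =
      addHigh (afterResponse c.toState (c.servedStage h) r)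
        (nextStage (afterResponse c.toState (c.servedStage h) r)
          (c.servedStage h)) {j | j ∈ {j | j ∉ c.queries[l₀]'h.1} ∧ ρ j = true}.ncard := by
  have hl₀ := served_eq_zero h hk
  subst hl₀
  have hq := nextQueries_of_ge h hk
  have hoff := offset_of_ge h hk
  have hc := c.card_lt _ (List.getElem_mem h.1)
  have hi : (c.servedStage h).val = (c.queries[0]'h.1).card := rfl
  have hcons : c.queries = c.queries[0]'h.1 :: c.queries.tail := by
    conv_lhs => rw [← List.cons_head_tail (List.ne_nil_of_length_pos h.1)]
    rw [List.head_eq_getElem]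
  have hmem : ∀ s, s ∈ c.queries ↔ s = c.queries[0]'h.1 ∨ s ∈ c.queries.tail := by
    intro s
    conv_lhs => rw [hcons]
    exact List.mem_cons
  have hresp : ∀ j l, (c.next (some j₀) ρ).responded j l ↔
      c.responded j (l + 1) := fun j l => responded_next_of_ge h hk
  refine toState_next (F := {j | j ∉ c.queries[0]'h.1}) (fun m => ?_) (fun j l hl => ?_)
    (fun j hj s hs => ?_) (fun m => ?_)
  · have hcount : ∀ p : Finset (Fin n) → Bool, c.queries.countP p =
        c.queries.tail.countP p + if p (c.queries[0]'h.1) then 1 else 0 := by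
      intro p
      conv_lhs => rw [hcons]
      exact List.countP_cons
    have hm := m.2
    simp only [toState, afterResponse, next_queries, hq]
    rw [hcount]
    simp only [decide_eq_true_eq, ← hi]
    split_ifs <;> grind
  · rw [hoff]
    constructor
    · intro hs hj
      exact hj ((responded_iff_of_lt h.1).1 (hs.2.2 0 (Nat.succ_pos l)))
    · intro hj
      refine ⟨?_, fun h' => hl.2.1 ((hresp j l).2 h'), fun l' hl' => ?_⟩
      · have := hl.1
        rw [next_queries, hq, List.length_tail] at this
        omega
      · rcases l' with _ | l'
        · simp only [Set.mem_ofPred_eq, not_not] at hj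
          exact (responded_iff_of_lt h.1).2 hj
        · exact (hresp j l').1 (hl.2.2 l' (by omega))
  · rw [hq] at hs
    have hs' := (hmem s).2 (Or.inr hs)
    have hlt := c.card_lt s hs'
    refine iff_of_false (fun h' => hj ?_) (by omega)
    exact c.subset_of_card_le hs' (List.getElem_mem h.1) (by omega) h'
  · have hset : {j | j ∉ {j | j ∉ c.queries[0]'h.1} ∧ (c.next (some j₀) ρ).onStage j m ∧
        c.rate j = true} = {j | j ∈ c.queries[0]'h.1 ∧ c.onStage j m ∧ c.rate j = true} := by
      ext j
      simp only [Set.mem_ofPred_eq, not_not]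
      refine and_congr_right fun hj => and_congr_left fun _ => ?_
      simp only [onStage, next_queries, hq, hmem]
      constructor
      · rintro ⟨⟨s, hs, h1⟩, h2⟩
        refine ⟨⟨s, Or.inr hs, h1⟩, ?_⟩
        rintro s' (rfl | hs') hlt
        · exact hj
        · exact h2 s' hs' hlt
      · rintro ⟨⟨s, hs, h1⟩, h2⟩
        refine ⟨⟨s, ?_, h1⟩, fun s' hs' => h2 s' (Or.inr hs')⟩
        rcases hs with rfl | hs
        · exact absurd hj h1.2
        · exact hs
    have hm := m.2
    rw [hset, afterResponse]
    split_ifs with h1 h2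
    · rw [Set.ncard_eq_zero]
      ext j
      simp only [Set.mem_ofPred_eq, Set.mem_empty_iff_false, iff_false]
      rintro ⟨hj, ⟨⟨s, hs, hsc, hjs⟩, -⟩, -⟩
      refine hjs (c.subset_of_card_le (List.getElem_mem h.1) hs ?_ hj)
      rw [hsc, h1, hi]
    · omega
    · change _ = {j | c.onStage j m ∧ c.rate j = true}.ncard
      congr 1
      ext j
      simp only [Set.mem_ofPred_eq, and_iff_right_iff_imp]
      rintro ⟨hj, -⟩
      have h1' : m.val ≠ (c.queries[0]'h.1).card := fun he => h1 (Fin.ext he)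
      exact hj.2 _ (List.getElem_mem h.1) (by omega)

lemma toState_next_some {c : Config n k} {ρ : Fin n → Bool} {j₀ : Fin n} {l₀ : ℕ}
    (h : c.served j₀ l₀) :
    (c.next (some j₀) ρ).toState =
      addHigh (afterResponse c.toState (c.servedStage h) (if c.rate j₀ then 1 else 0))
        (nextStage (afterResponse c.toState (c.servedStage h) (if c.rate j₀ then 1 else 0))
          (c.servedStage h)) {j | j ∈ c.freedSet h ∧ ρ j = true}.ncard := by
  rw [freedSet]
  by_cases hk : (c.queries[l₀]'h.1).card + 1 < k
  · rw [if_pos hk]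
    exact toState_next_of_lt h hk
  · rw [if_neg hk]
    exact toState_next_of_ge _ h (not_lt.1 hk)

end next

end Config

end ForkJoin

/-! ### Snapshots realising a given state, and the state at time zero -/

namespace ForkJoin

namespace Config

variable {n k : ℕ}

/-- The first `i` servers. -/
def firstServers (n i : ℕ) : Finset (Fin n) := Finset.univ.filter fun j => j.val < i

lemma card_firstServers {n i : ℕ} (h : i ≤ n) : (firstServers n i).card = i := by
  rw [firstServers, Fin.card_filter_val_lt, min_eq_right h]

lemma firstServers_mono {n i i' : ℕ} (h : i ≤ i') : firstServers n i ⊆ firstServers n i' := by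
  intro j hj
  simp only [firstServers, Finset.mem_filter, Finset.mem_univ, true_and] at hj ⊢
  omega

/-- A snapshot with prescribed numbers of queries at each stage. -/
def ofCounts (hkn : k ≤ n) (y : Fin k → ℕ) (rate : Fin n → Bool) : Config n k where
  queries := (List.finRange k).reverse.flatMap fun i => List.replicate (y i) (firstServers n i)
  rate := rate
  nested := by
    rw [List.pairwise_flatMap]
    refine ⟨fun i _ => ?_, ?_⟩
    · exact List.pairwise_replicate.2 (Or.inr (Finset.Subset.refl _))
    · rw [List.pairwise_reverse]
      refine (List.pairwise_lt_finRange k).imp ?_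
      intro a b hab s hs s' hs'
      rw [List.eq_of_mem_replicate hs, List.eq_of_mem_replicate hs']
      exact firstServers_mono (Fin.le_def.1 hab.le)
  card_lt := by
    intro s hs
    obtain ⟨i, -, hi⟩ := List.mem_flatMap.1 hs
    rw [List.eq_of_mem_replicate hi, card_firstServers (i.2.le.trans hkn)]
    exact i.2

lemma toState_ofCounts_fst (hkn : k ≤ n) (y : Fin k → ℕ) (rate : Fin n → Bool) (i : Fin k) :
    ((ofCounts hkn y rate).toState i).1 = y i := by
  simp only [toState, ofCounts, List.countP_flatMap, List.map_reverse, List.sum_reverse]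
  rw [← List.ofFn_eq_map, List.sum_ofFn, Finset.sum_eq_single i]
  · simp [List.countP_replicate, card_firstServers (i.2.le.trans hkn)]
  · intro i' _ hne
    have : i'.val ≠ i.val := fun h => hne (Fin.ext h)
    simp [List.countP_replicate, card_firstServers (i'.2.le.trans hkn), this]
  · simp

/-- Which servers are at a stage does not depend on the rates, so the rates can be chosen
afterwards: at each non-empty stage mark `h_i` of its `N_i` servers as fast. A server is at one
stage only, hence the choices do not interfere. -/
lemma exists_toState_eq (hkn : k ≤ n) {z : State k} (hz : z ∈ states n k) :
    ∃ c : Config n k, c.toState = z := by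
  classical
  set y : Fin k → ℕ := fun i => (z i).1
  set c₀ := ofCounts hkn y fun _ => false with hc₀
  have hy : ∀ rate i, ((ofCounts hkn y rate).toState i).1 = (z i).1 :=
    fun rate i => toState_ofCounts_fst hkn y rate i
  have hchoice : ∀ i : Fin k, ∃ R : Finset (Fin n),
      (∀ j ∈ R, c₀.onStage j i) ∧ R.card = (z i).2 := by
    intro i
    rcases Nat.eq_zero_or_pos (z i).1 with h0 | hpos
    · exact ⟨∅, by simp, by simp [(hz i).2 h0]⟩
    · have h1 : (Finset.univ.filter fun j => c₀.onStage j i).card = N n z i := by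
        rw [← Set.ncard_coe_finset]
        have h2 := ncard_onStage hkn (c := c₀) (i := i) (by rw [hc₀, hy]; exact hpos)
        have h3 : N n c₀.toState i = N n z i := by
          rw [N, N]
          congr 1
          funext m
          exact hy _ m
        rw [← h3, ← h2]
        congr 1
        ext j
        simp
      obtain ⟨R, hR, hcard⟩ := Finset.exists_subset_card_eq (h1.symm ▸ (hz i).1)
      exact ⟨R, fun j hj => (Finset.mem_filter.1 (hR hj)).2, hcard⟩
  choose R hR hcard using hchoice
  refine ⟨ofCounts hkn y fun j => decide (∃ i, j ∈ R i), funext fun i => Prod.ext (hy _ i) ?_⟩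
  rw [← hcard i, ← Set.ncard_coe_finset]
  refine congrArg Set.ncard (Set.ext fun j => ?_)
  simp only [Set.mem_ofPred_eq, Finset.mem_coe]
  constructor
  · rintro ⟨h1, h2⟩
    obtain ⟨i', hi'⟩ := of_decide_eq_true h2
    have : i = i' := Fin.ext (onStage_unique (c := c₀) h1 (hR i' j hi'))
    rwa [this]
  · intro hj
    exact ⟨hR i j hj, decide_eq_true ⟨i, hj⟩⟩

end Config

lemma ncard_getElem?_eq_countP {α : Type*} (L : List α) (p : α → Bool) :
    {l : ℕ | ∃ s, L[l]? = some s ∧ p s = true}.ncard = L.countP p := by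
  induction L with
  | nil => simp
  | cons a L ih =>
    have hinj : Function.Injective Nat.succ := Nat.succ_injective
    have hset : {l : ℕ | ∃ s, (a :: L)[l]? = some s ∧ p s = true} =
        (if p a = true then {0} else ∅) ∪ Nat.succ '' {l : ℕ | ∃ s, L[l]? = some s ∧ p s = true} := by
      ext l
      rcases l with _ | l
      · by_cases h : p a = true <;> simp [h]
      · by_cases h : p a = true <;> simp [h]
    have hfin : {l : ℕ | ∃ s, L[l]? = some s ∧ p s = true}.Finite := by
      refine (Set.finite_lt_nat L.length).subset ?_
      rintro l ⟨s, hs, -⟩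
      exact (List.getElem?_eq_some_iff.1 hs).1
    have hfin' : (if p a = true then ({0} : Set ℕ) else ∅).Finite := by
      split_ifs <;> simp
    rw [hset, Set.ncard_union_eq _ hfin' (hfin.image _), Set.ncard_image_of_injective _ hinj, ih,
      List.countP_cons]
    · split_ifs <;> simp [add_comm]
    · rw [Set.disjoint_left]
      rintro l hl ⟨l', -, rfl⟩
      split_ifs at hl <;> simp at hl

namespace Input

variable {n k : ℕ} {μ₀ μ₁ : ℝ}

/-- If nothing happens before some positive time, the initial aggregate state is that of the
initial snapshot. -/
lemma stateAt_zero (hk : 1 ≤ k) (hkn : k ≤ n) (h₀ : 0 < μ₀) (h₁ : 0 < μ₁) {w : Input n k} {r : ℝ}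
    (h : IsQuiet μ₀ μ₁ w r) (hr : 0 < r) : w.stateAt μ₀ μ₁ 0 = w.init.toState := by
  -- Positivity of `r` separates time `0` from all events, so the completions by time `0` are
  -- exactly the recorded responses.
  have hcomp : ∀ l j, w.completion μ₀ μ₁ l j ≤ 0 ↔ w.init.responded j l := by
    intro l j
    constructor
    · intro hle
      by_contra hn
      have := h.le_completion hk hkn h₀ h₁ hn
      linarith
    · intro hresp
      exact (h.completion_of_responded hk hkn h₀ h₁ hresp).le
  have harr : ∀ l, w.arrival l ≤ 0 ↔ l < w.init.queries.length := by
    intro l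
    constructor
    · intro hle
      by_contra hn
      have := h.le_arrival (not_lt.1 hn)
      linarith
    · intro hl
      exact (if_pos hl : w.arrival l = 0).le
  have hdep : ∀ l, 0 < w.departure μ₀ μ₁ l := fun l =>
    hr.trans_le (h.le_departure hk hkn h₀ h₁ l)
  have hstage : ∀ i l, w.atStage μ₀ μ₁ 0 i l ↔
      ∃ s, w.init.queries[l]? = some s ∧ s.card = i := by
    intro i l
    simp only [atStage, harr, hdep, true_and, hcomp]
    constructor
    · rintro ⟨hl, hi⟩
      refine ⟨_, List.getElem?_eq_getElem hl, ?_⟩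
      rw [← hi, ← Set.ncard_coe_finset]
      congr 1
      ext j
      simp [Config.responded_iff_of_lt hl]
    · rintro ⟨s, hs, hi⟩
      obtain ⟨hl, rfl⟩ := List.getElem?_eq_some_iff.1 hs
      refine ⟨hl, ?_⟩
      rw [← hi, ← Set.ncard_coe_finset]
      congr 1
      ext j
      simp [Config.responded_iff_of_lt hl]
  have hserv : ∀ j l, w.serving μ₀ μ₁ 0 j l ↔ w.init.served j l := by
    intro j l
    constructor
    · rintro ⟨h1, h2, -⟩
      by_contra hs
      by_cases hresp : w.init.responded j l
      · rw [h.completion_of_responded hk hkn h₀ h₁ hresp] at h2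
        exact lt_irrefl _ h2
      · have := h.le_start hk hkn h₀ h₁ hresp hs
        linarith
    · intro hs
      exact ⟨(h.start_of_served hk hkn h₀ h₁ hs).le,
        hr.trans_le (h.le_completion hk hkn h₀ h₁ hs.2.1), hdep l⟩
  funext i
  refine Prod.ext ?_ ?_
  · change w.Y μ₀ μ₁ 0 i = _
    rw [Y, Config.toState, ← ncard_getElem?_eq_countP]
    simp only [hstage, decide_eq_true_eq]
  · change w.H μ₀ μ₁ 0 i = _
    rw [H, Config.toState]
    congr 1
    ext j
    simp only [Set.mem_ofPred_eq, hserv, hstage, Config.onStage_iff]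
    constructor
    · rintro ⟨l, hl, ⟨s, hs, hi⟩, hhigh⟩
      rw [isHigh_of_served hl] at hhigh
      rw [List.getElem?_eq_getElem hl.1, Option.some.injEq] at hs
      exact ⟨⟨l, hl, hs ▸ hi⟩, hhigh⟩
    · rintro ⟨⟨l, hl, hi⟩, hhigh⟩
      exact ⟨l, hl, ⟨_, List.getElem?_eq_getElem hl.1, hi⟩, by rwa [isHigh_of_served hl]⟩

end Input

end ForkJoin

namespace ForkJoin

/-! ### Exponential distributions -/

lemma lintegral_expMeasure (ρ : ℝ) {f : ℝ → ℝ≥0∞} (hf : Measurable f) :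
    ∫⁻ x, f x ∂expMeasure ρ =
      ∫⁻ x in Set.Ioi 0, ENNReal.ofReal (ρ * Real.exp (-(ρ * x))) * f x := by
  have h1 : expMeasure ρ = volume.withDensity (exponentialPDF ρ) := rfl
  have hm : Measurable (exponentialPDF ρ) := (measurable_exponentialPDFReal ρ).ennreal_ofReal
  rw [h1, lintegral_withDensity_eq_lintegral_mul _ hm hf, Measure.restrict_congr_set Ioi_ae_eq_Ici,
    ← lintegral_indicator measurableSet_Ici]
  refine lintegral_congr fun x => ?_
  simp only [Pi.mul_apply, exponentialPDF_eq, Set.indicator_apply, Set.mem_Ici]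
  split_ifs <;> simp

/-- After translation by `s` the density at `x + s` factors into `exp (-(ρ * s))` times the density
at `x`. -/
lemma lintegral_expMeasure_memoryless (ρ : ℝ) {s : ℝ} (hs : 0 ≤ s) {f : ℝ → ℝ≥0∞}
    (hf : Measurable f) :
    ∫⁻ x in Set.Ioi s, f (x - s) ∂expMeasure ρ =
      ENNReal.ofReal (Real.exp (-(ρ * s))) * ∫⁻ x, f x ∂expMeasure ρ := by
  rw [← lintegral_indicator measurableSet_Ioi,
    lintegral_expMeasure ρ ((by fun_prop : Measurable fun x => f (x - s)).indicator
      measurableSet_Ioi), lintegral_expMeasure ρ hf, ← lintegral_indicator measurableSet_Ioi,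
    ← lintegral_add_right_eq_self _ s, ← lintegral_const_mul _ (by fun_prop),
    ← lintegral_indicator measurableSet_Ioi]
  refine lintegral_congr fun x => ?_
  simp only [Set.indicator_apply, Set.mem_Ioi, lt_add_iff_pos_left, add_sub_cancel_right]
  by_cases hx : 0 < x
  · have : 0 < x + s := by linarith
    simp only [hx, this, if_true]
    rw [← mul_assoc, ← ENNReal.ofReal_mul (Real.exp_nonneg _)]
    congr 2
    rw [mul_left_comm, ← Real.exp_add]
    congr 2
    ring
  · simp [hx]

lemma expMeasure_memoryless (ρ : ℝ) {s : ℝ} (hs : 0 ≤ s) {B : Set ℝ} (hB : MeasurableSet B) :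
    expMeasure ρ {x | s < x ∧ x - s ∈ B} =
      ENNReal.ofReal (Real.exp (-(ρ * s))) * expMeasure ρ B := by
  have h := lintegral_expMeasure_memoryless ρ hs (f := B.indicator 1)
    (measurable_one.indicator hB)
  rw [lintegral_indicator_one hB] at h
  rw [← h]
  have h2 : MeasurableSet ((fun x => x - s) ⁻¹' B) := hB.preimage (by fun_prop)
  have h3 : ∀ x, B.indicator (1 : ℝ → ℝ≥0∞) (x - s) = ((fun x => x - s) ⁻¹' B).indicator 1 x :=
    fun x => rfl
  simp only [h3]
  rw [lintegral_indicator_one h2, Measure.restrict_apply h2]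
  congr 1
  ext x
  exact and_comm

lemma ae_pos_expMeasure (ρ : ℝ) : ∀ᵐ x ∂expMeasure ρ, 0 < x := by
  have h : ∫⁻ x, (Set.Iic 0).indicator 1 x ∂expMeasure ρ = 0 := by
    rw [lintegral_expMeasure ρ (measurable_one.indicator measurableSet_Iic),
      ← lintegral_indicator measurableSet_Ioi]
    refine (lintegral_congr fun x => ?_).trans lintegral_zero
    by_cases hx : 0 < x
    · simp [hx]
    · simp [hx]
  rw [lintegral_indicator_one measurableSet_Iic] at h
  rw [ae_iff]
  convert h using 2
  ext x
  simp

instance : IsProbabilityMeasure (expMeasure 1) := isProbabilityMeasure_expMeasure one_pos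

lemma map_div_expMeasure_one {v : ℝ} (hv : 0 < v) :
    (expMeasure 1).map (fun x => x / v) = expMeasure v := by
  have := isProbabilityMeasure_expMeasure hv
  have hm : Measurable fun x : ℝ => x / v := by fun_prop
  have := Measure.isProbabilityMeasure_map (μ := expMeasure 1) hm.aemeasurable
  refine Measure.eq_of_cdf _ _ (StieltjesFunction.ext fun x => ?_)
  have h1 : (fun x : ℝ => x / v) ⁻¹' Set.Iic x = Set.Iic (v * x) := by
    ext y
    simp only [Set.mem_preimage, Set.mem_Iic]
    rw [div_le_iff₀ hv, mul_comm]
  rw [cdf_eq_real, map_measureReal_apply hm measurableSet_Iic, h1, ← cdf_eq_real,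
    cdf_expMeasure_eq one_pos, cdf_expMeasure_eq hv]
  simp only [one_mul, mul_nonneg_iff_of_pos_left hv]

/-! ### Infinite products -/

section InfinitePi

variable {ι : Type*} {X : Type*} [MeasurableSpace X] (μ : ι → Measure X)
  [∀ i, IsProbabilityMeasure (μ i)]

open Classical in
/-- Resampling some of the coordinates does not change a product measure. -/
lemma infinitePi_resample (A : Set ι) :
    ((Measure.infinitePi μ).prod (Measure.infinitePi μ)).map
      (fun q => A.piecewise q.1 q.2) = Measure.infinitePi μ := by
  have hmeas : Measurable fun q : (ι → X) × (ι → X) => A.piecewise q.1 q.2 := by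
    refine measurable_pi_lambda _ fun i => ?_
    by_cases hi : i ∈ A
    · simp only [Set.piecewise, hi, if_true]; fun_prop
    · simp only [Set.piecewise, hi, if_false]; fun_prop
  refine Measure.eq_infinitePi _ fun s t ht => ?_
  rw [Measure.map_apply hmeas (MeasurableSet.pi s.countable_toSet fun i _ => ht i)]
  have hset : (fun q : (ι → X) × (ι → X) => A.piecewise q.1 q.2) ⁻¹' (s : Set ι).pi t =
      ((s.filter (· ∈ A) : Finset ι) : Set ι).pi t ×ˢ
        ((s.filter (¬ · ∈ A) : Finset ι) : Set ι).pi t := by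
    ext q
    simp only [Set.mem_preimage, Set.mem_pi, Set.mem_prod, Finset.mem_coe, Finset.mem_filter]
    constructor
    · intro h
      refine ⟨fun i hi => ?_, fun i hi => ?_⟩
      · have := h i hi.1
        rwa [Set.piecewise_eq_of_mem _ _ _ hi.2] at this
      · have := h i hi.1
        rwa [Set.piecewise_eq_of_notMem _ _ _ hi.2] at this
    · rintro ⟨h1, h2⟩ i hi
      by_cases hA : i ∈ A
      · rw [Set.piecewise_eq_of_mem _ _ _ hA]; exact h1 i ⟨hi, hA⟩
      · rw [Set.piecewise_eq_of_notMem _ _ _ hA]; exact h2 i ⟨hi, hA⟩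
  rw [hset, Measure.prod_prod, Measure.infinitePi_pi _ fun i _ => ht i,
    Measure.infinitePi_pi _ fun i _ => ht i, Finset.prod_filter_mul_prod_filter_not]

open Classical in
lemma lintegral_infinitePi_resample (A : Set ι) {f : (ι → X) → ℝ≥0∞} (hf : Measurable f) :
    ∫⁻ x, f x ∂Measure.infinitePi μ =
      ∫⁻ x', ∫⁻ x, f (A.piecewise x' x) ∂Measure.infinitePi μ ∂Measure.infinitePi μ := by
  have hmeas : Measurable fun q : (ι → X) × (ι → X) => A.piecewise q.1 q.2 := by
    refine measurable_pi_lambda _ fun i => ?_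
    by_cases hi : i ∈ A
    · simp only [Set.piecewise, hi, if_true]; fun_prop
    · simp only [Set.piecewise, hi, if_false]; fun_prop
  conv_lhs => rw [← infinitePi_resample μ A]
  rw [lintegral_map hf hmeas]
  exact lintegral_prod _ (hf.comp hmeas).aemeasurable

/-- Resampling the single coordinate `a` separates it from all others. This is how the clock that
rings first is singled out. -/
lemma lintegral_infinitePi_update [DecidableEq ι] (a : ι) {f : (ι → X) → ℝ≥0∞}
    (hf : Measurable f) :
    ∫⁻ x, f x ∂Measure.infinitePi μ =
      ∫⁻ y, ∫⁻ x, f (Function.update x a y) ∂Measure.infinitePi μ ∂μ a := by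
  classical
  rw [lintegral_infinitePi_resample μ {a} hf, ← Measure.infinitePi_map_eval μ a, lintegral_map]
  · refine lintegral_congr fun x' => lintegral_congr fun x => ?_
    congr 1
    funext i
    by_cases hi : i = a
    · subst hi; simp
    · simp [hi]
  · have : Measurable fun q : X × (ι → X) => f (Function.update q.2 a q.1) := by
      refine hf.comp (measurable_pi_lambda _ fun i => ?_)
      by_cases hi : i = a
      · subst hi; simp only [Function.update_self]; fun_prop
      · simp only [Function.update_of_ne hi]; fun_prop
    exact this.lintegral_prod_right'
  · fun_prop

/-- An i.i.d. family read along an injection is again i.i.d. with the same law; needed when a gap is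
used up or a departure shifts the labels of the queries. -/
lemma lintegral_infinitePi_reindex (ν : Measure X) [IsProbabilityMeasure ν] {σ : ι → ι}
    (hσ : Function.Injective σ) {f : (ι → X) → ℝ≥0∞} (hf : Measurable f) :
    ∫⁻ x, f (fun i => x (σ i)) ∂Measure.infinitePi (fun _ => ν) =
      ∫⁻ x, f x ∂Measure.infinitePi (fun _ => ν) := by
  conv_rhs => rw [← Measure.map_infinitePi_infinitePi_of_inj (P := fun _ : ι => ν) hσ]
  rw [lintegral_map hf (by fun_prop)]

end InfinitePi

/-! ### Memorylessness of several clocks -/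

section Shift

variable {ι : Type*} [DecidableEq ι] (ρ : ℝ) [IsProbabilityMeasure (expMeasure ρ)]
  (A : Finset ι) (v : ι → ℝ)

omit [IsProbabilityMeasure (expMeasure ρ)] in
lemma measurable_shiftOn : Measurable fun q : ℝ × (ι → ℝ) => shiftOn A v q.1 q.2 := by
  refine measurable_pi_lambda _ fun i => ?_
  by_cases hi : i ∈ A
  · simp only [shiftOn, hi, if_true]; fun_prop
  · simp only [shiftOn, hi, if_false]; fun_prop

omit [DecidableEq ι] [IsProbabilityMeasure (expMeasure ρ)] in
lemma measurableSet_running (r : ℝ) : MeasurableSet {x : ι → ℝ | ∀ i ∈ A, r * v i < x i} := by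
  have : {x : ι → ℝ | ∀ i ∈ A, r * v i < x i} = ⋂ i ∈ A, {x | r * v i < x i} := by
    ext; simp
  rw [this]
  exact Finset.measurableSet_biInter _ fun i _ =>
    measurableSet_lt measurable_const (measurable_pi_apply i)

/-- Memorylessness of finitely many independent exponential clocks. -/
lemma map_shiftOn_infinitePi (hv : ∀ i, 0 ≤ v i) {r : ℝ} (hr : 0 ≤ r) :
    ((Measure.infinitePi fun _ : ι => expMeasure ρ).restrict
        {x | ∀ i ∈ A, r * v i < x i}).map (shiftOn A v r) =
      ENNReal.ofReal (Real.exp (-(ρ * (r * ∑ i ∈ A, v i)))) •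
        Measure.infinitePi fun _ : ι => expMeasure ρ := by
  classical
  set M := Measure.infinitePi fun _ : ι => expMeasure ρ
  set q : ι → ℝ≥0∞ := fun i => ENNReal.ofReal (Real.exp (-(ρ * (r * v i))))
  have hq : ENNReal.ofReal (Real.exp (-(ρ * (r * ∑ i ∈ A, v i)))) = ∏ i ∈ A, q i := by
    rw [← ENNReal.ofReal_prod_of_nonneg fun i _ => Real.exp_nonneg _, ← Real.exp_sum,
      Finset.sum_neg_distrib, ← Finset.mul_sum, ← Finset.mul_sum]
  have hq0 : ENNReal.ofReal (Real.exp (-(ρ * (r * ∑ i ∈ A, v i)))) ≠ 0 := by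
    simp [Real.exp_pos]
  set c := ENNReal.ofReal (Real.exp (-(ρ * (r * ∑ i ∈ A, v i))))
  have hctop : c ≠ ∞ := ENNReal.ofReal_ne_top
  have hms : Measurable (shiftOn A v r) :=
    (measurable_shiftOn A v).comp (measurable_const.prodMk measurable_id)
  -- Once normalised, the push-forward is identified as the product measure by its values on boxes.
  have key : c⁻¹ • (M.restrict {x | ∀ i ∈ A, r * v i < x i}).map (shiftOn A v r) = M := by
    refine Measure.eq_infinitePi _ fun s t ht => ?_
    have hpi : MeasurableSet ((s : Set ι).pi t) :=
      MeasurableSet.pi s.countable_toSet fun i _ => ht i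
    rw [Measure.smul_apply, Measure.map_apply hms hpi, Measure.restrict_apply (hms hpi)]
    -- A running clock outside `s` is unconstrained after the shift but must still outlast `r`,
    -- hence the default `Set.univ`.
    set t' : ι → Set ℝ := fun i => if i ∈ A then
      {x | r * v i < x ∧ x - r * v i ∈ (if i ∈ s then t i else Set.univ)} else t i with ht'
    have hset : shiftOn A v r ⁻¹' (s : Set ι).pi t ∩ {x | ∀ i ∈ A, r * v i < x i} =
        ((A ∪ s : Finset ι) : Set ι).pi t' := by
      ext x
      simp only [Set.mem_inter_iff, Set.mem_preimage, Set.mem_pi, Finset.mem_coe,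
        Set.mem_ofPred_eq, Finset.mem_union, ht', shiftOn]
      constructor
      · rintro ⟨h1, h2⟩ i hi
        by_cases hA : i ∈ A
        · simp only [hA, if_true, Set.mem_ofPred_eq]
          refine ⟨h2 i hA, ?_⟩
          split_ifs with his
          · simpa [hA] using h1 i his
          · trivial
        · have his := hi.resolve_left hA
          simpa [hA] using h1 i his
      · intro h
        refine ⟨fun i hi => ?_, fun i hi => ?_⟩
        · have := h i (Or.inr hi)
          by_cases hA : i ∈ A
          · simp only [hA, if_true, Set.mem_ofPred_eq, hi] at this ⊢
            exact this.2
          · simpa [hA] using this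
        · have := h i (Or.inl hi)
          simp only [hi, if_true, Set.mem_ofPred_eq] at this
          exact this.1
    have hmt : ∀ i, MeasurableSet (t' i) := by
      intro i
      simp only [ht']
      split_ifs with h1 h2
      · exact (measurableSet_lt measurable_const measurable_id).inter
          ((ht i).preimage (by fun_prop : Measurable fun x : ℝ => x - r * v i))
      · exact (measurableSet_lt measurable_const measurable_id).inter
          (MeasurableSet.univ.preimage (by fun_prop : Measurable fun x : ℝ => x - r * v i))
      · exact ht i
    have hval : ∀ i ∈ A ∪ s, expMeasure ρ (t' i) =
        (if i ∈ A then q i else 1) * (if i ∈ s then expMeasure ρ (t i) else 1) := by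
      intro i hi
      by_cases hA : i ∈ A
      · simp only [ht', hA, if_true]
        rw [expMeasure_memoryless ρ (mul_nonneg hr (hv i))]
        · split_ifs with his
          · rfl
          · simp [q]
        · split_ifs
          · exact ht i
          · exact MeasurableSet.univ
      · have his := (Finset.mem_union.1 hi).resolve_left hA
        simp [ht', hA, his]
    rw [hset, Measure.infinitePi_pi _ fun i _ => hmt i, Finset.prod_congr rfl hval,
      Finset.prod_mul_distrib, Finset.prod_ite_mem, Finset.prod_ite_mem,
      Finset.inter_eq_right.2 Finset.subset_union_left,
      Finset.inter_eq_right.2 Finset.subset_union_right, ← hq, smul_eq_mul, ← mul_assoc,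
      ENNReal.inv_mul_cancel hq0 hctop, one_mul]
  conv_rhs => rw [← key]
  rw [smul_smul, ENNReal.mul_inv_cancel hq0 hctop, one_smul]

lemma lintegral_shiftOn_infinitePi (hv : ∀ i, 0 ≤ v i) {r : ℝ} (hr : 0 ≤ r)
    {f : (ι → ℝ) → ℝ≥0∞} (hf : Measurable f) :
    ∫⁻ x in {x | ∀ i ∈ A, r * v i < x i}, f (shiftOn A v r x)
        ∂Measure.infinitePi (fun _ : ι => expMeasure ρ) =
      ENNReal.ofReal (Real.exp (-(ρ * (r * ∑ i ∈ A, v i)))) *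
        ∫⁻ x, f x ∂Measure.infinitePi fun _ : ι => expMeasure ρ := by
  have hms : Measurable (shiftOn A v r) :=
    (measurable_shiftOn A v).comp (measurable_const.prodMk measurable_id)
  rw [← lintegral_map hf hms, map_shiftOn_infinitePi ρ A v hv hr, lintegral_smul_measure,
    smul_eq_mul]

end Shift

/-! ### Coins -/

/-- The law of a coin showing `true` with probability `p`. -/
def coinLaw (p : ℝ) : Measure Bool :=
  ENNReal.ofReal p • Measure.dirac true + ENNReal.ofReal (1 - p) • Measure.dirac false

lemma isProbabilityMeasure_coinLaw {p : ℝ} (h₀ : 0 ≤ p) (h₁ : p ≤ 1) :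
    IsProbabilityMeasure (coinLaw p) := by
  constructor
  simp only [coinLaw, Measure.coe_add, Measure.coe_smul, Pi.add_apply, Pi.smul_apply,
    measure_univ, smul_eq_mul, mul_one]
  rw [← ENNReal.ofReal_add h₀ (by linarith)]
  simp

lemma coinLaw_true (p : ℝ) : coinLaw p {true} = ENNReal.ofReal p := by
  simp [coinLaw]

lemma coinLaw_false (p : ℝ) : coinLaw p {false} = ENNReal.ofReal (1 - p) := by
  simp [coinLaw]

/-- The number of heads among finitely many coins is binomial. -/
lemma lintegral_ncard_coins {ι α : Type*} [Finite α] {p : ℝ} (h₀ : 0 ≤ p) (h₁ : p ≤ 1)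
    [IsProbabilityMeasure (coinLaw p)] (F : Set α) {κ : α → ι} (hκ : Function.Injective κ)
    (ψ : ℕ → ℝ≥0∞) :
    ∫⁻ b, ψ {j | j ∈ F ∧ b (κ j) = true}.ncard ∂Measure.infinitePi (fun _ : ι => coinLaw p) =
      ∑ m ∈ Finset.range (F.ncard + 1),
        ENNReal.ofReal (binomialWeight F.ncard p m) * ψ m := by
  classical
  set M := Measure.infinitePi (fun _ : ι => coinLaw p)
  set F' : Finset α := F.toFinite.toFinset with hF'
  have hmemF : ∀ j, j ∈ F' ↔ j ∈ F := fun j => by simp [F']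
  have hcard : F'.card = F.ncard := (Set.ncard_eq_toFinset_card F).symm
  -- The events that `T` is exactly the set of heads partition the coin space. Their probabilities
  -- depend only on the size of `T`, and grouping subsets by size produces the binomial
  -- coefficients.
  set E : Finset α → Set (ι → Bool) := fun T => {b | ∀ j ∈ F', b (κ j) = decide (j ∈ T)}
  have hEpi : ∀ T, E T = ((F'.image κ : Finset ι) : Set ι).pi
      fun i => {decide (∃ j ∈ T, κ j = i)} := by
    intro T
    ext b
    simp only [E, Set.mem_ofPred_eq, Set.mem_pi, Finset.coe_image, Set.mem_image, Finset.mem_coe,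
      forall_exists_index, and_imp, forall_apply_eq_imp_iff₂, Set.mem_singleton_iff]
    refine forall₂_congr fun j hj => ?_
    simp [hκ.eq_iff]
  have hEmeas : ∀ T, MeasurableSet (E T) := fun T => by
    rw [hEpi]
    exact MeasurableSet.pi (Finset.countable_toSet _) fun i _ => measurableSet_singleton _
  have hEval : ∀ T ∈ F'.powerset, M (E T) =
      ENNReal.ofReal (p ^ T.card * (1 - p) ^ (F'.card - T.card)) := by
    intro T hT
    rw [Finset.mem_powerset] at hT
    rw [hEpi, Measure.infinitePi_pi _ fun i _ => measurableSet_singleton _,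
      Finset.prod_image fun a _ b _ h => hκ h]
    have : ∀ j ∈ F', coinLaw p {decide (∃ j' ∈ T, κ j' = κ j)} =
        if j ∈ T then ENNReal.ofReal p else ENNReal.ofReal (1 - p) := by
      intro j _
      simp only [hκ.eq_iff, exists_eq_right]
      split_ifs with h
      · simp [h, coinLaw_true]
      · simp [h, coinLaw_false]
    rw [Finset.prod_congr rfl this, Finset.prod_ite, Finset.prod_const, Finset.prod_const,
      ENNReal.ofReal_mul (by positivity), ENNReal.ofReal_pow h₀, ENNReal.ofReal_pow (by linarith)]
    have h1 : F'.filter (· ∈ T) = T := by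
      ext j; simp only [Finset.mem_filter]; exact ⟨fun h => h.2, fun h => ⟨hT h, h⟩⟩
    have h2 : F'.filter (¬ · ∈ T) = F' \ T := by
      ext j; simp
    rw [h1, h2, Finset.card_sdiff_of_subset hT]
  have hdisj : ((F'.powerset : Finset (Finset α)) : Set (Finset α)).PairwiseDisjoint E := by
    intro T hT T' hT' hne
    rw [Function.onFun, Set.disjoint_left]
    intro b hb hb'
    refine hne (Finset.ext fun j => ?_)
    have hT := Finset.mem_powerset.1 hT
    have hT' := Finset.mem_powerset.1 hT'
    by_cases hj : j ∈ F'
    · have := (hb j hj).symm.trans (hb' j hj)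
      simpa using this
    · exact iff_of_false (fun h => hj (hT h)) (fun h => hj (hT' h))
  have hunion : (⋃ T ∈ F'.powerset, E T) = Set.univ := by
    refine Set.eq_univ_of_forall fun b => ?_
    simp only [Set.mem_iUnion]
    refine ⟨F'.filter fun j => b (κ j) = true, by simp, fun j hj => ?_⟩
    simp [hj]
  have hcount : ∀ T ∈ F'.powerset, ∀ b ∈ E T, {j | j ∈ F ∧ b (κ j) = true}.ncard = T.card := by
    intro T hT b hb
    rw [← Set.ncard_coe_finset]
    congr 1
    ext j
    simp only [Set.mem_ofPred_eq, Finset.mem_coe]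
    constructor
    · rintro ⟨hj, hbj⟩
      have := hb j ((hmemF j).2 hj)
      rw [hbj] at this
      exact of_decide_eq_true this.symm
    · intro hj
      have hjF := Finset.mem_powerset.1 hT hj
      exact ⟨(hmemF j).1 hjF, by rw [hb j hjF]; simpa using hj⟩
  rw [← setLIntegral_univ, ← hunion, lintegral_biUnion_finset hdisj fun T _ => hEmeas T]
  have : ∀ T ∈ F'.powerset, ∫⁻ b in E T, ψ {j | j ∈ F ∧ b (κ j) = true}.ncard ∂M =
      ENNReal.ofReal (p ^ T.card * (1 - p) ^ (F'.card - T.card)) * ψ T.card := by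
    intro T hT
    rw [setLIntegral_congr_fun (g := fun _ => ψ T.card) (hEmeas T)
      fun b hb => congrArg ψ (hcount T hT b hb), setLIntegral_const, hEval T hT, mul_comm]
  rw [Finset.sum_congr rfl this, Finset.sum_powerset_apply_card
    (fun m => ENNReal.ofReal (p ^ m * (1 - p) ^ (F'.card - m)) * ψ m), hcard]
  refine Finset.sum_congr rfl fun m _ => ?_
  have h2 : 0 ≤ 1 - p := by linarith
  rw [binomialWeight, mul_assoc, ENNReal.ofReal_mul (Nat.cast_nonneg _), ENNReal.ofReal_natCast,
    nsmul_eq_mul, mul_assoc]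

end ForkJoin

namespace ForkJoin

/-! ### Measurability -/

/-- A positive value `m` means that the set is one of the countably many finite sets of size `m`.
The value `0` is also taken by infinite sets, so its preimage is treated as the complement of the
others. -/
lemma measurable_ncard {α ι : Type*} [MeasurableSpace α] [Countable ι] {S : α → ι → Prop}
    (hS : ∀ i, MeasurableSet {a | S a i}) : Measurable fun a => {i | S a i}.ncard := by
  classical
  have hpos : ∀ m, 0 < m → MeasurableSet {a | {i | S a i}.ncard = m} := by
    intro m hm
    have : {a | {i | S a i}.ncard = m} =
        ⋃ T : {T : Finset ι // T.card = m}, ⋂ i, {a | S a i ↔ i ∈ T.1} := by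
      ext a
      simp only [Set.mem_ofPred_eq, Set.mem_iUnion, Set.mem_iInter, Subtype.exists, exists_prop]
      constructor
      · intro h
        have hfin : {i | S a i}.Finite := Set.finite_of_ncard_pos (h ▸ hm)
        refine ⟨hfin.toFinset, ?_, by simp⟩
        rw [← Set.ncard_eq_toFinset_card _ hfin, h]
      · rintro ⟨T, hT, h⟩
        have : {i | S a i} = (T : Set ι) := by
          ext i; simpa using h i
        rw [this, Set.ncard_coe_finset, hT]
    rw [this]
    refine MeasurableSet.iUnion fun T => MeasurableSet.iInter fun i => ?_
    by_cases hi : i ∈ T.1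
    · simpa [hi] using hS i
    · have : {a | S a i ↔ i ∈ T.1} = {a | S a i}ᶜ := by ext; simp [hi]
      rw [this]
      exact (hS i).compl
  refine measurable_to_countable' fun m => ?_
  rcases Nat.eq_zero_or_pos m with rfl | hm
  · have : (fun a => {i | S a i}.ncard) ⁻¹' {0} =
        (⋃ m : {m : ℕ // 0 < m}, {a | {i | S a i}.ncard = m})ᶜ := by
      ext a
      simp only [Set.mem_preimage, Set.mem_singleton_iff, Set.mem_compl_iff, Set.mem_iUnion,
        Set.mem_ofPred_eq, Subtype.exists, not_exists]
      constructor
      · intro h m hm hc; omega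
      · intro h
        by_contra hne
        exact h _ (Nat.pos_of_ne_zero hne) rfl
    rw [this]
    exact (MeasurableSet.iUnion fun m : {m : ℕ // 0 < m} => hpos m.1 m.2).compl
  · exact hpos m hm

lemma measurable_kthSmallest {n k : ℕ} (hk : 1 ≤ k) (hkn : k ≤ n) :
    Measurable fun x : Fin n → ℝ => Input.kthSmallest k x := by
  refine measurable_of_Iic fun t => ?_
  have : (fun x : Fin n → ℝ => Input.kthSmallest k x) ⁻¹' Set.Iic t =
      (fun x : Fin n → ℝ => {j | x j ≤ t}.ncard) ⁻¹' Set.Ici k := by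
    ext x
    exact kthSmallest_le_iff hk hkn x t
  rw [this]
  refine (measurable_ncard fun j => ?_) (measurableSet_Ici)
  exact measurableSet_le (measurable_pi_apply j) measurable_const

/-- Interarrival times, service requirements and coins. -/
abbrev Noise (n : ℕ) : Type := (ℕ → ℝ) × (Fin n × ℕ → ℝ) × (Fin n × ℕ → Bool)

/-- The realisation with snapshot `c` and noise `e`. -/
def inp {n k : ℕ} (c : Config n k) (e : Noise n) : Input n k := ⟨c, e.1, e.2.1, e.2.2⟩

section

variable {n k : ℕ} {μ₀ μ₁ : ℝ} (c : Config n k)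

lemma measurable_isHigh (j : Fin n) (l : ℕ) :
    Measurable fun e : Noise n => (inp c e).isHigh j l := by
  by_cases h : c.served j l
  · have : (fun e : Noise n => (inp c e).isHigh j l) = fun _ => c.rate j :=
      funext fun e => Input.isHigh_of_served h
    rw [this]; exact measurable_const
  · have : (fun e : Noise n => (inp c e).isHigh j l) = fun e => e.2.2 (j, l) :=
      funext fun e => Input.isHigh_of_not_served h
    rw [this]; fun_prop

lemma measurable_arrival (l : ℕ) : Measurable fun e : Noise n => (inp c e).arrival l := by
  by_cases h : l < c.queries.length
  · have : (fun e : Noise n => (inp c e).arrival l) = fun _ => 0 := funext fun e => if_pos h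
    rw [this]; exact measurable_const
  · have : (fun e : Noise n => (inp c e).arrival l) =
        fun e => ∑ m ∈ Finset.range (l - c.queries.length + 1), e.1 m := funext fun e => if_neg h
    rw [this]; fun_prop

lemma measurable_service (j : Fin n) (l : ℕ) :
    Measurable fun e : Noise n => (inp c e).service μ₀ μ₁ j l := by
  by_cases h : c.responded j l
  · have : (fun e : Noise n => (inp c e).service μ₀ μ₁ j l) = fun _ => 0 :=
      funext fun e => Input.service_of_responded h
    rw [this]; exact measurable_const
  · have : (fun e : Noise n => (inp c e).service μ₀ μ₁ j l) =
        fun e => e.2.1 (j, l) / speed μ₀ μ₁ ((inp c e).isHigh j l) :=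
      funext fun e => Input.service_of_not_responded h
    rw [this]
    have h2 : Measurable (speed μ₀ μ₁) := measurable_from_top
    exact Measurable.div (by fun_prop) (h2.comp (measurable_isHigh c j l))

lemma measurable_free (hk : 1 ≤ k) (hkn : k ≤ n) (l : ℕ) :
    Measurable fun e : Noise n => (inp c e).free μ₀ μ₁ l := by
  induction l with
  | zero => exact measurable_const
  | succ l ih =>
    have hc : Measurable fun e : Noise n => (inp c e).completion μ₀ μ₁ l := by
      refine measurable_pi_lambda _ fun j => ?_
      exact ((measurable_arrival c l).max ((measurable_pi_apply j).comp ih)).add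
        (measurable_service c j l)
    refine measurable_pi_lambda _ fun j => ?_
    exact ((measurable_pi_apply j).comp hc).min ((measurable_kthSmallest hk hkn).comp hc)

lemma measurable_start (hk : 1 ≤ k) (hkn : k ≤ n) (l : ℕ) (j : Fin n) :
    Measurable fun e : Noise n => (inp c e).start μ₀ μ₁ l j :=
  (measurable_arrival c l).max ((measurable_pi_apply j).comp (measurable_free c hk hkn l))

lemma measurable_completion (hk : 1 ≤ k) (hkn : k ≤ n) (l : ℕ) (j : Fin n) :
    Measurable fun e : Noise n => (inp c e).completion μ₀ μ₁ l j :=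
  (measurable_start c hk hkn l j).add (measurable_service c j l)

lemma measurable_departure (hk : 1 ≤ k) (hkn : k ≤ n) (l : ℕ) :
    Measurable fun e : Noise n => (inp c e).departure μ₀ μ₁ l :=
  (measurable_kthSmallest hk hkn).comp
    (measurable_pi_lambda _ fun j => measurable_completion c hk hkn l j)

lemma measurableSet_atStage (hk : 1 ≤ k) (hkn : k ≤ n) (i l : ℕ) :
    MeasurableSet {q : ℝ × Noise n | (inp c q.2).atStage μ₀ μ₁ q.1 i l} := by
  have h1 := (measurable_arrival c l).comp (measurable_snd : Measurable (Prod.snd : ℝ × Noise n → Noise n))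
  have h2 := (measurable_departure (μ₀ := μ₀) (μ₁ := μ₁) c hk hkn l).comp (measurable_snd : Measurable (Prod.snd : ℝ × Noise n → Noise n))
  have h3 : ∀ j, Measurable fun q : ℝ × Noise n => (inp c q.2).completion μ₀ μ₁ l j :=
    fun j => (measurable_completion c hk hkn l j).comp (measurable_snd : Measurable (Prod.snd : ℝ × Noise n → Noise n))
  refine (measurableSet_le h1 measurable_fst).inter ((measurableSet_lt measurable_fst h2).inter ?_)
  exact (measurable_ncard fun j => measurableSet_le (h3 j) measurable_fst)
    (measurableSet_singleton i)

lemma measurableSet_serving (hk : 1 ≤ k) (hkn : k ≤ n) (j : Fin n) (l : ℕ) :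
    MeasurableSet {q : ℝ × Noise n | (inp c q.2).serving μ₀ μ₁ q.1 j l} := by
  have h1 := (measurable_start (μ₀ := μ₀) (μ₁ := μ₁) c hk hkn l j).comp (measurable_snd : Measurable (Prod.snd : ℝ × Noise n → Noise n))
  have h2 := (measurable_departure (μ₀ := μ₀) (μ₁ := μ₁) c hk hkn l).comp (measurable_snd : Measurable (Prod.snd : ℝ × Noise n → Noise n))
  have h3 := (measurable_completion (μ₀ := μ₀) (μ₁ := μ₁) c hk hkn l j).comp
    (measurable_snd : Measurable (Prod.snd : ℝ × Noise n → Noise n))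
  exact (measurableSet_le h1 measurable_fst).inter ((measurableSet_lt measurable_fst h3).inter
    (measurableSet_lt measurable_fst h2))

lemma measurable_stateAt (hk : 1 ≤ k) (hkn : k ≤ n) :
    Measurable fun q : ℝ × Noise n => (inp c q.2).stateAt μ₀ μ₁ q.1 := by
  refine measurable_pi_lambda _ fun i => Measurable.prodMk ?_ ?_
  · exact measurable_ncard fun l => measurableSet_atStage c hk hkn i l
  · refine measurable_ncard fun j => ?_
    have : {q : ℝ × Noise n | ∃ l, (inp c q.2).serving μ₀ μ₁ q.1 j l ∧
        (inp c q.2).atStage μ₀ μ₁ q.1 i l ∧ (inp c q.2).isHigh j l = true} =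
        ⋃ l, {q : ℝ × Noise n | (inp c q.2).serving μ₀ μ₁ q.1 j l} ∩
          ({q : ℝ × Noise n | (inp c q.2).atStage μ₀ μ₁ q.1 i l} ∩
            {q : ℝ × Noise n | (inp c q.2).isHigh j l = true}) := by
      ext q
      simp only [Set.mem_ofPred_eq, Set.mem_iUnion, Set.mem_inter_iff]
    rw [this]
    refine MeasurableSet.iUnion fun l => (measurableSet_serving c hk hkn j l).inter
      ((measurableSet_atStage c hk hkn i l).inter ?_)
    exact ((measurable_isHigh c j l).comp measurable_snd) (measurableSet_singleton true)

end

instance {n k : ℕ} : Countable (Config n k) := by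
  have : Function.Injective fun c : Config n k => (c.queries, c.rate) := by
    rintro ⟨q, r, _, _⟩ ⟨q', r', _, _⟩ h
    simp only [Prod.mk.injEq] at h
    obtain ⟨rfl, rfl⟩ := h
    rfl
  exact this.countable

instance {n k : ℕ} : MeasurableSingletonClass (Config n k) := ⟨fun _ => trivial⟩

/-! ### The law of the noise -/

section

variable (n : ℕ) (lam p : ℝ) [IsProbabilityMeasure (expMeasure lam)]
  [IsProbabilityMeasure (coinLaw p)]

/-- The law of the interarrival times. -/
def gapLaw : Measure (ℕ → ℝ) := Measure.infinitePi fun _ => expMeasure lam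

/-- The law of the service requirements. -/
def workLaw : Measure (Fin n × ℕ → ℝ) := Measure.infinitePi fun _ => expMeasure 1

/-- The law of the coins. -/
def coinsLaw : Measure (Fin n × ℕ → Bool) := Measure.infinitePi fun _ => coinLaw p

instance : IsProbabilityMeasure (gapLaw lam) := by unfold gapLaw; infer_instance
instance : IsProbabilityMeasure (workLaw n) := by unfold workLaw; infer_instance
instance : IsProbabilityMeasure (coinsLaw n p) := by unfold coinsLaw; infer_instance

/-- The law of the noise. -/
def noiseLaw : Measure (Noise n) := (gapLaw lam).prod ((workLaw n).prod (coinsLaw n p))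

instance : IsProbabilityMeasure (noiseLaw n lam p) := by unfold noiseLaw; infer_instance

variable {n lam p}

omit [IsProbabilityMeasure (expMeasure lam)] in
lemma lintegral_noiseLaw {f : Noise n → ℝ≥0∞} (hf : Measurable f) :
    ∫⁻ e, f e ∂noiseLaw n lam p =
      ∫⁻ g, ∫⁻ w, ∫⁻ b, f (g, w, b) ∂coinsLaw n p ∂workLaw n ∂gapLaw lam := by
  rw [noiseLaw, lintegral_prod _ hf.aemeasurable]
  refine lintegral_congr fun g => ?_
  exact lintegral_prod _ (hf.comp (by fun_prop)).aemeasurable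

lemma ae_gapLaw_pos : ∀ᵐ g ∂gapLaw lam, ∀ m, 0 < g m := by
  refine ae_all_iff.2 fun m => ?_
  have := (measurePreserving_eval_infinitePi (fun _ : ℕ => expMeasure lam) m).quasiMeasurePreserving
  exact this.ae (ae_pos_expMeasure lam)

lemma ae_workLaw_pos : ∀ᵐ w ∂workLaw n, ∀ a, 0 < w a := by
  refine ae_all_iff.2 fun a => ?_
  have := (measurePreserving_eval_infinitePi (fun _ : Fin n × ℕ => expMeasure 1) a).quasiMeasurePreserving
  exact this.ae (ae_pos_expMeasure 1)

/-- Only finitely many queries arrive in a bounded time. -/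
lemma ae_gapLaw_unbounded (hlam : 0 < lam) :
    ∀ᵐ g ∂gapLaw lam, ∀ T : ℕ, ∃ m, (T : ℝ) < g m := by
  refine ae_all_iff.2 fun T => ?_
  rw [ae_iff]
  simp only [not_exists, not_lt]
  have hexp : expMeasure lam (Set.Iic (T : ℝ)) < 1 := by
    have h1 := cdf_eq_real (expMeasure lam) T
    rw [cdf_expMeasure_eq hlam, if_pos (Nat.cast_nonneg T)] at h1
    have h2 : (expMeasure lam).real (Set.Iic (T : ℝ)) < 1 := by
      rw [← h1]; linarith [Real.exp_pos (-(lam * T))]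
    rw [← ENNReal.ofReal_one, ← ofReal_measureReal]
    exact (ENNReal.ofReal_lt_ofReal_iff one_pos).2 h2
  -- The first `N` gaps are all at most `T` with the `N`-th power of a probability below one.
  have hle : ∀ N : ℕ, gapLaw lam {g | ∀ m, g m ≤ T} ≤ expMeasure lam (Set.Iic (T : ℝ)) ^ N := by
    intro N
    have : {g : ℕ → ℝ | ∀ m, g m ≤ T} ⊆
        ((Finset.range N : Finset ℕ) : Set ℕ).pi fun _ => Set.Iic (T : ℝ) :=
      fun g hg m _ => hg m
    refine (measure_mono this).trans ?_
    rw [gapLaw, Measure.infinitePi_pi _ fun _ _ => measurableSet_Iic, Finset.prod_const,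
      Finset.card_range]
  exact le_antisymm (ge_of_tendsto' (ENNReal.tendsto_pow_atTop_nhds_zero_of_lt_one hexp) hle)
    bot_le

end

end ForkJoin

namespace ForkJoin

/-! ### The first event -/

/-- The path seen from time `s`. -/
def shiftPath {S : Type*} (s : ℝ≥0) (x : ℝ≥0 → S) : ℝ≥0 → S := fun t => x (s + t)

variable {n k : ℕ}

/-- The path of the aggregate process. -/
def path (μ₀ μ₁ : ℝ) (c : Config n k) (e : Noise n) : ℝ≥0 → State k :=
  fun t => (inp c e).stateAt μ₀ μ₁ t

/-- Measurable functionals of the path with values in `[0, 1]`. -/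
structure IsFunctional (n : ℕ) {k : ℕ} (μ₀ μ₁ : ℝ) (Ψ : (ℝ≥0 → State k) → ℝ≥0∞) : Prop where
  le_one : ∀ x, Ψ x ≤ 1
  measurable : ∀ c : Config n k,
    Measurable fun q : ℝ≥0 × Noise n => Ψ (shiftPath q.1 (path μ₀ μ₁ c q.2))

section

variable (μ₀ μ₁ lam p : ℝ)

/-- The expectation of a functional of the path after time `s`. -/
def expect (Ψ : (ℝ≥0 → State k) → ℝ≥0∞) (s : ℝ≥0) (c : Config n k) : ℝ≥0∞ :=
  ∫⁻ e, Ψ (shiftPath s (path μ₀ μ₁ c e)) ∂noiseLaw n lam p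

/-- The speed of a service under way. -/
def clockSpeed (c : Config n k) (a : Fin n × ℕ) : ℝ := speed μ₀ μ₁ (c.rate a.1)

/-- The total rate of the events that can happen to a snapshot. -/
def totalRate (c : Config n k) : ℝ := lam + ∑ a ∈ c.active, clockSpeed μ₀ μ₁ c a

/-- The coins used by the services that begin at an event. -/
def newCoins (c : Config n k) (a : Option (Fin n)) (b : Fin n × ℕ → Bool) : Fin n → Bool :=
  fun j => b (j, c.nextIdx a j + c.offset a)

variable [NeZero k]

/-- The mean of a function of the snapshot after an event. -/
def nextMean (c : Config n k) (a : Option (Fin n)) (φ : Config n k → ℝ≥0∞) : ℝ≥0∞ :=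
  ∫⁻ b, φ (c.next a (newCoins c a b)) ∂coinsLaw n p

/-- The sum over all events of the rate times the mean after the event. -/
def jumpMean (c : Config n k) (φ : Config n k → ℝ≥0∞) : ℝ≥0∞ :=
  ENNReal.ofReal lam * nextMean p c none φ +
    ∑ a ∈ c.active, ENNReal.ofReal (clockSpeed μ₀ μ₁ c a) * nextMean p c (some a.1) φ

/-- The mean over the coins of a functional of the path that begins after an event. -/
def restartMean (Ψ : (ℝ≥0 → State k) → ℝ≥0∞) (c : Config n k) (a : Option (Fin n)) (u : ℝ≥0)
    (g : ℕ → ℝ) (w : Fin n × ℕ → ℝ) : ℝ≥0∞ :=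
  ∫⁻ b', ∫⁻ b, Ψ (shiftPath u (path μ₀ μ₁ (c.next a (newCoins c a b'))
    (g, fun x => w (x.1, x.2 + c.offset a), fun x => b (x.1, x.2 + c.offset a))))
      ∂coinsLaw n p ∂coinsLaw n p

end

/-! ### Restarts expressed for paths, and the coins spent at an event -/

section pathwise

variable {μ₀ μ₁ : ℝ}

lemma shiftPath_eq_of_isRestart (hk : 1 ≤ k) (hkn : k ≤ n) {c c' : Config n k} {e e' : Noise n}
    {r : ℝ} {d : ℕ} (h : Input.IsRestart μ₀ μ₁ (inp c e) (inp c' e') r d) {s : ℝ≥0}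
    (hrs : r ≤ s) :
    shiftPath s (path μ₀ μ₁ c e) = shiftPath (Real.toNNReal (s - r)) (path μ₀ μ₁ c' e') := by
  funext t
  have h1 : (0 : ℝ) ≤ s - r := by linarith
  simp only [shiftPath, path]
  have h2 : ((Real.toNNReal (s - r) + t : ℝ≥0) : ℝ) = (s - r) + t := by
    rw [NNReal.coe_add, Real.coe_toNNReal _ h1]
  rw [h2, h.stateAt_eq hk hkn (by positivity)]
  congr 1
  push_cast
  ring

lemma isQuiet_of_running (h₀ : 0 < μ₀) (h₁ : 0 < μ₁) {c : Config n k} {g : ℕ → ℝ}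
    {w : Fin n × ℕ → ℝ} {b : Fin n × ℕ → Bool} {r : ℝ} (hr : 0 ≤ r) (hg : ∀ m, 0 < g m)
    (hw : ∀ a, 0 < w a) (hrg : r ≤ g 0)
    (hrun : ∀ a ∈ c.active, r * clockSpeed μ₀ μ₁ c a ≤ w a) :
    Input.IsQuiet μ₀ μ₁ (⟨c, g, w, b⟩ : Input n k) r where
  nonneg := hr
  le_gap := hrg
  gap_nonneg m := (hg m).le
  work_nonneg a := (hw a).le
  le_work j l h := by
    rw [le_div_iff₀ (speed_pos h₀ h₁ _)]
    exact hrun (j, l) (Config.mem_active.2 h)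

lemma shiftPath_quiet (hk : 1 ≤ k) (hkn : k ≤ n) (h₀ : 0 < μ₀) (h₁ : 0 < μ₁) {c : Config n k}
    {g : ℕ → ℝ} {w : Fin n × ℕ → ℝ} {b : Fin n × ℕ → Bool} {s : ℝ≥0} (hg : ∀ m, 0 < g m)
    (hw : ∀ a, 0 < w a) (hrg : s < g 0)
    (hrun : ∀ a ∈ c.active, s * clockSpeed μ₀ μ₁ c a < w a) :
    shiftPath s (path μ₀ μ₁ c (g, w, b)) = shiftPath 0 (path μ₀ μ₁ c
      (shiftOn {0} (fun _ => 1) s g, shiftOn c.active (clockSpeed μ₀ μ₁ c) s w, b)) := by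
  have hq := isQuiet_of_running h₀ h₁ (b := b) s.2 hg hw hrg.le fun a ha => (hrun a ha).le
  have := shiftPath_eq_of_isRestart hk hkn (e := (g, w, b))
    (e' := (shiftOn {0} (fun _ => 1) s g, shiftOn c.active (clockSpeed μ₀ μ₁ c) s w, b))
    (Input.isRestart_quiet hk hkn h₀ h₁ hq) le_rfl
  rw [this]
  simp

variable [NeZero k]

/-- The coins used at an event. -/
def usedCoins (c : Config n k) (a : Option (Fin n)) : Set (Fin n × ℕ) :=
  {x | ∃ l, x.2 = l + c.offset a ∧ (c.next a c.rate).served x.1 l}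

-- Which query a server is serving does not depend on the rates, so `usedCoins`, formed with the old
-- rates, is the right set for every `ρ`.
open Classical in
lemma piecewise_usedCoins_of_served {c : Config n k} {a : Option (Fin n)}
    {b b' : Fin n × ℕ → Bool} {ρ : Fin n → Bool} {j : Fin n} {l : ℕ}
    (h : (c.next a ρ).served j l) :
    (usedCoins c a).piecewise b' b (j, l + c.offset a) = newCoins c a b' j := by
  have hmem : (j, l + c.offset a) ∈ usedCoins c a := ⟨l, rfl, h⟩
  rw [Set.piecewise_eq_of_mem _ _ _ hmem, newCoins, (Config.served_iff.1 h).2]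
  rfl

open Classical in
lemma piecewise_usedCoins_of_not_served {c : Config n k} {a : Option (Fin n)}
    {b b' : Fin n × ℕ → Bool} {ρ : Fin n → Bool} {j : Fin n} {l : ℕ}
    (h : ¬ (c.next a ρ).served j l) :
    (usedCoins c a).piecewise b' b (j, l + c.offset a) = b (j, l + c.offset a) := by
  refine Set.piecewise_eq_of_notMem _ _ _ ?_
  rintro ⟨l', hl', hs⟩
  have : l = l' := by simp only at hl'; omega
  exact h (this ▸ hs)

end pathwise

attribute [irreducible] path shiftPath

/-! ### Averaging over the noise at an event -/

section mean

variable [NeZero k] {μ₀ μ₁ lam p : ℝ} [IsProbabilityMeasure (expMeasure lam)]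
  [IsProbabilityMeasure (coinLaw p)] {Ψ : (ℝ≥0 → State k) → ℝ≥0∞}

omit [NeZero k] in
lemma IsFunctional.measurable_apply (hΨ : IsFunctional n μ₀ μ₁ Ψ) (c : Config n k) (s : ℝ≥0) :
    Measurable fun e => Ψ (shiftPath s (path μ₀ μ₁ c e)) := by
  have h : Measurable fun e : Noise n => ((s, e) : ℝ≥0 × Noise n) := by fun_prop
  exact (hΨ.measurable c).comp h

lemma IsFunctional.measurable_next (hΨ : IsFunctional n μ₀ μ₁ Ψ) (c : Config n k)
    (a : Option (Fin n)) :
    Measurable fun q : (ℝ≥0 × Noise n) × (Fin n → Bool) =>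
      Ψ (shiftPath q.1.1 (path μ₀ μ₁ (c.next a q.2) q.1.2)) :=
  measurable_from_prod_countable_left fun ρ => hΨ.measurable (c.next a ρ)

omit [NeZero k] in
lemma measurable_newCoins (c : Config n k) (a : Option (Fin n)) :
    Measurable (newCoins c a) := by
  unfold newCoins; fun_prop

omit [NeZero k] in
lemma IsFunctional.measurable_expect (hΨ : IsFunctional n μ₀ μ₁ Ψ) (c : Config n k) :
    Measurable fun s => expect μ₀ μ₁ lam p Ψ s c :=
  (hΨ.measurable c).lintegral_prod_right'

omit [NeZero k] in
lemma expect_le_one (hΨ : IsFunctional n μ₀ μ₁ Ψ) (s : ℝ≥0) (c : Config n k) :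
    expect μ₀ μ₁ lam p Ψ s c ≤ 1 := by
  refine (lintegral_mono fun e => hΨ.le_one _).trans ?_
  simp

lemma IsFunctional.measurable_nextMean (hΨ : IsFunctional n μ₀ μ₁ Ψ) (c : Config n k)
    (a : Option (Fin n)) :
    Measurable fun s => nextMean p c a (expect μ₀ μ₁ lam p Ψ s) := by
  have h1 : Measurable fun q : ℝ≥0 × (Fin n → Bool) =>
      expect μ₀ μ₁ lam p Ψ q.1 (c.next a q.2) :=
    measurable_from_prod_countable_left fun ρ => hΨ.measurable_expect (c.next a ρ)
  have h2 : Measurable fun q : ℝ≥0 × (Fin n × ℕ → Bool) =>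
      expect μ₀ μ₁ lam p Ψ q.1 (c.next a (newCoins c a q.2)) :=
    h1.comp (measurable_fst.prodMk ((measurable_newCoins c a).comp measurable_snd))
  exact h2.lintegral_prod_right'

lemma IsFunctional.measurable_restart (hΨ : IsFunctional n μ₀ μ₁ Ψ) (c : Config n k)
    (a : Option (Fin n)) :
    Measurable fun q : (ℝ≥0 × (ℕ → ℝ) × (Fin n × ℕ → ℝ)) × (Fin n × ℕ → Bool) ×
        (Fin n × ℕ → Bool) =>
      Ψ (shiftPath q.1.1 (path μ₀ μ₁ (c.next a (newCoins c a q.2.1))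
        (q.1.2.1, fun x => q.1.2.2 (x.1, x.2 + c.offset a),
          fun x => q.2.2 (x.1, x.2 + c.offset a)))) := by
  have h1 := measurable_newCoins c a
  have h2 : Measurable fun q : (ℝ≥0 × (ℕ → ℝ) × (Fin n × ℕ → ℝ)) × (Fin n × ℕ → Bool) ×
        (Fin n × ℕ → Bool) =>
      (((q.1.1, (q.1.2.1, fun x => q.1.2.2 (x.1, x.2 + c.offset a),
          fun x => q.2.2 (x.1, x.2 + c.offset a))), newCoins c a q.2.1) :
        (ℝ≥0 × Noise n) × (Fin n → Bool)) := by
    fun_prop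
  exact (hΨ.measurable_next c a).comp h2

lemma IsFunctional.measurable_restartMean (hΨ : IsFunctional n μ₀ μ₁ Ψ) (c : Config n k)
    (a : Option (Fin n)) :
    Measurable fun q : ℝ≥0 × (ℕ → ℝ) × (Fin n × ℕ → ℝ) =>
      restartMean μ₀ μ₁ p Ψ c a q.1 q.2.1 q.2.2 := by
  have h1 : Measurable fun q : ((ℝ≥0 × (ℕ → ℝ) × (Fin n × ℕ → ℝ)) × (Fin n × ℕ → Bool)) ×
        (Fin n × ℕ → Bool) =>
      Ψ (shiftPath q.1.1.1 (path μ₀ μ₁ (c.next a (newCoins c a q.1.2))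
        (q.1.1.2.1, fun x => q.1.1.2.2 (x.1, x.2 + c.offset a),
          fun x => q.2 (x.1, x.2 + c.offset a)))) :=
    (hΨ.measurable_restart c a).comp (by fun_prop :
      Measurable fun q : ((ℝ≥0 × (ℕ → ℝ) × (Fin n × ℕ → ℝ)) × (Fin n × ℕ → Bool)) ×
        (Fin n × ℕ → Bool) => (q.1.1, q.1.2, q.2))
  exact (h1.lintegral_prod_right' (ν := coinsLaw n p)).lintegral_prod_right' (ν := coinsLaw n p)

/-- The surviving noise is relabelled by an injection, which keeps its law, and the coins `b'`
fixing the new rates are independent of it. Tonelli brings `b'` outside: the path begins anew from a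
random snapshot with fresh noise. -/
lemma lintegral_restartMean (hΨ : IsFunctional n μ₀ μ₁ Ψ) (c : Config n k) (a : Option (Fin n))
    (u : ℝ≥0) :
    ∫⁻ g, ∫⁻ w, restartMean μ₀ μ₁ p Ψ c a u g w ∂workLaw n ∂gapLaw lam =
      nextMean p c a (expect μ₀ μ₁ lam p Ψ u) := by
  have hre : Function.Injective fun x : Fin n × ℕ => (x.1, x.2 + c.offset a) := by
    rintro ⟨j, l⟩ ⟨j', l'⟩ h
    simp only [Prod.mk.injEq] at h ⊢
    exact ⟨h.1, by omega⟩
  have hm := hΨ.measurable_restart c a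
  have hswap : ∀ g, ∫⁻ w, restartMean μ₀ μ₁ p Ψ c a u g w ∂workLaw n =
      ∫⁻ b', ∫⁻ w, ∫⁻ b, Ψ (shiftPath u (path μ₀ μ₁ (c.next a (newCoins c a b'))
        (g, fun x => w (x.1, x.2 + c.offset a), fun x => b (x.1, x.2 + c.offset a))))
        ∂coinsLaw n p ∂workLaw n ∂coinsLaw n p := by
    intro g
    refine lintegral_lintegral_swap (Measurable.aemeasurable ?_)
    exact (hm.comp (by fun_prop : Measurable fun q : ((Fin n × ℕ → ℝ) × (Fin n × ℕ → Bool)) ×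
      (Fin n × ℕ → Bool) => ((u, g, q.1.1), q.1.2, q.2))).lintegral_prod_right'
  have hred : ∀ g b', ∫⁻ w, ∫⁻ b, Ψ (shiftPath u (path μ₀ μ₁ (c.next a (newCoins c a b'))
        (g, fun x => w (x.1, x.2 + c.offset a), fun x => b (x.1, x.2 + c.offset a))))
        ∂coinsLaw n p ∂workLaw n =
      ∫⁻ w, ∫⁻ b, Ψ (shiftPath u (path μ₀ μ₁ (c.next a (newCoins c a b')) (g, w, b)))
        ∂coinsLaw n p ∂workLaw n := by
    intro g b'
    have h1 := hΨ.measurable_apply (c.next a (newCoins c a b')) u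
    have h2 : ∀ w, ∫⁻ b, Ψ (shiftPath u (path μ₀ μ₁ (c.next a (newCoins c a b'))
        (g, w, fun x => b (x.1, x.2 + c.offset a)))) ∂coinsLaw n p =
        ∫⁻ b, Ψ (shiftPath u (path μ₀ μ₁ (c.next a (newCoins c a b')) (g, w, b)))
          ∂coinsLaw n p := fun w =>
      lintegral_infinitePi_reindex (coinLaw p) hre (h1.comp (by fun_prop :
        Measurable fun b : Fin n × ℕ → Bool => ((g, w, b) : Noise n)))
    simp only [h2]
    exact lintegral_infinitePi_reindex (expMeasure 1) hre (f := fun w => ∫⁻ b, Ψ (shiftPath u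
        (path μ₀ μ₁ (c.next a (newCoins c a b')) (g, w, b))) ∂coinsLaw n p)
      (h1.comp (by fun_prop : Measurable fun q : (Fin n × ℕ → ℝ) × (Fin n × ℕ → Bool) =>
        ((g, q.1, q.2) : Noise n))).lintegral_prod_right'
  simp only [hswap, hred]
  rw [nextMean, lintegral_lintegral_swap]
  · refine lintegral_congr fun b' => ?_
    rw [expect, lintegral_noiseLaw (hΨ.measurable_apply _ u)]
  · refine Measurable.aemeasurable ?_
    have h1 : Measurable fun q : ((((ℕ → ℝ) × (Fin n × ℕ → Bool)) × (Fin n × ℕ → ℝ)) ×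
        (Fin n × ℕ → Bool)) => Ψ (shiftPath u (path μ₀ μ₁ (c.next a (newCoins c a q.1.1.2))
          (q.1.1.1, q.1.2, q.2))) := by
      have h2 := measurable_newCoins c a
      exact (hΨ.measurable_next c a).comp (by fun_prop :
        Measurable fun q : ((((ℕ → ℝ) × (Fin n × ℕ → Bool)) × (Fin n × ℕ → ℝ)) ×
          (Fin n × ℕ → Bool)) => (((u, (q.1.1.1, q.1.2, q.2)), newCoins c a q.1.1.2) :
            (ℝ≥0 × Noise n) × (Fin n → Bool)))
    exact (h1.lintegral_prod_right' (ν := coinsLaw n p)).lintegral_prod_right' (ν := workLaw n)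

/-- The coins spent at the event are replaced by those of an independent copy `b'`. They enter the
restarted system only as rates of the snapshot, so `b` can serve as its full family of fresh coins.
-/
lemma lintegral_coins_arrival (hkn : k ≤ n) (h₀ : 0 < μ₀) (h₁ : 0 < μ₁)
    (hΨ : IsFunctional n μ₀ μ₁ Ψ) {c : Config n k} {g : ℕ → ℝ} {w : Fin n × ℕ → ℝ} {s : ℝ≥0}
    (hg : ∀ m, 0 < g m) (hw : ∀ a, 0 < w a) (hgs : g 0 ≤ s)
    (hrun : ∀ a ∈ c.active, g 0 * clockSpeed μ₀ μ₁ c a < w a) :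
    ∫⁻ b, Ψ (shiftPath s (path μ₀ μ₁ c (g, w, b))) ∂coinsLaw n p =
      restartMean μ₀ μ₁ p Ψ c none (Real.toNNReal (s - g 0)) (fun m => g (m + 1))
        (shiftOn c.active (clockSpeed μ₀ μ₁ c) (g 0) w) := by
  classical
  have hm : Measurable fun b => Ψ (shiftPath s (path μ₀ μ₁ c (g, w, b))) :=
    (hΨ.measurable_apply c s).comp (by fun_prop :
      Measurable fun b : Fin n × ℕ → Bool => ((g, w, b) : Noise n))
  rw [coinsLaw, lintegral_infinitePi_resample _ (usedCoins c none) hm, restartMean]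
  refine lintegral_congr fun b' => lintegral_congr fun b => ?_
  congr 1
  have hq := isQuiet_of_running h₀ h₁ (b := (usedCoins c none).piecewise b' b) (hg 0).le hg hw
    le_rfl fun a ha => (hrun a ha).le
  exact shiftPath_eq_of_isRestart (NeZero.pos k) hkn
    (e := (g, w, (usedCoins c none).piecewise b' b))
    (e' := (fun m => g (m + 1), shiftOn c.active (clockSpeed μ₀ μ₁ c) (g 0) w, b))
    (Input.isRestart_arrival hkn h₀ h₁ (ρ := newCoins c none b') hq
      (fun j l h => piecewise_usedCoins_of_served h)
      (fun j l h => piecewise_usedCoins_of_not_served h)) hgs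

/-- The clock `a` is set to ring exactly at `r`. Its value is not needed afterwards, so on the right
the unmodified `w` appears, and its coordinate `a` remains unconditioned. -/
lemma lintegral_coins_response (hkn : k ≤ n) (h₀ : 0 < μ₀) (h₁ : 0 < μ₁)
    (hΨ : IsFunctional n μ₀ μ₁ Ψ) {c : Config n k} {g : ℕ → ℝ} {w : Fin n × ℕ → ℝ} {s : ℝ≥0}
    {a : Fin n × ℕ} (ha : a ∈ c.active) {r : ℝ} (hr : 0 < r)
    (hg : ∀ m, 0 < g m) (hw : ∀ a, 0 < w a) (hrs : r ≤ s) (hrg : r < g 0)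
    (hrun : ∀ a' ∈ c.active.erase a, r * clockSpeed μ₀ μ₁ c a' < w a') :
    ∫⁻ b, Ψ (shiftPath s (path μ₀ μ₁ c
        (g, Function.update w a (r * clockSpeed μ₀ μ₁ c a), b))) ∂coinsLaw n p =
      restartMean μ₀ μ₁ p Ψ c (some a.1) (Real.toNNReal (s - r)) (shiftOn {0} (fun _ => 1) r g)
        (shiftOn (c.active.erase a) (clockSpeed μ₀ μ₁ c) r w) := by
  classical
  set w' := Function.update w a (r * clockSpeed μ₀ μ₁ c a)
  have hv : 0 < clockSpeed μ₀ μ₁ c a := speed_pos h₀ h₁ _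
  have hm : Measurable fun b => Ψ (shiftPath s (path μ₀ μ₁ c (g, w', b))) :=
    (hΨ.measurable_apply c s).comp (by fun_prop :
      Measurable fun b : Fin n × ℕ → Bool => ((g, w', b) : Noise n))
  rw [coinsLaw, lintegral_infinitePi_resample _ (usedCoins c (some a.1)) hm, restartMean]
  refine lintegral_congr fun b' => lintegral_congr fun b => ?_
  congr 1
  have hw' : ∀ a, 0 < w' a := by
    intro a'
    by_cases h : a' = a
    · subst h; simp only [w', Function.update_self]; positivity
    · simp only [w', Function.update_of_ne h]; exact hw a'
  have hq := isQuiet_of_running h₀ h₁ (c := c) (b := (usedCoins c (some a.1)).piecewise b' b)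
    hr.le hg hw' hrg.le (by
      intro a' ha'
      by_cases h : a' = a
      · subst h; simp [w']
      · simp only [w', Function.update_of_ne h]
        exact (hrun a' (Finset.mem_erase.2 ⟨h, ha'⟩)).le)
  exact shiftPath_eq_of_isRestart (NeZero.pos k) hkn
    (e := (g, w', (usedCoins c (some a.1)).piecewise b' b))
    (e' := (shiftOn {0} (fun _ => 1) r g,
      fun x => shiftOn (c.active.erase a) (clockSpeed μ₀ μ₁ c) r w
        (x.1, x.2 + c.offset (some a.1)), fun x => b (x.1, x.2 + c.offset (some a.1))))
    (Input.isRestart_response hkn h₀ h₁ (j₀ := a.1) (l₀ := a.2) (ρ := newCoins c (some a.1) b')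
      (Config.mem_active.1 ha) hq
      (by
        change w' a / clockSpeed μ₀ μ₁ c a = r
        simp only [w', Function.update_self]
        field_simp)
      (fun a' h => Function.update_of_ne h _ _)
      (fun j l h => piecewise_usedCoins_of_served h)
      (fun j l h => piecewise_usedCoins_of_not_served h)) hrs

end mean

end ForkJoin

/-! ### Integrals over the possible first events -/

namespace ForkJoin

lemma lintegral_ite_and {α : Type*} [MeasurableSpace α] (ν : Measure α) (P : Prop) [Decidable P]
    {S : Set α} [∀ x, Decidable (P ∧ x ∈ S)] (hS : MeasurableSet S) (f : α → ℝ≥0∞) :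
    ∫⁻ x, (if P ∧ x ∈ S then f x else 0) ∂ν = if P then ∫⁻ x in S, f x ∂ν else 0 := by
  by_cases hP : P
  · simp only [hP, true_and, if_true]
    rw [← lintegral_indicator hS]
    refine lintegral_congr fun x => ?_
    by_cases hx : x ∈ S <;> simp [hP, hx]
  · simp [hP]

/-- A clock of rate `ρ` rings at `x` while competing clocks of total rate `σ` outlast `x`; the two
exponentials combine to the total rate `ρ + σ`. -/
lemma lintegral_expMeasure_jump {ρ : ℝ} (hρ : 0 ≤ ρ) (σ : ℝ) (s : ℝ≥0) {f : ℝ → ℝ≥0∞}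
    (hf : Measurable f) :
    ∫⁻ x, (if 0 < x ∧ x ≤ s then ENNReal.ofReal (Real.exp (-(x * σ))) * f x else 0)
        ∂expMeasure ρ =
      ∫⁻ x in Set.Ioc 0 (s : ℝ),
        ENNReal.ofReal (Real.exp (-((ρ + σ) * x))) * (ENNReal.ofReal ρ * f x) := by
  have hS : MeasurableSet {x : ℝ | 0 < x ∧ x ≤ s} := measurableSet_Ioc
  rw [lintegral_expMeasure ρ (Measurable.ite hS (by fun_prop) measurable_const),
    ← lintegral_indicator measurableSet_Ioi, ← lintegral_indicator measurableSet_Ioc]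
  refine lintegral_congr fun x => ?_
  simp only [Set.indicator_apply, Set.mem_Ioi, Set.mem_Ioc]
  by_cases hx : 0 < x ∧ x ≤ s
  · rw [if_pos hx.1, if_pos hx, if_pos hx, ← mul_assoc, ← mul_assoc,
      ← ENNReal.ofReal_mul (by positivity), ← ENNReal.ofReal_mul (by positivity), mul_assoc,
      ← Real.exp_add, mul_comm (Real.exp _) ρ]
    congr 4
    ring
  · rw [if_neg hx, if_neg hx]
    simp

variable {n k : ℕ} {μ₀ μ₁ lam p : ℝ}

/-- No event up to time `s`. -/
def quietSet (μ₀ μ₁ : ℝ) (c : Config n k) (s : ℝ≥0) : Set (Noise n) :=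
  {e | (s : ℝ) < e.1 0 ∧ ∀ a ∈ c.active, s * clockSpeed μ₀ μ₁ c a < e.2.1 a}

/-- The first event is an arrival, not after time `s`. -/
def arrivalSet (μ₀ μ₁ : ℝ) (c : Config n k) (s : ℝ≥0) : Set (Noise n) :=
  {e | (0 < e.1 0 ∧ e.1 0 ≤ s) ∧ ∀ a ∈ c.active, e.1 0 * clockSpeed μ₀ μ₁ c a < e.2.1 a}

/-- The first event is the end of the service `a`, not after time `s`. -/
def responseSet (μ₀ μ₁ : ℝ) (c : Config n k) (s : ℝ≥0) (a : Fin n × ℕ) : Set (Noise n) :=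
  {e | (0 < e.2.1 a / clockSpeed μ₀ μ₁ c a ∧ e.2.1 a / clockSpeed μ₀ μ₁ c a ≤ s) ∧
    e.2.1 a / clockSpeed μ₀ μ₁ c a < e.1 0 ∧ ∀ a' ∈ c.active.erase a,
      e.2.1 a / clockSpeed μ₀ μ₁ c a * clockSpeed μ₀ μ₁ c a' < e.2.1 a'}

lemma measurableSet_forall_mem {α ι : Type*} [MeasurableSpace α] (A : Finset ι)
    {S : ι → Set α} (hS : ∀ i, MeasurableSet (S i)) : MeasurableSet {x | ∀ i ∈ A, x ∈ S i} := by
  have : {x | ∀ i ∈ A, x ∈ S i} = ⋂ i ∈ A, S i := by ext; simp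
  rw [this]
  exact Finset.measurableSet_biInter _ fun i _ => hS i

lemma measurableSet_quietSet (c : Config n k) (s : ℝ≥0) :
    MeasurableSet (quietSet μ₀ μ₁ c s) := by
  have h1 : MeasurableSet {e : Noise n | (s : ℝ) < e.1 0} :=
    measurableSet_lt (by fun_prop) (by fun_prop)
  refine h1.inter (measurableSet_forall_mem c.active
    (S := fun a => {e : Noise n | s * clockSpeed μ₀ μ₁ c a < e.2.1 a}) fun a => ?_)
  exact measurableSet_lt (by fun_prop) (by fun_prop)

lemma measurableSet_arrivalSet (c : Config n k) (s : ℝ≥0) :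
    MeasurableSet (arrivalSet μ₀ μ₁ c s) := by
  have h1 : MeasurableSet {e : Noise n | 0 < e.1 0} :=
    measurableSet_lt (by fun_prop) (by fun_prop)
  have h2 : MeasurableSet {e : Noise n | e.1 0 ≤ s} :=
    measurableSet_le (by fun_prop) (by fun_prop)
  refine (h1.inter h2).inter (measurableSet_forall_mem c.active
    (S := fun a => {e : Noise n | e.1 0 * clockSpeed μ₀ μ₁ c a < e.2.1 a}) fun a => ?_)
  exact measurableSet_lt (by fun_prop) (by fun_prop)

lemma measurableSet_responseSet (c : Config n k) (s : ℝ≥0) (a : Fin n × ℕ) :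
    MeasurableSet (responseSet μ₀ μ₁ c s a) := by
  have h1 : MeasurableSet {e : Noise n | 0 < e.2.1 a / clockSpeed μ₀ μ₁ c a} :=
    measurableSet_lt (by fun_prop) (by fun_prop)
  have h2 : MeasurableSet {e : Noise n | e.2.1 a / clockSpeed μ₀ μ₁ c a ≤ s} :=
    measurableSet_le (by fun_prop) (by fun_prop)
  have h3 : MeasurableSet {e : Noise n | e.2.1 a / clockSpeed μ₀ μ₁ c a < e.1 0} :=
    measurableSet_lt (by fun_prop) (by fun_prop)
  refine (h1.inter h2).inter (h3.inter (measurableSet_forall_mem (c.active.erase a)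
    (S := fun a' => {e : Noise n | e.2.1 a / clockSpeed μ₀ μ₁ c a * clockSpeed μ₀ μ₁ c a' <
      e.2.1 a'}) fun a' => ?_))
  exact measurableSet_lt (by fun_prop) (by fun_prop)

section

variable [IsProbabilityMeasure (expMeasure lam)] [IsProbabilityMeasure (coinLaw p)]
  {Ψ : (ℝ≥0 → State k) → ℝ≥0∞}

/-- Shifting the gap clock and the active service clocks by `s` restores the law of the noise, at
the price of one exponential factor for each; their product carries the total rate. -/
lemma setLIntegral_quietSet (hk : 1 ≤ k) (hkn : k ≤ n) (h₀ : 0 < μ₀) (h₁ : 0 < μ₁)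
    (hΨ : IsFunctional n μ₀ μ₁ Ψ) (c : Config n k) (s : ℝ≥0) :
    ∫⁻ e in quietSet μ₀ μ₁ c s, Ψ (shiftPath s (path μ₀ μ₁ c e)) ∂noiseLaw n lam p =
      ENNReal.ofReal (Real.exp (-(totalRate μ₀ μ₁ lam c * s))) *
        expect μ₀ μ₁ lam p Ψ 0 c := by
  classical
  set v := clockSpeed μ₀ μ₁ c with hv
  have hv0 : ∀ a, 0 ≤ v a := fun a => (speed_pos h₀ h₁ _).le
  set S : Set (Fin n × ℕ → ℝ) := {w | ∀ a ∈ c.active, s * v a < w a}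
  have hS : MeasurableSet S := measurableSet_running c.active v s
  set B : (ℕ → ℝ) → (Fin n × ℕ → ℝ) → ℝ≥0∞ := fun g w =>
    ∫⁻ b, Ψ (shiftPath 0 (path μ₀ μ₁ c (g, w, b))) ∂coinsLaw n p with hB
  have hBm : Measurable fun q : (ℕ → ℝ) × (Fin n × ℕ → ℝ) => B q.1 q.2 := by
    have h1 : Measurable fun q : ((ℕ → ℝ) × (Fin n × ℕ → ℝ)) × (Fin n × ℕ → Bool) =>
        ((q.1.1, q.1.2, q.2) : Noise n) := by fun_prop
    exact ((hΨ.measurable_apply c 0).comp h1).lintegral_prod_right' (ν := coinsLaw n p)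
  have hstep : ∀ᵐ g ∂gapLaw lam, ∀ᵐ w ∂workLaw n,
      ∫⁻ b, (quietSet μ₀ μ₁ c s).indicator (fun e => Ψ (shiftPath s (path μ₀ μ₁ c e)))
        (g, w, b) ∂coinsLaw n p =
      if (s : ℝ) < g 0 ∧ w ∈ S then
        B (shiftOn {0} (fun _ => 1) s g) (shiftOn c.active v s w) else 0 := by
    filter_upwards [ae_gapLaw_pos] with g hg
    filter_upwards [ae_workLaw_pos] with w hw
    by_cases h : (s : ℝ) < g 0 ∧ w ∈ S
    · rw [if_pos h, hB]
      refine lintegral_congr fun b => ?_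
      rw [Set.indicator_of_mem (show (g, w, b) ∈ quietSet μ₀ μ₁ c s from h),
        shiftPath_quiet hk hkn h₀ h₁ hg hw h.1 h.2]
    · rw [if_neg h]
      refine (lintegral_congr fun b => ?_).trans lintegral_zero
      exact Set.indicator_of_notMem (show (g, w, b) ∉ quietSet μ₀ μ₁ c s from h) _
  have hF := (hΨ.measurable_apply c s).indicator (measurableSet_quietSet (μ₀ := μ₀) (μ₁ := μ₁) c s)
  have hg : ∀ g, ∫⁻ w, (if (s : ℝ) < g 0 ∧ w ∈ S then
        B (shiftOn {0} (fun _ => 1) s g) (shiftOn c.active v s w) else 0) ∂workLaw n =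
      ({g | ∀ i ∈ ({0} : Finset ℕ), (s : ℝ) * (fun _ => (1 : ℝ)) i < g i} : Set (ℕ → ℝ)).indicator
        (fun g => ENNReal.ofReal (Real.exp (-(1 * (s * ∑ a ∈ c.active, v a)))) *
          ∫⁻ w, B (shiftOn {0} (fun _ => 1) s g) w ∂workLaw n) g := by
    intro g
    rw [lintegral_ite_and _ _ hS]
    simp only [Set.indicator_apply, Finset.mem_singleton, forall_eq, Set.mem_ofPred_eq, mul_one]
    congr 1
    exact lintegral_shiftOn_infinitePi 1 c.active v hv0 s.coe_nonneg
      (hBm.comp (by fun_prop : Measurable fun w : Fin n × ℕ → ℝ =>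
        (shiftOn {0} (fun _ => 1) (s : ℝ) g, w)))
  have hBw : Measurable fun g => ∫⁻ w, B g w ∂workLaw n := hBm.lintegral_prod_right'
  have hsg : Measurable (shiftOn ({0} : Finset ℕ) (fun _ => (1 : ℝ)) (s : ℝ)) :=
    (measurable_shiftOn {0} fun _ => (1 : ℝ)).comp (measurable_const.prodMk measurable_id)
  have hsB : Measurable fun g => ∫⁻ w, B (shiftOn {0} (fun _ => 1) s g) w ∂workLaw n :=
    hBw.comp hsg
  rw [← lintegral_indicator (measurableSet_quietSet c s), lintegral_noiseLaw hF,
    lintegral_congr_ae (hstep.mono fun g h => lintegral_congr_ae h)]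
  simp only [hg]
  rw [lintegral_indicator (measurableSet_running _ _ _),
    lintegral_const_mul _ hsB]
  refine (congrArg (fun q => _ * q) (lintegral_shiftOn_infinitePi lam {0} (fun _ => 1)
    (fun _ => zero_le_one) s.coe_nonneg hBw)).trans ?_
  rw [← mul_assoc, ← ENNReal.ofReal_mul (Real.exp_nonneg _), ← Real.exp_add]
  have h2 : expect μ₀ μ₁ lam p Ψ 0 c = ∫⁻ g, ∫⁻ w, B g w ∂workLaw n ∂gapLaw lam :=
    lintegral_noiseLaw (hΨ.measurable_apply c 0)
  rw [h2, totalRate, gapLaw]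
  congr 3
  simp only [Finset.sum_singleton, hv]
  ring

variable [NeZero k]

/-- Given the first gap `x`, the active service clocks have to outlast `x`, and everything after `x`
is fresh. The density of the gap supplies the rate `lam`. -/
lemma setLIntegral_arrivalSet (hkn : k ≤ n) (h₀ : 0 < μ₀) (h₁ : 0 < μ₁) (hlam : 0 < lam)
    (hΨ : IsFunctional n μ₀ μ₁ Ψ) (c : Config n k) (s : ℝ≥0) :
    ∫⁻ e in arrivalSet μ₀ μ₁ c s, Ψ (shiftPath s (path μ₀ μ₁ c e)) ∂noiseLaw n lam p =
      ∫⁻ r in Set.Ioc 0 (s : ℝ), ENNReal.ofReal (Real.exp (-(totalRate μ₀ μ₁ lam c * r))) *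
        (ENNReal.ofReal lam *
          nextMean p c none (expect μ₀ μ₁ lam p Ψ (Real.toNNReal (s - r)))) := by
  classical
  set v := clockSpeed μ₀ μ₁ c with hv
  have hv0 : ∀ a, 0 ≤ v a := fun a => (speed_pos h₀ h₁ _).le
  obtain ⟨R, hR⟩ : ∃ R : ℝ → Set (Fin n × ℕ → ℝ), ∀ r,
      R r = {w | ∀ a ∈ c.active, r * v a < w a} := ⟨_, fun _ => rfl⟩
  have hRm : ∀ r, MeasurableSet (R r) := fun r => hR r ▸ measurableSet_running c.active v r
  have hiff : ∀ g w b, (g, w, b) ∈ arrivalSet μ₀ μ₁ c s ↔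
      (0 < g 0 ∧ g 0 ≤ s) ∧ w ∈ R (g 0) := fun g w b => by rw [hR]; rfl
  set G := fun (x : ℝ) g w => restartMean μ₀ μ₁ p Ψ c none (Real.toNNReal (s - x)) g w
  have hGm : Measurable fun q : ℝ × (ℕ → ℝ) × (Fin n × ℕ → ℝ) => G q.1 q.2.1 q.2.2 :=
    (hΨ.measurable_restartMean c none).comp (by fun_prop :
      Measurable fun q : ℝ × (ℕ → ℝ) × (Fin n × ℕ → ℝ) =>
        (Real.toNNReal (s - q.1), q.2.1, q.2.2))
  have hF := (hΨ.measurable_apply c s).indicator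
    (measurableSet_arrivalSet (μ₀ := μ₀) (μ₁ := μ₁) c s)
  set L : ℝ → (ℕ → ℝ) → ℝ≥0∞ := fun x g => if 0 < x ∧ x ≤ s then
    ENNReal.ofReal (Real.exp (-(1 * (x * ∑ a ∈ c.active, v a)))) * ∫⁻ w, G x g w ∂workLaw n
    else 0 with hL
  have hLm : Measurable fun q : ℝ × (ℕ → ℝ) => L q.1 q.2 := by
    refine Measurable.ite ?_ ?_ measurable_const
    · exact measurableSet_Ioc.preimage measurable_fst
    · have h1 : Measurable fun q : (ℝ × (ℕ → ℝ)) × (Fin n × ℕ → ℝ) => G q.1.1 q.1.2 q.2 :=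
        hGm.comp (by fun_prop : Measurable fun q : (ℝ × (ℕ → ℝ)) × (Fin n × ℕ → ℝ) =>
          (q.1.1, q.1.2, q.2))
      have h2 := h1.lintegral_prod_right' (ν := workLaw n)
      exact Measurable.mul (by fun_prop) h2
  have hstep : ∀ᵐ g ∂gapLaw lam, ∀ᵐ w ∂workLaw n,
      ∫⁻ b, (arrivalSet μ₀ μ₁ c s).indicator (fun e => Ψ (shiftPath s (path μ₀ μ₁ c e)))
        (g, w, b) ∂coinsLaw n p =
      if (0 < g 0 ∧ g 0 ≤ s) ∧ w ∈ R (g 0) then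
        G (g 0) (fun m => g (m + 1)) (shiftOn c.active v (g 0) w) else 0 := by
    filter_upwards [ae_gapLaw_pos] with g hg
    filter_upwards [ae_workLaw_pos] with w hw
    by_cases h : (0 < g 0 ∧ g 0 ≤ s) ∧
        w ∈ R (g 0)
    · rw [if_pos h]
      refine Eq.trans (lintegral_congr fun b => ?_)
        (lintegral_coins_arrival hkn h₀ h₁ hΨ hg hw h.1.2 (by have := h.2; rwa [hR] at this))
      exact Set.indicator_of_mem ((hiff g w b).2 h) _
    · rw [if_neg h]
      refine (lintegral_congr fun b => ?_).trans lintegral_zero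
      exact Set.indicator_of_notMem (mt (hiff g w b).1 h) _
  have hg : ∀ g : ℕ → ℝ, ∫⁻ w, (if (0 < g 0 ∧ g 0 ≤ s) ∧
        w ∈ R (g 0) then
        G (g 0) (fun m => g (m + 1)) (shiftOn c.active v (g 0) w) else 0) ∂workLaw n =
      L (g 0) (fun m => g (m + 1)) := by
    intro g
    rw [lintegral_ite_and _ _ (hRm _), hL]
    by_cases h : 0 < g 0 ∧ g 0 ≤ s
    · simp only [h, and_self, if_true, hR]
      exact lintegral_shiftOn_infinitePi 1 c.active v hv0 h.1.le
        (hGm.comp (by fun_prop : Measurable fun w : Fin n × ℕ → ℝ =>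
          (g 0, (fun m => g (m + 1)), w)))
    · simp only [h, if_false]
  rw [← lintegral_indicator (measurableSet_arrivalSet c s), lintegral_noiseLaw hF,
    lintegral_congr_ae (hstep.mono fun g h => lintegral_congr_ae h)]
  simp only [hg]
  have hLg : Measurable fun g : ℕ → ℝ => L (g 0) (fun m => g (m + 1)) :=
    hLm.comp (by fun_prop : Measurable fun g : ℕ → ℝ => (g 0, fun m => g (m + 1)))
  -- The first gap is separated as the time of the event; the later gaps, relabelled, are again
  -- i.i.d.
  rw [gapLaw, lintegral_infinitePi_update _ 0 hLg]
  have hx : ∀ x, ∫⁻ g, L (Function.update g 0 x 0) (fun m => Function.update g 0 x (m + 1))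
        ∂Measure.infinitePi (fun _ : ℕ => expMeasure lam) =
      if 0 < x ∧ x ≤ s then ENNReal.ofReal (Real.exp (-(x * ∑ a ∈ c.active, v a))) *
        nextMean p c none (expect μ₀ μ₁ lam p Ψ (Real.toNNReal (s - x))) else 0 := by
    intro x
    have h1 : ∀ g : ℕ → ℝ, (fun m => Function.update g 0 x (m + 1)) = fun m => g (m + 1) :=
      fun g => funext fun m => Function.update_of_ne (by omega) _ _
    simp only [Function.update_self, h1]
    rw [lintegral_infinitePi_reindex (expMeasure lam) (σ := fun m => m + 1)
      (add_left_injective 1) (f := L x) (hLm.comp (measurable_const.prodMk measurable_id)), hL]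
    by_cases h : 0 < x ∧ x ≤ s
    · simp only [h, and_self, if_true, one_mul]
      rw [lintegral_const_mul, ← lintegral_restartMean hΨ c none]
      · rfl
      · exact (hGm.comp (by fun_prop : Measurable fun q : (ℕ → ℝ) × (Fin n × ℕ → ℝ) =>
          (x, q.1, q.2))).lintegral_prod_right' (ν := workLaw n)
    · simp only [h, if_false, lintegral_zero]
  simp only [hx]
  exact lintegral_expMeasure_jump hlam.le _ s
    ((hΨ.measurable_nextMean c none).comp (by fun_prop : Measurable fun x : ℝ =>
      Real.toNNReal (s - x)))

/-- Given that the service `a` ends at `r`, the first gap and the other active clocks have to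
outlast `r`. The time of the service itself is exponential with rate its speed, by scaling the unit
requirement. -/
lemma setLIntegral_responseSet (hkn : k ≤ n) (h₀ : 0 < μ₀) (h₁ : 0 < μ₁)
    (hΨ : IsFunctional n μ₀ μ₁ Ψ) (c : Config n k) (s : ℝ≥0) {a : Fin n × ℕ}
    (ha : a ∈ c.active) :
    ∫⁻ e in responseSet μ₀ μ₁ c s a, Ψ (shiftPath s (path μ₀ μ₁ c e)) ∂noiseLaw n lam p =
      ∫⁻ r in Set.Ioc 0 (s : ℝ), ENNReal.ofReal (Real.exp (-(totalRate μ₀ μ₁ lam c * r))) *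
        (ENNReal.ofReal (clockSpeed μ₀ μ₁ c a) *
          nextMean p c (some a.1) (expect μ₀ μ₁ lam p Ψ (Real.toNNReal (s - r)))) := by
  classical
  set v := clockSpeed μ₀ μ₁ c with hv
  have hv0 : ∀ a, 0 < v a := fun a => speed_pos h₀ h₁ _
  set G := fun (x : ℝ) g w => restartMean μ₀ μ₁ p Ψ c (some a.1) (Real.toNNReal (s - x)) g w
  have hGm : Measurable fun q : ℝ × (ℕ → ℝ) × (Fin n × ℕ → ℝ) => G q.1 q.2.1 q.2.2 :=
    (hΨ.measurable_restartMean c (some a.1)).comp (by fun_prop :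
      Measurable fun q : ℝ × (ℕ → ℝ) × (Fin n × ℕ → ℝ) =>
        (Real.toNNReal (s - q.1), q.2.1, q.2.2))
  have hF := (hΨ.measurable_apply c s).indicator
    (measurableSet_responseSet (μ₀ := μ₀) (μ₁ := μ₁) c s a)
  set F := (responseSet μ₀ μ₁ c s a).indicator (fun e => Ψ (shiftPath s (path μ₀ μ₁ c e)))
  -- The clock that rings is a service requirement, so these are integrated outermost in order to
  -- single it out.
  have hswap : ∫⁻ g, ∫⁻ w, ∫⁻ b, F (g, w, b) ∂coinsLaw n p ∂workLaw n ∂gapLaw lam =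
      ∫⁻ w, ∫⁻ g, ∫⁻ b, F (g, w, b) ∂coinsLaw n p ∂gapLaw lam ∂workLaw n := by
    refine lintegral_lintegral_swap (Measurable.aemeasurable ?_)
    exact (hF.comp (by fun_prop : Measurable fun q : ((ℕ → ℝ) × (Fin n × ℕ → ℝ)) ×
      (Fin n × ℕ → Bool) => ((q.1.1, q.1.2, q.2) : Noise n))).lintegral_prod_right'
        (ν := coinsLaw n p)
  have hFw : Measurable fun w => ∫⁻ g, ∫⁻ b, F (g, w, b) ∂coinsLaw n p ∂gapLaw lam :=
    ((hF.comp (by fun_prop : Measurable fun q : ((Fin n × ℕ → ℝ) × (ℕ → ℝ)) ×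
      (Fin n × ℕ → Bool) => ((q.1.2, q.1.1, q.2) : Noise n))).lintegral_prod_right'
        (ν := coinsLaw n p)).lintegral_prod_right' (ν := gapLaw lam)
  rw [← lintegral_indicator (measurableSet_responseSet c s a), lintegral_noiseLaw hF, hswap,
    workLaw, lintegral_infinitePi_update _ a hFw]
  set A : ℝ → ℝ≥0∞ := fun r => if 0 < r ∧ r ≤ s then
    ENNReal.ofReal (Real.exp (-(r * (lam + ∑ a' ∈ c.active.erase a, v a')))) *
      nextMean p c (some a.1) (expect μ₀ μ₁ lam p Ψ (Real.toNNReal (s - r))) else 0 with hA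
  have hnm : Measurable fun r : ℝ =>
      nextMean p c (some a.1) (expect μ₀ μ₁ lam p Ψ (Real.toNNReal (s - r))) :=
    (hΨ.measurable_nextMean c (some a.1)).comp (by fun_prop : Measurable fun x : ℝ =>
      Real.toNNReal (s - x))
  have hAm : Measurable A :=
    Measurable.ite measurableSet_Ioc (by fun_prop) measurable_const
  have key : ∀ r : ℝ, ∫⁻ w, ∫⁻ g, ∫⁻ b, F (g, Function.update w a (r * v a), b)
      ∂coinsLaw n p ∂gapLaw lam ∂workLaw n = A r := by
    intro r
    have hdiv : r * v a / v a = r := by have := (hv0 a).ne'; field_simp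
    set S : Set (Fin n × ℕ → ℝ) := {w | ∀ a' ∈ c.active.erase a, r * v a' < w a'}
    have hS : MeasurableSet S := measurableSet_running _ _ _
    set T : Set (ℕ → ℝ) := {g | ∀ i ∈ ({0} : Finset ℕ), r * (fun _ => (1 : ℝ)) i < g i}
    have hT : MeasurableSet T := measurableSet_running _ _ _
    have hiff : ∀ (g : ℕ → ℝ) (w : Fin n × ℕ → ℝ) (b : Fin n × ℕ → Bool),
        (g, Function.update w a (r * v a), b) ∈ responseSet μ₀ μ₁ c s a ↔
          ((0 < r ∧ r ≤ s) ∧ w ∈ S) ∧ g ∈ T := by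
      intro g w b
      have h1 : (∀ a' ∈ c.active.erase a, r * v a' < Function.update w a (r * v a) a') ↔
          w ∈ S := by
        refine forall₂_congr fun a' ha' => ?_
        rw [Function.update_of_ne (Finset.ne_of_mem_erase ha')]
      have h2 : g ∈ T ↔ r < g 0 := by simp [T]
      rw [h2, ← h1]
      simp only [responseSet, Set.mem_ofPred_eq, Function.update_self, ← hv, hdiv]
      tauto
    have hstep : ∀ᵐ w ∂workLaw n, ∀ᵐ g ∂gapLaw lam,
        ∫⁻ b, F (g, Function.update w a (r * v a), b) ∂coinsLaw n p =
        if ((0 < r ∧ r ≤ s) ∧ w ∈ S) ∧ g ∈ T then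
          G r (shiftOn {0} (fun _ => 1) r g) (shiftOn (c.active.erase a) v r w) else 0 := by
      filter_upwards [ae_workLaw_pos] with w hw
      filter_upwards [ae_gapLaw_pos] with g hg
      by_cases h : ((0 < r ∧ r ≤ s) ∧ w ∈ S) ∧ g ∈ T
      · have hrg : r < g 0 := by simpa [T] using h.2
        rw [if_pos h]
        refine Eq.trans (lintegral_congr fun b => ?_)
          (lintegral_coins_response hkn h₀ h₁ hΨ ha h.1.1.1 hg hw h.1.1.2 hrg h.1.2)
        exact Set.indicator_of_mem ((hiff g w b).2 h) _
      · rw [if_neg h]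
        refine (lintegral_congr fun b => ?_).trans lintegral_zero
        exact Set.indicator_of_notMem (fun h' => h ((hiff g w b).1 h')) _
    rw [lintegral_congr_ae (hstep.mono fun g h => lintegral_congr_ae h)]
    refine (lintegral_congr fun w => lintegral_ite_and _ _ hT _).trans ?_
    rw [lintegral_ite_and _ _ hS, hA]
    by_cases hr : 0 < r ∧ r ≤ s
    · simp only [hr, and_self, if_true]
      have hGr : Measurable fun q : (Fin n × ℕ → ℝ) × (ℕ → ℝ) => G r q.2 q.1 :=
        hGm.comp (by fun_prop : Measurable fun q : (Fin n × ℕ → ℝ) × (ℕ → ℝ) => (r, q.2, q.1))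
      have h1 : ∀ w, ∫⁻ g in T, G r (shiftOn {0} (fun _ => 1) r g)
          (shiftOn (c.active.erase a) v r w) ∂gapLaw lam =
          ENNReal.ofReal (Real.exp (-(lam * (r * ∑ i ∈ ({0} : Finset ℕ), 1)))) *
            ∫⁻ g, G r g (shiftOn (c.active.erase a) v r w) ∂gapLaw lam := fun w =>
        lintegral_shiftOn_infinitePi lam {0} (fun _ => 1) (fun _ => zero_le_one) hr.1.le
          (f := fun g => G r g (shiftOn (c.active.erase a) v r w))
          (hGr.comp (by fun_prop : Measurable fun g : ℕ → ℝ =>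
            (shiftOn (c.active.erase a) v r w, g)))
      have hGw : Measurable fun w => ∫⁻ g, G r g w ∂gapLaw lam := hGr.lintegral_prod_right'
      have hsw : Measurable (shiftOn (c.active.erase a) v r) :=
        (measurable_shiftOn _ v).comp (measurable_const.prodMk measurable_id)
      have hsG : Measurable fun w => ∫⁻ g, G r g (shiftOn (c.active.erase a) v r w) ∂gapLaw lam :=
        hGw.comp hsw
      simp only [h1]
      rw [lintegral_const_mul _ hsG, workLaw,
        lintegral_shiftOn_infinitePi 1 (c.active.erase a) v (fun a => (hv0 a).le) hr.1.le hGw,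
        ← mul_assoc, ← ENNReal.ofReal_mul (Real.exp_nonneg _), ← Real.exp_add]
      congr 1
      · congr 2
        simp only [Finset.sum_singleton]
        ring
      · rw [← lintegral_restartMean hΨ c (some a.1)]
        exact lintegral_lintegral_swap hGr.aemeasurable
    · simp only [hr, if_false]
  have hA' : ∀ y : ℝ, ∫⁻ w, ∫⁻ g, ∫⁻ b, F (g, Function.update w a y, b)
      ∂coinsLaw n p ∂gapLaw lam ∂Measure.infinitePi (fun _ : Fin n × ℕ => expMeasure 1) =
      A (y / v a) := by
    intro y
    rw [← key, div_mul_cancel₀ _ (hv0 a).ne']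
    rfl
  simp only [hA']
  rw [← lintegral_map hAm (by fun_prop), map_div_expMeasure_one (hv0 a), hA,
    lintegral_expMeasure_jump (hv0 a).le _ s hnm]
  have htot : totalRate μ₀ μ₁ lam c = v a + (lam + ∑ a' ∈ c.active.erase a, v a') := by
    rw [totalRate, ← Finset.add_sum_erase _ _ ha]
    ring
  rw [htot]

end

end ForkJoin

namespace ForkJoin

variable {n k : ℕ} {μ₀ μ₁ lam p : ℝ}

/-! ### The renewal equation -/

lemma clockSpeed_pos (h₀ : 0 < μ₀) (h₁ : 0 < μ₁) (c : Config n k) (a : Fin n × ℕ) :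
    0 < clockSpeed μ₀ μ₁ c a := speed_pos h₀ h₁ _

lemma totalRate_pos (h₀ : 0 < μ₀) (h₁ : 0 < μ₁) (hlam : 0 < lam) (c : Config n k) :
    0 < totalRate μ₀ μ₁ lam c :=
  add_pos_of_pos_of_nonneg hlam (Finset.sum_nonneg fun _ _ => (speed_pos h₀ h₁ _).le)

lemma setLIntegral_exp_mul {q : ℝ} (hq : 0 < q) (s : ℝ≥0) :
    ∫⁻ r in Set.Ioc 0 (s : ℝ), ENNReal.ofReal (Real.exp (-(q * r))) * ENNReal.ofReal q =
      ENNReal.ofReal (1 - Real.exp (-(q * s))) := by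
  have := isProbabilityMeasure_expMeasure hq
  have h := lintegral_expMeasure_jump hq.le 0 s (f := fun _ => 1) measurable_const
  simp only [mul_zero, neg_zero, Real.exp_zero, ENNReal.ofReal_one, mul_one, add_zero] at h
  have h2 : ∫⁻ x, (if 0 < x ∧ x ≤ (s : ℝ) then 1 else 0) ∂expMeasure q =
      expMeasure q (Set.Iic (s : ℝ)) := by
    rw [← lintegral_indicator_one measurableSet_Iic]
    refine lintegral_congr_ae ((ae_pos_expMeasure q).mono fun x hx => ?_)
    by_cases h : x ≤ s <;> simp [hx, h]
  rw [← h, h2, ← ofReal_cdf, cdf_expMeasure_eq hq, if_pos s.coe_nonneg]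

lemma disjoint_quietSet_arrivalSet (c : Config n k) (s : ℝ≥0) :
    Disjoint (quietSet μ₀ μ₁ c s) (arrivalSet μ₀ μ₁ c s) :=
  Set.disjoint_left.2 fun _ h h' => absurd h'.1.2 (not_le.2 h.1)

lemma disjoint_quietSet_responseSet (h₀ : 0 < μ₀) (h₁ : 0 < μ₁) {c : Config n k} (s : ℝ≥0)
    {a : Fin n × ℕ} (ha : a ∈ c.active) :
    Disjoint (quietSet μ₀ μ₁ c s) (responseSet μ₀ μ₁ c s a) := by
  refine Set.disjoint_left.2 fun e h h' => ?_
  have h1 := (div_le_iff₀ (speed_pos h₀ h₁ _)).1 h'.1.2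
  exact absurd h1 (not_le.2 (h.2 a ha))

lemma disjoint_arrivalSet_responseSet (h₀ : 0 < μ₀) (h₁ : 0 < μ₁) {c : Config n k} (s : ℝ≥0)
    {a : Fin n × ℕ} (ha : a ∈ c.active) :
    Disjoint (arrivalSet μ₀ μ₁ c s) (responseSet μ₀ μ₁ c s a) := by
  refine Set.disjoint_left.2 fun e h h' => ?_
  have h1 := (div_lt_iff₀ (speed_pos h₀ h₁ _)).1 h'.2.1
  exact absurd h1 (not_lt.2 (h.2 a ha).le)

lemma pairwiseDisjoint_responseSet (h₀ : 0 < μ₀) (h₁ : 0 < μ₁) (c : Config n k) (s : ℝ≥0) :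
    (c.active : Set (Fin n × ℕ)).PairwiseDisjoint (responseSet μ₀ μ₁ c s) := by
  intro a ha a' ha' hne
  refine Set.disjoint_left.2 fun e h h' => ?_
  have h1 := (lt_div_iff₀ (speed_pos h₀ h₁ _)).2 (h.2.2 a' (Finset.mem_erase.2 ⟨hne.symm, ha'⟩))
  have h2 := (lt_div_iff₀ (speed_pos h₀ h₁ _)).2 (h'.2.2 a (Finset.mem_erase.2 ⟨hne, ha⟩))
  exact absurd h1 (not_lt.2 h2.le)

/-- Either there is no event up to time `s`, or one event comes strictly first. -/
def eventSet (μ₀ μ₁ : ℝ) (c : Config n k) (s : ℝ≥0) : Set (Noise n) :=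
  quietSet μ₀ μ₁ c s ∪ (arrivalSet μ₀ μ₁ c s ∪ ⋃ a ∈ c.active, responseSet μ₀ μ₁ c s a)

lemma measurableSet_biUnion_responseSet (c : Config n k) (s : ℝ≥0) :
    MeasurableSet (⋃ a ∈ c.active, responseSet μ₀ μ₁ c s a) :=
  Finset.measurableSet_biUnion _ fun a _ => measurableSet_responseSet c s a

lemma measurableSet_eventSet (c : Config n k) (s : ℝ≥0) :
    MeasurableSet (eventSet μ₀ μ₁ c s) :=
  (measurableSet_quietSet c s).union
    ((measurableSet_arrivalSet c s).union (measurableSet_biUnion_responseSet c s))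

lemma isFunctional_const {a : ℝ≥0∞} (ha : a ≤ 1) :
    IsFunctional n μ₀ μ₁ (fun _ : ℝ≥0 → State k => a) :=
  ⟨fun _ => ha, fun _ => measurable_const⟩

section

variable [NeZero k] [IsProbabilityMeasure (expMeasure lam)] [IsProbabilityMeasure (coinLaw p)]
  {Ψ : (ℝ≥0 → State k) → ℝ≥0∞}

lemma setLIntegral_eventSet (hkn : k ≤ n) (h₀ : 0 < μ₀) (h₁ : 0 < μ₁) (hlam : 0 < lam)
    (hΨ : IsFunctional n μ₀ μ₁ Ψ) (c : Config n k) (s : ℝ≥0) :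
    ∫⁻ e in eventSet μ₀ μ₁ c s, Ψ (shiftPath s (path μ₀ μ₁ c e)) ∂noiseLaw n lam p =
      ENNReal.ofReal (Real.exp (-(totalRate μ₀ μ₁ lam c * s))) * expect μ₀ μ₁ lam p Ψ 0 c +
      ∫⁻ r in Set.Ioc 0 (s : ℝ), ENNReal.ofReal (Real.exp (-(totalRate μ₀ μ₁ lam c * r))) *
        jumpMean μ₀ μ₁ lam p c (expect μ₀ μ₁ lam p Ψ (Real.toNNReal (s - r))) := by
  have hm : ∀ a, Measurable fun r : ℝ =>
      nextMean p c a (expect μ₀ μ₁ lam p Ψ (Real.toNNReal (s - r))) := fun a =>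
    (hΨ.measurable_nextMean c a).comp (by fun_prop : Measurable fun x : ℝ =>
      Real.toNNReal (s - x))
  rw [eventSet, lintegral_union ((measurableSet_arrivalSet c s).union
      (measurableSet_biUnion_responseSet c s)),
    lintegral_union (measurableSet_biUnion_responseSet c s),
    lintegral_biUnion_finset (pairwiseDisjoint_responseSet h₀ h₁ c s)
      (fun a _ => measurableSet_responseSet c s a),
    setLIntegral_quietSet (NeZero.pos k) hkn h₀ h₁ hΨ,
    setLIntegral_arrivalSet hkn h₀ h₁ hlam hΨ,
    Finset.sum_congr rfl fun a ha => setLIntegral_responseSet hkn h₀ h₁ hΨ c s ha,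
    ← lintegral_finsetSum, ← lintegral_add_left]
  · congr 1
    refine lintegral_congr fun r => ?_
    rw [← Finset.mul_sum, ← mul_add]
    rfl
  · exact Measurable.mul (by fun_prop) ((hm none).const_mul _)
  · exact fun a _ => Measurable.mul (by fun_prop) ((hm (some a.1)).const_mul _)
  · exact Set.disjoint_iUnion₂_right.2 fun a ha => disjoint_arrivalSet_responseSet h₀ h₁ s ha
  · exact Set.disjoint_union_right.2 ⟨disjoint_quietSet_arrivalSet c s,
      Set.disjoint_iUnion₂_right.2 fun a ha => disjoint_quietSet_responseSet h₀ h₁ s ha⟩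

omit [IsProbabilityMeasure (expMeasure lam)] in
lemma jumpMean_const (h₀ : 0 < μ₀) (h₁ : 0 < μ₁) (hlam : 0 < lam) (c : Config n k) (a : ℝ≥0∞) :
    jumpMean μ₀ μ₁ lam p c (fun _ => a) = ENNReal.ofReal (totalRate μ₀ μ₁ lam c) * a := by
  have h : ∀ b, nextMean p c b (fun _ => a) = a := fun b => by simp [nextMean]
  simp only [jumpMean, h, totalRate]
  rw [← Finset.sum_mul, ← add_mul, ENNReal.ofReal_add hlam.le
    (Finset.sum_nonneg fun a _ => (clockSpeed_pos h₀ h₁ c a).le), ENNReal.ofReal_sum_of_nonneg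
      fun a _ => (clockSpeed_pos h₀ h₁ c a).le]

omit [NeZero k] in
lemma expect_const (s : ℝ≥0) (c : Config n k) (a : ℝ≥0∞) :
    expect μ₀ μ₁ lam p (fun _ => a) s c = a := by
  simp [expect]

/-- No separate argument for ties is needed: for the constant functional `1`, the decomposition says
that the quiet part and the parts with a strictly first event have masses adding up to `exp (-(q *
s)) + (1 - exp (-(q * s)))`, with `q` the total rate. -/
lemma noiseLaw_eventSet (hkn : k ≤ n) (h₀ : 0 < μ₀) (h₁ : 0 < μ₁) (hlam : 0 < lam)
    (c : Config n k) (s : ℝ≥0) : noiseLaw n lam p (eventSet μ₀ μ₁ c s) = 1 := by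
  have h := setLIntegral_eventSet (p := p) hkn h₀ h₁ hlam
    (isFunctional_const (k := k) (n := n) le_rfl) c s
  have h1 : ∀ s, expect (n := n) (k := k) μ₀ μ₁ lam p (fun _ => 1) s = fun _ => 1 := fun s =>
    funext fun c => expect_const s c 1
  simp only [h1, jumpMean_const h₀ h₁ hlam, mul_one, setLIntegral_one] at h
  rw [h, setLIntegral_exp_mul (totalRate_pos h₀ h₁ hlam c),
    ← ENNReal.ofReal_add (Real.exp_nonneg _)]
  · simp
  · have := totalRate_pos h₀ h₁ hlam c
    simp only [sub_nonneg, Real.exp_le_one_iff, Left.neg_nonpos_iff]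
    positivity

/-- The renewal equation: the first event happens after an exponential time and is an arrival or
the end of a service with probabilities proportional to the rates. -/
theorem expect_renewal (hkn : k ≤ n) (h₀ : 0 < μ₀) (h₁ : 0 < μ₁) (hlam : 0 < lam)
    (hΨ : IsFunctional n μ₀ μ₁ Ψ) (c : Config n k) (s : ℝ≥0) :
    expect μ₀ μ₁ lam p Ψ s c =
      ENNReal.ofReal (Real.exp (-(totalRate μ₀ μ₁ lam c * s))) * expect μ₀ μ₁ lam p Ψ 0 c +
      ∫⁻ r in Set.Ioc 0 (s : ℝ), ENNReal.ofReal (Real.exp (-(totalRate μ₀ μ₁ lam c * r))) *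
        jumpMean μ₀ μ₁ lam p c (expect μ₀ μ₁ lam p Ψ (Real.toNNReal (s - r))) := by
  rw [← setLIntegral_eventSet hkn h₀ h₁ hlam hΨ, expect]
  have h : ∀ᵐ e ∂noiseLaw n lam p, e ∈ eventSet μ₀ μ₁ c s :=
    (prob_compl_eq_zero_iff (measurableSet_eventSet c s)).2
      (noiseLaw_eventSet hkn h₀ h₁ hlam c s)
  rw [Measure.restrict_eq_self_of_ae_mem h]

end

end ForkJoin

namespace ForkJoin

variable {n k : ℕ} {μ₀ μ₁ lam p : ℝ}

/-! ### Lumping -/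

namespace Config

lemma sum_onStage {M : Type*} [AddCommMonoid M] (hkn : k ≤ n) (c : Config n k)
    (G : Fin k → Bool → M) (i : Fin k) [DecidablePred fun j => c.onStage j i] :
    ∑ j, (if c.onStage j i then G i (c.rate j) else 0) =
      if (c.toState i).1 = 0 then 0
      else (c.toState i).2 • G i true + (N n c.toState i - (c.toState i).2) • G i false := by
  classical
  rw [← Finset.sum_filter]
  split_ifs with h
  · refine Finset.sum_eq_zero fun j hj => absurd h ?_
    exact (toState_fst_pos_of_onStage (Finset.mem_filter.1 hj).2).ne'
  · have h1 : (Finset.univ.filter fun j => c.onStage j i).card = N n c.toState i := by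
      rw [← ncard_onStage hkn (Nat.pos_of_ne_zero h), Set.ncard_eq_toFinset_card',
        Set.toFinset_ofPred]
    have h2 : ((Finset.univ.filter fun j => c.onStage j i).filter fun j => c.rate j = true).card =
        (c.toState i).2 := by
      rw [Finset.filter_filter]
      change _ = {j | c.onStage j i ∧ c.rate j = true}.ncard
      rw [Set.ncard_eq_toFinset_card', Set.toFinset_ofPred]
    have h3 := Finset.card_filter_add_card_filter_not
      (s := Finset.univ.filter fun j => c.onStage j i) (fun j => c.rate j = true)
    rw [← Finset.sum_filter_add_sum_filter_not _ fun j => c.rate j = true]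
    congr 1
    · rw [← h2, ← Finset.sum_const]
      exact Finset.sum_congr rfl fun j hj => by rw [(Finset.mem_filter.1 hj).2]
    · rw [← h1, ← h2, ← h3, Nat.add_sub_cancel_left, ← Finset.sum_const]
      refine Finset.sum_congr rfl fun j hj => ?_
      rw [eq_false_of_ne_true (Finset.mem_filter.1 hj).2]

/-- Each service under way belongs to one server at one stage. A summand depending only on stage and
rate is thus counted `h_i` times for fast and `N_i - h_i` times for slow servers at every non-empty
stage. -/
lemma sum_active {M : Type*} [AddCommMonoid M] (hkn : k ≤ n) (c : Config n k)
    (G : Fin k → Bool → M) {f : Fin n × ℕ → M}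
    (hf : ∀ j l (h : c.served j l), f (j, l) = G (c.servedStage h) (c.rate j)) :
    ∑ a ∈ c.active, f a = ∑ i, if (c.toState i).1 = 0 then 0
      else (c.toState i).2 • G i true + (N n c.toState i - (c.toState i).2) • G i false := by
  classical
  simp only [← sum_onStage hkn c G]
  rw [Finset.sum_comm, active, Finset.sum_image (by simp), Finset.sum_filter]
  refine Finset.sum_congr rfl fun j _ => ?_
  split_ifs with h
  · have hs : c.served j (c.servedIdx j) := served_iff.2 ⟨h, rfl⟩
    rw [hf _ _ hs, Finset.sum_eq_single (c.servedStage hs), if_pos]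
    · exact onStage_of_served hs
    · intro i _ hi
      rw [if_neg]
      intro h'
      exact hi (Fin.ext (onStage_unique h' (onStage_of_served hs)))
    · simp
  · refine (Finset.sum_eq_zero fun i _ => if_neg fun h' => ?_).symm
    obtain ⟨l, hl, -⟩ := onStage_iff.1 h'
    obtain ⟨h1, rfl⟩ := served_iff.1 hl
    exact h h1

end Config

/-- Lumpability of the holding times. -/
lemma totalRate_eq_exitRate (hkn : k ≤ n) (c : Config n k) :
    totalRate μ₀ μ₁ lam c = exitRate n lam μ₀ μ₁ c.toState := by
  rw [totalRate, exitRate, c.sum_active hkn (fun _ b => speed μ₀ μ₁ b) fun j l h => rfl]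
  congr 1
  refine Finset.sum_congr rfl fun i _ => ?_
  simp only [nsmul_eq_mul, Nat.cast_sub (c.toState_mem hkn i).1, speed, if_true,
    Bool.false_eq_true, if_false]

/-- The mean of a function of the state after `f` servers have begun to serve at stage `m`. -/
def selectMean (p : ℝ) (f : ℕ) (z : State k) (m : WithBot (Fin k)) (ψ : State k → ℝ≥0∞) : ℝ≥0∞ :=
  ∑ b ∈ Finset.range (f + 1), ENNReal.ofReal (binomialWeight f p b) * ψ (addHigh z m b)

/-- The mean of a function of the state after a response at stage `i`. -/
def responseMean (n : ℕ) (p : ℝ) (z : State k) (i : Fin k) (r : ℕ) (ψ : State k → ℝ≥0∞) : ℝ≥0∞ :=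
  selectMean p (freed n i) (afterResponse z i r) (nextStage (afterResponse z i r) i) ψ

/-- The sum over all transitions out of `z` of the rate times the mean after the transition. -/
def lumpMean (n : ℕ) [NeZero k] (μ₀ μ₁ lam p : ℝ) (z : State k) (ψ : State k → ℝ≥0∞) : ℝ≥0∞ :=
  ENNReal.ofReal lam * selectMean p (if (z 0).1 = 0 then N n z 0 else 0) (afterArrival z)
      ((0 : Fin k) : WithBot (Fin k)) ψ +
    ∑ i, if (z i).1 = 0 then 0
      else (z i).2 • (ENNReal.ofReal μ₁ * responseMean n p z i 1 ψ) +
        (N n z i - (z i).2) • (ENNReal.ofReal μ₀ * responseMean n p z i 0 ψ)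

variable [NeZero k]

omit [NeZero k] in
lemma newCoins_injective (c : Config n k) (a : Option (Fin n)) :
    Function.Injective fun j : Fin n => (j, c.nextIdx a j + c.offset a) :=
  fun _ _ h => (Prod.mk.inj h).1

/-- The new coins affect the aggregate state only through the number of heads among the servers that
begin a service, and this number is binomial. -/
lemma nextMean_none_toState [IsProbabilityMeasure (coinLaw p)] (hkn : k ≤ n) (h₀ : 0 ≤ p)
    (h₁ : p ≤ 1) (c : Config n k) (ψ : State k → ℝ≥0∞) :
    nextMean p c none (fun c' => ψ c'.toState) =
      selectMean p (if (c.toState 0).1 = 0 then N n c.toState 0 else 0) (afterArrival c.toState)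
        ((0 : Fin k) : WithBot (Fin k)) ψ := by
  simp only [nextMean, Config.toState_next_none]
  rw [selectMean, ← Config.ncard_idle hkn c]
  exact lintegral_ncard_coins h₀ h₁ {j | ∀ s ∈ c.queries, j ∈ s} (newCoins_injective c none)
    fun m => ψ (addHigh (afterArrival c.toState) ((0 : Fin k) : WithBot (Fin k)) m)

lemma nextMean_some_toState [IsProbabilityMeasure (coinLaw p)] (hkn : k ≤ n) (h₀ : 0 ≤ p)
    (h₁ : p ≤ 1) (c : Config n k) {j : Fin n} {l : ℕ} (h : c.served j l) (ψ : State k → ℝ≥0∞) :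
    nextMean p c (some j) (fun c' => ψ c'.toState) =
      responseMean n p c.toState (c.servedStage h) (if c.rate j then 1 else 0) ψ := by
  simp only [nextMean, Config.toState_next_some h]
  rw [responseMean, selectMean, ← Config.ncard_freedSet hkn h]
  exact lintegral_ncard_coins h₀ h₁ (c.freedSet h) (newCoins_injective c (some j)) fun m =>
    ψ (addHigh (afterResponse c.toState (c.servedStage h) (if c.rate j then 1 else 0))
      (nextStage (afterResponse c.toState (c.servedStage h) (if c.rate j then 1 else 0))
        (c.servedStage h)) m)

/-- Lumpability of the jumps: the law of the state after a response depends on the snapshot only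
through its aggregate state and the stage and rate of the responder, and services can be grouped by
the latter two. -/
theorem jumpMean_toState [IsProbabilityMeasure (coinLaw p)] (hkn : k ≤ n) (h₀ : 0 ≤ p)
    (h₁ : p ≤ 1) (c : Config n k) (ψ : State k → ℝ≥0∞) :
    jumpMean μ₀ μ₁ lam p c (fun c' => ψ c'.toState) = lumpMean n μ₀ μ₁ lam p c.toState ψ := by
  rw [jumpMean, nextMean_none_toState hkn h₀ h₁, lumpMean]
  congr 1
  refine (c.sum_active hkn (fun i b => ENNReal.ofReal (speed μ₀ μ₁ b) *
    responseMean n p c.toState i (if b then 1 else 0) ψ) fun j l h => ?_).trans ?_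
  · rw [nextMean_some_toState hkn h₀ h₁ c h]
    rfl
  · simp [speed]

/-! ### Comparison with the transition rates -/

omit [NeZero k] in
lemma binomialWeight_nonneg (h₀ : 0 ≤ p) (h₁ : p ≤ 1) (f b : ℕ) : 0 ≤ binomialWeight f p b := by
  have : 0 ≤ 1 - p := by linarith
  unfold binomialWeight; positivity

omit [NeZero k] in
lemma selectProb_nonneg (h₀ : 0 ≤ p) (h₁ : p ≤ 1) (f : ℕ) (z : State k) (m : WithBot (Fin k))
    (z' : State k) : 0 ≤ selectProb p f z m z' := by
  refine Finset.sum_nonneg fun b _ => mul_nonneg (binomialWeight_nonneg h₀ h₁ f b) ?_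
  split_ifs <;> simp

omit [NeZero k] in
lemma selectMean_single (h₀ : 0 ≤ p) (h₁ : p ≤ 1) (f : ℕ) (z : State k) (m : WithBot (Fin k))
    (z' : State k) : selectMean p f z m (Set.indicator {z'} 1) =
      ENNReal.ofReal (selectProb p f z m z') := by
  rw [selectProb, ENNReal.ofReal_sum_of_nonneg]
  · refine Finset.sum_congr rfl fun b _ => ?_
    rw [ENNReal.ofReal_mul (binomialWeight_nonneg h₀ h₁ f b), Set.indicator_apply]
    by_cases h : z' = addHigh z m b
    · simp [h]
    · rw [if_neg (by simpa using Ne.symm h), if_neg h]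
      simp
  · intro b _
    refine mul_nonneg (binomialWeight_nonneg h₀ h₁ f b) ?_
    split_ifs <;> simp

/-- The total rate of the transitions from `z` to `z'`. -/
def jumpRate (n : ℕ) (μ₀ μ₁ lam p : ℝ) (z z' : State k) : ℝ :=
  arrivalRate n lam p z z' + ∑ i, responseRate n μ₀ μ₁ p z i z'

lemma jumpRate_nonneg (h₀ : 0 ≤ p) (h₁ : p ≤ 1) (hμ₀ : 0 < μ₀) (hμ₁ : 0 < μ₁) (hlam : 0 < lam)
    {z : State k} (hz : z ∈ states n k) (z' : State k) : 0 ≤ jumpRate n μ₀ μ₁ lam p z z' := by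
  refine add_nonneg (mul_nonneg hlam.le (selectProb_nonneg h₀ h₁ _ _ _ _))
    (Finset.sum_nonneg fun i _ => ?_)
  rw [responseRate]
  split_ifs
  · exact le_rfl
  · have h2 : (0 : ℝ) ≤ (N n z i : ℝ) - (z i).2 := sub_nonneg.2 (by exact_mod_cast (hz i).1)
    exact add_nonneg (mul_nonneg (by positivity) (selectProb_nonneg h₀ h₁ _ _ _ _))
      (mul_nonneg (by positivity) (selectProb_nonneg h₀ h₁ _ _ _ _))

/-- Testing the jump operator on an indicator recovers the rates in the definition of `Q`.
Membership in `states` makes the truncated difference `N - h` agree with the real one. -/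
lemma lumpMean_single (h₀ : 0 ≤ p) (h₁ : p ≤ 1) (hμ₀ : 0 < μ₀) (hμ₁ : 0 < μ₁) (hlam : 0 < lam)
    {z : State k} (hz : z ∈ states n k) (z' : State k) :
    lumpMean n μ₀ μ₁ lam p z (Set.indicator {z'} 1) =
      ENNReal.ofReal (jumpRate n μ₀ μ₁ lam p z z') := by
  have hr : ∀ i, 0 ≤ responseRate n μ₀ μ₁ p z i z' ∧
      ENNReal.ofReal (responseRate n μ₀ μ₁ p z i z') = if (z i).1 = 0 then 0
      else (z i).2 • (ENNReal.ofReal μ₁ * responseMean n p z i 1 (Set.indicator {z'} 1)) +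
        (N n z i - (z i).2) •
          (ENNReal.ofReal μ₀ * responseMean n p z i 0 (Set.indicator {z'} 1)) := by
    intro i
    rw [responseRate]
    split_ifs
    · simp
    · have h2 : (0 : ℝ) ≤ (N n z i : ℝ) - (z i).2 := sub_nonneg.2 (by exact_mod_cast (hz i).1)
      have h3 : ∀ r, 0 ≤ selectProb p (freed n i) (afterResponse z i r)
        (nextStage (afterResponse z i r) i) z' := fun r => selectProb_nonneg h₀ h₁ _ _ _ _
      have h4 := mul_nonneg (mul_nonneg (Nat.cast_nonneg (z i).2) hμ₁.le) (h3 1)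
      have h5 := mul_nonneg (mul_nonneg h2 hμ₀.le) (h3 0)
      refine ⟨add_nonneg h4 h5, ?_⟩
      simp only [responseMean, selectMean_single h₀ h₁, nsmul_eq_mul]
      rw [ENNReal.ofReal_add h4 h5, mul_assoc, mul_assoc, ENNReal.ofReal_mul (Nat.cast_nonneg _),
        ENNReal.ofReal_mul hμ₁.le, ENNReal.ofReal_mul h2, ENNReal.ofReal_mul hμ₀.le,
        ENNReal.ofReal_natCast, ← Nat.cast_sub (hz i).1, ENNReal.ofReal_natCast]
  rw [jumpRate, arrivalRate, ENNReal.ofReal_add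
    (mul_nonneg hlam.le (selectProb_nonneg h₀ h₁ _ _ _ _))
    (Finset.sum_nonneg fun i _ => (hr i).1), ENNReal.ofReal_sum_of_nonneg fun i _ => (hr i).1,
    lumpMean, selectMean_single h₀ h₁, ENNReal.ofReal_mul hlam.le]
  congr 1
  exact Finset.sum_congr rfl fun i _ => (hr i).2.symm

end ForkJoin

namespace ForkJoin

variable {n k : ℕ} {μ₀ μ₁ lam p : ℝ}

/-! ### Uniqueness of the solution of the renewal equation -/

/-- A bound for the total rate of the events. -/
def maxRate (n : ℕ) (μ₀ μ₁ lam : ℝ) : ℝ := lam + n * max μ₀ μ₁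

lemma totalRate_le_maxRate (h₀ : 0 < μ₀) (c : Config n k) :
    totalRate μ₀ μ₁ lam c ≤ maxRate n μ₀ μ₁ lam := by
  have h1 : c.active.card ≤ n := by
    refine (Finset.card_image_le.trans (Finset.card_filter_le _ _)).trans ?_
    simp
  have h2 : ∑ a ∈ c.active, clockSpeed μ₀ μ₁ c a ≤ c.active.card • max μ₀ μ₁ := by
    refine Finset.sum_le_card_nsmul _ _ _ fun a _ => ?_
    rw [clockSpeed, speed]
    split_ifs
    · exact le_max_right _ _
    · exact le_max_left _ _
  rw [nsmul_eq_mul] at h2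
  have h3 : (c.active.card : ℝ) * max μ₀ μ₁ ≤ n * max μ₀ μ₁ :=
    mul_le_mul_of_nonneg_right (by exact_mod_cast h1) (h₀.le.trans (le_max_left _ _))
  rw [totalRate, maxRate]
  linarith

lemma maxRate_pos (h₀ : 0 < μ₀) (hlam : 0 < lam) : 0 < maxRate n μ₀ μ₁ lam :=
  add_pos_of_pos_of_nonneg hlam
    (mul_nonneg (Nat.cast_nonneg n) (h₀.le.trans (le_max_left _ _)))

variable [NeZero k]

lemma nextMean_mono {c : Config n k} {a : Option (Fin n)} {φ φ' : Config n k → ℝ≥0∞}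
    (h : ∀ c, φ c ≤ φ' c) : nextMean p c a φ ≤ nextMean p c a φ' :=
  lintegral_mono fun _ => h _

lemma jumpMean_mono {c : Config n k} {φ φ' : Config n k → ℝ≥0∞} (h : ∀ c, φ c ≤ φ' c) :
    jumpMean μ₀ μ₁ lam p c φ ≤ jumpMean μ₀ μ₁ lam p c φ' :=
  add_le_add (mul_le_mul_right (nextMean_mono h) _)
    (Finset.sum_le_sum fun _ _ => mul_le_mul_right (nextMean_mono h) _)

lemma jumpMean_add_const [IsProbabilityMeasure (coinLaw p)] (h₀ : 0 < μ₀) (h₁ : 0 < μ₁)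
    (hlam : 0 < lam) (c : Config n k) (φ : Config n k → ℝ≥0∞) (a : ℝ≥0∞) :
    jumpMean μ₀ μ₁ lam p c (fun c' => φ c' + a) =
      jumpMean μ₀ μ₁ lam p c φ + ENNReal.ofReal (totalRate μ₀ μ₁ lam c) * a := by
  have h : ∀ b, nextMean p c b (fun c' => φ c' + a) =
      nextMean p c b φ + nextMean p c b fun _ => a := fun b =>
    lintegral_add_right _ measurable_const
  rw [← jumpMean_const h₀ h₁ hlam (p := p)]
  simp only [jumpMean, h, mul_add, Finset.sum_add_distrib]
  ring

lemma jumpMean_const_mul [IsProbabilityMeasure (coinLaw p)] (c : Config n k)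
    (φ : Config n k → ℝ≥0∞) {a : ℝ≥0∞} (ha : a ≠ ∞) :
    jumpMean μ₀ μ₁ lam p c (fun c' => a * φ c') = a * jumpMean μ₀ μ₁ lam p c φ := by
  have h : ∀ b, nextMean p c b (fun c' => a * φ c') = a * nextMean p c b φ := fun b =>
    lintegral_const_mul' _ _ ha
  simp only [jumpMean, h, mul_add, Finset.mul_sum, mul_left_comm]

section

variable [IsProbabilityMeasure (expMeasure lam)] [IsProbabilityMeasure (coinLaw p)]
  {Ψ Ψ' : (ℝ≥0 → State k) → ℝ≥0∞}

/-- Both means satisfy renewal equations with the same exit rate and the same quiet term. What comes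
after the first event differs by at most `θ`, weighted by the probability of an event up to `s`,
which is at most `1 - exp (-(maxRate * T))`. -/
lemma expect_le_add_step (hkn : k ≤ n) (hp₀ : 0 ≤ p) (hp₁ : p ≤ 1) (h₀ : 0 < μ₀) (h₁ : 0 < μ₁)
    (hlam : 0 < lam) (hΨ : IsFunctional n μ₀ μ₁ Ψ) (hΨ' : IsFunctional n μ₀ μ₁ Ψ') {T : ℝ≥0}
    {θ : ℝ} (hθ : 0 ≤ θ)
    (hzero : ∀ c c' : Config n k, c.toState = c'.toState →
      expect μ₀ μ₁ lam p Ψ 0 c = expect μ₀ μ₁ lam p Ψ' 0 c')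
    (ih : ∀ s ≤ T, ∀ c c' : Config n k, c.toState = c'.toState →
      expect μ₀ μ₁ lam p Ψ s c ≤ expect μ₀ μ₁ lam p Ψ' s c' + ENNReal.ofReal θ)
    {s : ℝ≥0} (hs : s ≤ T) {c c' : Config n k} (hc : c.toState = c'.toState) :
    expect μ₀ μ₁ lam p Ψ s c ≤ expect μ₀ μ₁ lam p Ψ' s c' +
      ENNReal.ofReal ((1 - Real.exp (-(maxRate n μ₀ μ₁ lam * T))) * θ) := by
  have hq : totalRate μ₀ μ₁ lam c = totalRate μ₀ μ₁ lam c' := by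
    rw [totalRate_eq_exitRate hkn, totalRate_eq_exitRate hkn, hc]
  have hq0 := totalRate_pos h₀ h₁ hlam c
  have hJ : ∀ u ≤ T, jumpMean μ₀ μ₁ lam p c (expect μ₀ μ₁ lam p Ψ u) ≤
      jumpMean μ₀ μ₁ lam p c' (expect μ₀ μ₁ lam p Ψ' u) +
        ENNReal.ofReal (totalRate μ₀ μ₁ lam c) * ENNReal.ofReal θ := by
    intro u hu
    -- The supremum over all snapshots with a given aggregate state is a function of that state
    -- dominating the mean; lumpability then carries its jump mean from `c` to `c'`.
    set ψ : State k → ℝ≥0∞ := fun z =>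
      ⨆ (d : Config n k) (_ : d.toState = z), expect μ₀ μ₁ lam p Ψ u d
    have h1 : ∀ d, expect μ₀ μ₁ lam p Ψ u d ≤ ψ d.toState := fun d =>
      le_iSup₂ (f := fun (d' : Config n k) (_ : d'.toState = d.toState) =>
        expect μ₀ μ₁ lam p Ψ u d') d rfl
    have h2 : ∀ d, ψ d.toState ≤ expect μ₀ μ₁ lam p Ψ' u d + ENNReal.ofReal θ := fun d =>
      iSup₂_le fun d' hd' => ih u hu d' d hd'
    refine (jumpMean_mono h1).trans ?_
    rw [jumpMean_toState hkn hp₀ hp₁, hc, ← jumpMean_toState hkn hp₀ hp₁, hq,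
      ← jumpMean_add_const h₀ h₁ hlam]
    exact jumpMean_mono h2
  rw [expect_renewal hkn h₀ h₁ hlam hΨ c s, expect_renewal hkn h₀ h₁ hlam hΨ' c' s, hzero c c' hc,
    ← hq, add_assoc]
  refine add_le_add le_rfl ?_
  have hmeas : Measurable fun r : ℝ => ENNReal.ofReal (Real.exp (-(totalRate μ₀ μ₁ lam c * r))) *
      ENNReal.ofReal (totalRate μ₀ μ₁ lam c) := by fun_prop
  calc _ ≤ ∫⁻ r in Set.Ioc 0 (s : ℝ), (ENNReal.ofReal (Real.exp (-(totalRate μ₀ μ₁ lam c * r))) *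
        jumpMean μ₀ μ₁ lam p c' (expect μ₀ μ₁ lam p Ψ' (Real.toNNReal (s - r))) +
        ENNReal.ofReal (Real.exp (-(totalRate μ₀ μ₁ lam c * r))) *
          ENNReal.ofReal (totalRate μ₀ μ₁ lam c) * ENNReal.ofReal θ) := by
        refine setLIntegral_mono' measurableSet_Ioc fun r hr => ?_
        rw [mul_assoc, ← mul_add]
        refine mul_le_mul_right (hJ _ ?_) _
        refine le_trans ?_ hs
        rw [Real.toNNReal_le_iff_le_coe]
        linarith [hr.1]
    _ ≤ _ := by
        rw [lintegral_add_right _ (hmeas.mul_const _), lintegral_mul_const _ hmeas,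
          setLIntegral_exp_mul hq0]
        refine add_le_add le_rfl ?_
        rw [← ENNReal.ofReal_mul' hθ]
        refine ENNReal.ofReal_le_ofReal (mul_le_mul_of_nonneg_right ?_ hθ)
        have h1 := totalRate_le_maxRate (μ₁ := μ₁) (lam := lam) h₀ c
        have h2 : (s : ℝ) ≤ T := by exact_mod_cast hs
        have h3 : totalRate μ₀ μ₁ lam c * s ≤ maxRate n μ₀ μ₁ lam * T :=
          mul_le_mul h1 h2 s.coe_nonneg (hq0.le.trans h1)
        have := Real.exp_le_exp.2 (neg_le_neg h3)
        linarith

/-- The trivial error bound `1`, improved repeatedly by the previous estimate, becomes `θ ^ m`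
uniformly on `[0, T]`, with `θ < 1`. -/
lemma expect_le_of_zero (hkn : k ≤ n) (hp₀ : 0 ≤ p) (hp₁ : p ≤ 1) (h₀ : 0 < μ₀) (h₁ : 0 < μ₁)
    (hlam : 0 < lam) (hΨ : IsFunctional n μ₀ μ₁ Ψ) (hΨ' : IsFunctional n μ₀ μ₁ Ψ')
    (hzero : ∀ c c' : Config n k, c.toState = c'.toState →
      expect μ₀ μ₁ lam p Ψ 0 c = expect μ₀ μ₁ lam p Ψ' 0 c')
    (T : ℝ≥0) {c c' : Config n k} (hc : c.toState = c'.toState) :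
    expect μ₀ μ₁ lam p Ψ T c ≤ expect μ₀ μ₁ lam p Ψ' T c' := by
  set θ := 1 - Real.exp (-(maxRate n μ₀ μ₁ lam * T))
  have hθ0 : 0 ≤ θ := by
    have := maxRate_pos (n := n) (μ₁ := μ₁) h₀ hlam
    simp only [θ, sub_nonneg, Real.exp_le_one_iff, Left.neg_nonpos_iff]
    positivity
  have hθ1 : θ < 1 := sub_lt_self _ (Real.exp_pos _)
  have key : ∀ m : ℕ, ∀ s ≤ T, ∀ c c' : Config n k, c.toState = c'.toState →
      expect μ₀ μ₁ lam p Ψ s c ≤ expect μ₀ μ₁ lam p Ψ' s c' + ENNReal.ofReal (θ ^ m) := by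
    intro m
    induction m with
    | zero =>
      intro s _ c c' _
      rw [pow_zero, ENNReal.ofReal_one]
      exact (expect_le_one hΨ s c).trans le_add_self
    | succ m ih =>
      intro s hs c c' hc
      rw [pow_succ']
      exact expect_le_add_step hkn hp₀ hp₁ h₀ h₁ hlam hΨ hΨ' (by positivity) hzero ih hs hc
  have hlim : Tendsto (fun m : ℕ => expect μ₀ μ₁ lam p Ψ' T c' + ENNReal.ofReal (θ ^ m)) atTop
      (𝓝 (expect μ₀ μ₁ lam p Ψ' T c' + ENNReal.ofReal 0)) :=
    tendsto_const_nhds.add (ENNReal.tendsto_ofReal (tendsto_pow_atTop_nhds_zero_of_lt_one hθ0 hθ1))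
  rw [ENNReal.ofReal_zero, add_zero] at hlim
  exact ge_of_tendsto' hlim fun m => key m T le_rfl c c' hc

/-- Two functionals with the same expectations from time `0`, which depend on the snapshot only
through its aggregate state, have the same expectations from every time. -/
theorem expect_eq_of_zero (hkn : k ≤ n) (hp₀ : 0 ≤ p) (hp₁ : p ≤ 1) (h₀ : 0 < μ₀) (h₁ : 0 < μ₁)
    (hlam : 0 < lam) (hΨ : IsFunctional n μ₀ μ₁ Ψ) (hΨ' : IsFunctional n μ₀ μ₁ Ψ')
    (hzero : ∀ c c' : Config n k, c.toState = c'.toState →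
      expect μ₀ μ₁ lam p Ψ 0 c = expect μ₀ μ₁ lam p Ψ' 0 c')
    (s : ℝ≥0) {c c' : Config n k} (hc : c.toState = c'.toState) :
    expect μ₀ μ₁ lam p Ψ s c = expect μ₀ μ₁ lam p Ψ' s c' :=
  le_antisymm (expect_le_of_zero hkn hp₀ hp₁ h₀ h₁ hlam hΨ hΨ' hzero s hc)
    (expect_le_of_zero hkn hp₀ hp₁ h₀ h₁ hlam hΨ' hΨ
      (fun _ _ h => (hzero _ _ h.symm).symm) s hc.symm)

/-! ### Short times -/

lemma expect_le_zero_add (hkn : k ≤ n) (h₀ : 0 < μ₀) (h₁ : 0 < μ₁) (hlam : 0 < lam)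
    (hΨ : IsFunctional n μ₀ μ₁ Ψ) (c : Config n k) (s : ℝ≥0) :
    expect μ₀ μ₁ lam p Ψ s c ≤ expect μ₀ μ₁ lam p Ψ 0 c +
      ENNReal.ofReal (maxRate n μ₀ μ₁ lam * s) := by
  have hq0 := totalRate_pos h₀ h₁ hlam c
  rw [expect_renewal hkn h₀ h₁ hlam hΨ c s]
  refine add_le_add (mul_le_of_le_one_left' ?_) ?_
  · rw [ENNReal.ofReal_le_one, Real.exp_le_one_iff, Left.neg_nonpos_iff]
    positivity
  · calc _ ≤ ∫⁻ r in Set.Ioc 0 (s : ℝ), ENNReal.ofReal (maxRate n μ₀ μ₁ lam) := by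
          refine setLIntegral_mono' measurableSet_Ioc fun r hr => ?_
          have h1 : jumpMean μ₀ μ₁ lam p c (expect μ₀ μ₁ lam p Ψ (Real.toNNReal (s - r))) ≤
              ENNReal.ofReal (maxRate n μ₀ μ₁ lam) := by
            refine (jumpMean_mono fun c' => expect_le_one hΨ _ c').trans ?_
            rw [jumpMean_const h₀ h₁ hlam, mul_one]
            exact ENNReal.ofReal_le_ofReal (totalRate_le_maxRate h₀ c)
          refine (mul_le_of_le_one_left' ?_).trans h1
          rw [ENNReal.ofReal_le_one, Real.exp_le_one_iff, Left.neg_nonpos_iff]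
          exact mul_nonneg hq0.le hr.1.le
      _ = _ := by
          rw [lintegral_const, Measure.restrict_apply_univ, Real.volume_Ioc, sub_zero,
            ← ENNReal.ofReal_mul (maxRate_pos h₀ hlam).le]

lemma mul_expect_zero_le (hkn : k ≤ n) (h₀ : 0 < μ₀) (h₁ : 0 < μ₁) (hlam : 0 < lam)
    (hΨ : IsFunctional n μ₀ μ₁ Ψ) (c : Config n k) (s : ℝ≥0) :
    ENNReal.ofReal (Real.exp (-(maxRate n μ₀ μ₁ lam * s))) * expect μ₀ μ₁ lam p Ψ 0 c ≤
      expect μ₀ μ₁ lam p Ψ s c := by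
  rw [expect_renewal hkn h₀ h₁ hlam hΨ c s]
  refine le_add_right (mul_le_mul_left (ENNReal.ofReal_le_ofReal (Real.exp_le_exp.2
    (neg_le_neg (mul_le_mul_of_nonneg_right (totalRate_le_maxRate h₀ c) s.coe_nonneg)))) _)

/-- In the renewal integral the mean at the remaining time is replaced by the one at time `0`, with
error at most `maxRate * t`. Since the jump rate is bounded too, the total error is quadratic in
`t`. -/
lemma expect_le_short (hkn : k ≤ n) (h₀ : 0 < μ₀) (h₁ : 0 < μ₁) (hlam : 0 < lam)
    (hΨ : IsFunctional n μ₀ μ₁ Ψ) (c : Config n k) (t : ℝ≥0) :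
    expect μ₀ μ₁ lam p Ψ t c ≤
      ENNReal.ofReal (Real.exp (-(totalRate μ₀ μ₁ lam c * t))) * expect μ₀ μ₁ lam p Ψ 0 c +
      (jumpMean μ₀ μ₁ lam p c (expect μ₀ μ₁ lam p Ψ 0) +
        ENNReal.ofReal (maxRate n μ₀ μ₁ lam) * ENNReal.ofReal (maxRate n μ₀ μ₁ lam * t)) *
          ENNReal.ofReal t := by
  have hΛ := maxRate_pos (n := n) (μ₁ := μ₁) h₀ hlam
  rw [expect_renewal hkn h₀ h₁ hlam hΨ c t]
  refine add_le_add le_rfl ?_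
  rw [show ENNReal.ofReal (t : ℝ) = volume.restrict (Set.Ioc 0 (t : ℝ)) Set.univ by
    rw [Measure.restrict_apply_univ, Real.volume_Ioc, sub_zero], ← lintegral_const]
  refine setLIntegral_mono' measurableSet_Ioc fun r hr => ?_
  refine (mul_le_of_le_one_left' ?_).trans ((jumpMean_mono fun c' =>
    (expect_le_zero_add hkn h₀ h₁ hlam hΨ c' _).trans (add_le_add le_rfl
      (ENNReal.ofReal_le_ofReal (mul_le_mul_of_nonneg_left ?_ hΛ.le) :
        _ ≤ ENNReal.ofReal (maxRate n μ₀ μ₁ lam * t)))).trans ?_)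
  · rw [ENNReal.ofReal_le_one, Real.exp_le_one_iff, Left.neg_nonpos_iff]
    exact mul_nonneg (totalRate_pos h₀ h₁ hlam c).le hr.1.le
  · rw [Real.coe_toNNReal _ (by linarith [hr.2])]
    linarith [hr.1]
  · rw [jumpMean_add_const h₀ h₁ hlam]
    gcongr
    exact totalRate_le_maxRate h₀ c

/-- Of the two factors `exp (-(maxRate * t))`, one bounds below the probability of no event before
the first jump, the other that of no event between this jump and `t`. -/
lemma le_expect_short (hkn : k ≤ n) (h₀ : 0 < μ₀) (h₁ : 0 < μ₁) (hlam : 0 < lam)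
    (hΨ : IsFunctional n μ₀ μ₁ Ψ) (c : Config n k) (t : ℝ≥0) :
    ENNReal.ofReal (Real.exp (-(totalRate μ₀ μ₁ lam c * t))) * expect μ₀ μ₁ lam p Ψ 0 c +
      ENNReal.ofReal (Real.exp (-(maxRate n μ₀ μ₁ lam * t))) *
        (ENNReal.ofReal (Real.exp (-(maxRate n μ₀ μ₁ lam * t))) *
          jumpMean μ₀ μ₁ lam p c (expect μ₀ μ₁ lam p Ψ 0)) * ENNReal.ofReal t ≤
    expect μ₀ μ₁ lam p Ψ t c := by
  have hΛ := maxRate_pos (n := n) (μ₁ := μ₁) h₀ hlam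
  rw [expect_renewal hkn h₀ h₁ hlam hΨ c t]
  refine add_le_add le_rfl ?_
  rw [show ENNReal.ofReal (t : ℝ) = volume.restrict (Set.Ioc 0 (t : ℝ)) Set.univ by
    rw [Measure.restrict_apply_univ, Real.volume_Ioc, sub_zero], ← lintegral_const]
  refine setLIntegral_mono' measurableSet_Ioc fun r hr => ?_
  refine mul_le_mul' (ENNReal.ofReal_le_ofReal (Real.exp_le_exp.2 (neg_le_neg ?_))) ?_
  · exact mul_le_mul (totalRate_le_maxRate h₀ c) hr.2 hr.1.le hΛ.le
  · rw [← jumpMean_const_mul _ _ ENNReal.ofReal_ne_top]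
    refine jumpMean_mono fun c' => le_trans (mul_le_mul_left (ENNReal.ofReal_le_ofReal
      (Real.exp_le_exp.2 (neg_le_neg (mul_le_mul_of_nonneg_left ?_ hΛ.le)))) _)
      (mul_expect_zero_le hkn h₀ h₁ hlam hΨ c' _)
    rw [Real.coe_toNNReal _ (by linarith [hr.2])]
    linarith [hr.1]

end

end ForkJoin

namespace ForkJoin

variable {n k : ℕ} {μ₀ μ₁ lam p : ℝ}

/-! ### Functionals with lumped expectations -/

lemma shiftPath_apply {S : Type*} (s t : ℝ≥0) (x : ℝ≥0 → S) : shiftPath s x t = x (s + t) := by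
  rw [shiftPath]

lemma shiftPath_shiftPath {S : Type*} (s r : ℝ≥0) (x : ℝ≥0 → S) :
    shiftPath s (shiftPath r x) = shiftPath (r + s) x := by
  funext t
  simp only [shiftPath_apply, add_assoc]

lemma shiftPath_zero {S : Type*} (x : ℝ≥0 → S) : shiftPath 0 x = x := by
  funext t
  rw [shiftPath_apply, zero_add]

/-- The assumptions on the parameters. -/
structure Admissible (n k : ℕ) (lam μ₀ μ₁ p : ℝ) : Prop where
  le : k ≤ n
  lam_pos : 0 < lam
  low_pos : 0 < μ₀
  high_pos : 0 < μ₁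
  prob_nonneg : 0 ≤ p
  prob_le_one : p ≤ 1

lemma exists_running (h : Admissible n k lam μ₀ μ₁ p) (c : Config n k) {g : ℕ → ℝ}
    {w : Fin n × ℕ → ℝ} (hg : 0 < g 0) (hw : ∀ a, 0 < w a) :
    ∃ r > 0, r ≤ g 0 ∧ ∀ a ∈ c.active, r * clockSpeed μ₀ μ₁ c a ≤ w a := by
  have h1 : ∀ᶠ r : ℝ in 𝓝[>] 0, r ≤ g 0 :=
    ((eventually_lt_nhds hg).filter_mono nhdsWithin_le_nhds).mono fun _ => le_of_lt
  have h2 : ∀ᶠ r : ℝ in 𝓝[>] 0, ∀ a ∈ c.active, r * clockSpeed μ₀ μ₁ c a ≤ w a := by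
    refine (Finset.eventually_all c.active).2 fun a _ => ?_
    have h3 := clockSpeed_pos h.low_pos h.high_pos c a
    refine ((eventually_lt_nhds (div_pos (hw a) h3)).filter_mono nhdsWithin_le_nhds).mono
      fun r hr => ?_
    exact ((lt_div_iff₀ h3).1 hr).le
  obtain ⟨r, hr, hr1, hr2⟩ := ((eventually_mem_nhdsWithin (a := (0 : ℝ))).and (h1.and h2)).exists
  exact ⟨r, hr, hr1, hr2⟩

lemma measurable_path (hk : 1 ≤ k) (hkn : k ≤ n) (c : Config n k) :
    Measurable fun q : ℝ≥0 × Noise n => path μ₀ μ₁ c q.2 q.1 := by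
  have h1 : Measurable fun q : ℝ≥0 × Noise n => (((q.1 : ℝ), q.2) : ℝ × Noise n) := by fun_prop
  have h2 : (fun q : ℝ≥0 × Noise n => path μ₀ μ₁ c q.2 q.1) =
      (fun q : ℝ × Noise n => (inp c q.2).stateAt μ₀ μ₁ q.1) ∘ fun q => ((q.1 : ℝ), q.2) := by
    funext q
    rw [path]
    rfl
  rw [h2]
  exact (measurable_stateAt c hk hkn).comp h1

variable [NeZero k]

namespace IsFunctional

variable {Ψ : (ℝ≥0 → State k) → ℝ≥0∞}

omit [NeZero k] in
lemma shift (h : IsFunctional n μ₀ μ₁ Ψ) (d : ℝ≥0) :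
    IsFunctional n μ₀ μ₁ fun x => Ψ (shiftPath d x) where
  le_one _ := h.le_one _
  measurable c := by
    simp only [shiftPath_shiftPath]
    exact (h.measurable c).comp (by fun_prop :
      Measurable fun q : ℝ≥0 × Noise n => (q.1 + d, q.2))

lemma mul (hkn : k ≤ n) (h : IsFunctional n μ₀ μ₁ Ψ) {g : State k → ℝ≥0∞} (hg : ∀ z, g z ≤ 1) :
    IsFunctional n μ₀ μ₁ fun x => g (x 0) * Ψ x where
  le_one x := mul_le_one' (hg _) (h.le_one _)
  measurable c := by
    simp only [shiftPath_apply, add_zero]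
    exact ((Measurable.of_discrete (f := g)).comp (measurable_path (NeZero.pos k) hkn c)).mul
      (h.measurable c)

end IsFunctional

section

variable [IsProbabilityMeasure (expMeasure lam)] [IsProbabilityMeasure (coinLaw p)]
  {Ψ Ψ' : (ℝ≥0 → State k) → ℝ≥0∞}

omit [NeZero k] [IsProbabilityMeasure (coinLaw p)] in
lemma ae_noiseLaw_pos : ∀ᵐ e ∂noiseLaw n lam p, (∀ m, 0 < e.1 m) ∧ ∀ a, 0 < e.2.1 a := by
  have h1 : ∀ᵐ e ∂noiseLaw n lam p, ∀ m, 0 < e.1 m :=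
    Measure.quasiMeasurePreserving_fst.ae ae_gapLaw_pos
  have h2 : ∀ᵐ e ∂noiseLaw n lam p, ∀ a, 0 < e.2.1 a :=
    Measure.quasiMeasurePreserving_snd.ae (Measure.quasiMeasurePreserving_fst.ae ae_workLaw_pos)
  exact h1.and h2

omit [IsProbabilityMeasure (coinLaw p)] in
-- Almost surely all clocks are positive, and only finitely many are running, so nothing happens
-- before some positive time.
lemma ae_path_zero (h : Admissible n k lam μ₀ μ₁ p) (c : Config n k) :
    ∀ᵐ e ∂noiseLaw n lam p, path μ₀ μ₁ c e 0 = c.toState := by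
  filter_upwards [ae_noiseLaw_pos] with e he
  obtain ⟨r, hr, hrg, hrun⟩ := exists_running h c (he.1 0) he.2
  rw [path]
  exact Input.stateAt_zero (NeZero.pos k) h.le h.low_pos h.high_pos
    (isQuiet_of_running h.low_pos h.high_pos (b := e.2.2) hr.le he.1 he.2 hrg hrun) hr

omit [IsProbabilityMeasure (coinLaw p)] in
lemma expect_mul_zero (h : Admissible n k lam μ₀ μ₁ p) (hΨ : IsFunctional n μ₀ μ₁ Ψ)
    (g : State k → ℝ≥0∞) (c : Config n k) :
    expect μ₀ μ₁ lam p (fun x => g (x 0) * Ψ x) 0 c =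
      g c.toState * expect μ₀ μ₁ lam p Ψ 0 c := by
  rw [expect, expect, ← lintegral_const_mul _ (hΨ.measurable_apply c 0)]
  refine lintegral_congr_ae ((ae_path_zero h c).mono fun e he => ?_)
  simp only [shiftPath_apply, zero_add, he]

omit [NeZero k] [IsProbabilityMeasure (expMeasure lam)] [IsProbabilityMeasure (coinLaw p)] in
lemma expect_shift (d s : ℝ≥0) (c : Config n k) :
    expect μ₀ μ₁ lam p (fun x => Ψ (shiftPath d x)) s c = expect μ₀ μ₁ lam p Ψ (s + d) c := by
  simp only [expect, shiftPath_shiftPath]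

variable (n μ₀ μ₁ lam p) in
omit [NeZero k] [IsProbabilityMeasure (expMeasure lam)] [IsProbabilityMeasure (coinLaw p)] in
/-- Two functionals have the same expectations, which depend on the snapshot only through its
aggregate state. -/
structure LumpEq (Ψ Ψ' : (ℝ≥0 → State k) → ℝ≥0∞) : Prop where
  left : IsFunctional n μ₀ μ₁ Ψ
  right : IsFunctional n μ₀ μ₁ Ψ'
  eq_zero : ∀ c c' : Config n k, c.toState = c'.toState →
    expect μ₀ μ₁ lam p Ψ 0 c = expect μ₀ μ₁ lam p Ψ' 0 c'

namespace LumpEq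

lemma eq (H : LumpEq n μ₀ μ₁ lam p Ψ Ψ') (h : Admissible n k lam μ₀ μ₁ p) (s : ℝ≥0)
    {c c' : Config n k} (hc : c.toState = c'.toState) :
    expect μ₀ μ₁ lam p Ψ s c = expect μ₀ μ₁ lam p Ψ' s c' :=
  expect_eq_of_zero h.le h.prob_nonneg h.prob_le_one h.low_pos h.high_pos h.lam_pos H.left H.right
    H.eq_zero s hc

/-- Equality at time zero for the shifted functionals is equality at time `d` for the original ones,
which is what uniqueness of the renewal solution provides. -/
lemma shift (H : LumpEq n μ₀ μ₁ lam p Ψ Ψ') (h : Admissible n k lam μ₀ μ₁ p) (d : ℝ≥0) :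
    LumpEq n μ₀ μ₁ lam p (fun x => Ψ (shiftPath d x)) fun x => Ψ' (shiftPath d x) where
  left := H.left.shift d
  right := H.right.shift d
  eq_zero c c' hc := by
    rw [expect_shift, expect_shift]
    exact H.eq h _ hc

omit [IsProbabilityMeasure (coinLaw p)] in
lemma mul (H : LumpEq n μ₀ μ₁ lam p Ψ Ψ') (h : Admissible n k lam μ₀ μ₁ p)
    {g : State k → ℝ≥0∞} (hg : ∀ z, g z ≤ 1) :
    LumpEq n μ₀ μ₁ lam p (fun x => g (x 0) * Ψ x) fun x => g (x 0) * Ψ' x where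
  left := H.left.mul h.le hg
  right := H.right.mul h.le hg
  eq_zero c c' hc := by
    rw [expect_mul_zero h H.left, expect_mul_zero h H.right, hc, H.eq_zero c c' hc]

lemma of_state (h : Admissible n k lam μ₀ μ₁ p) {g : State k → ℝ≥0∞} (hg : ∀ z, g z ≤ 1) :
    LumpEq n μ₀ μ₁ lam p (fun x => g (x 0)) fun x => g (x 0) := by
  have h1 : LumpEq n μ₀ μ₁ lam p (fun _ : ℝ≥0 → State k => 1) fun _ => 1 :=
    ⟨isFunctional_const le_rfl, isFunctional_const le_rfl, fun c c' _ => by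
      rw [expect_const, expect_const]⟩
  simpa only [mul_one] using h1.mul h hg

/-- The path is taken to begin at time `r`. Factors are inserted from the latest observation time to
the earliest: the pair already built for times after `v` is seen from `v`, multiplied by the factor
at `v` (there the initial time), and moved back to `r` by a shift. -/
lemma cylinder (H : LumpEq n μ₀ μ₁ lam p Ψ Ψ') (h : Admissible n k lam μ₀ μ₁ p) {s : ℝ≥0}
    (g : ℝ≥0 → State k → ℝ≥0∞) (hg : ∀ u z, g u z ≤ 1) (t : Finset ℝ≥0) :
    ∀ r, (∀ u ∈ t, r ≤ u ∧ u ≤ s) → r ≤ s →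
      LumpEq n μ₀ μ₁ lam p (fun x => (∏ u ∈ t, g u (x (u - r))) * Ψ (shiftPath (s - r) x))
        fun x => (∏ u ∈ t, g u (x (u - r))) * Ψ' (shiftPath (s - r) x) := by
  induction t using Finset.induction_on_min with
  | empty =>
    intro r _ _
    simpa only [Finset.prod_empty, one_mul] using H.shift h (s - r)
  | insert v t hv ih =>
    intro r ht hr
    obtain ⟨hrv, hvs⟩ := ht v (Finset.mem_insert_self v t)
    have h1 := ((ih v (fun u hu => ⟨(hv u hu).le, (ht u (Finset.mem_insert_of_mem hu)).2⟩)
      hvs).mul h (hg v)).shift h (v - r)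
    have hvt : v ∉ t := fun hmem => lt_irrefl _ (hv v hmem)
    have hsub : ∀ u, v ≤ u → v - r + (u - v) = u - r := fun u hu => by
      rw [add_comm, tsub_add_tsub_cancel hu hrv]
    have key : ∀ (Φ : (ℝ≥0 → State k) → ℝ≥0∞) (x : ℝ≥0 → State k),
        g v (shiftPath (v - r) x 0) * ((∏ u ∈ t, g u (shiftPath (v - r) x (u - v))) *
          Φ (shiftPath (s - v) (shiftPath (v - r) x))) =
        (∏ u ∈ insert v t, g u (x (u - r))) * Φ (shiftPath (s - r) x) := by
      intro Φ x
      rw [Finset.prod_insert hvt, shiftPath_shiftPath, shiftPath_apply, add_zero,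
        hsub s hvs, mul_assoc]
      congr 2
      refine Finset.prod_congr rfl fun u hu => ?_
      rw [shiftPath_apply, hsub u (hv u hu).le]
    simpa only [key] using h1

end LumpEq

/-! ### The transition function -/

instance : Nonempty (Config n k) :=
  ⟨⟨[], fun _ => false, List.Pairwise.nil, by simp⟩⟩

/-- A snapshot with the given aggregate state. -/
def rep (n : ℕ) (z : State k) : Config n k := Function.invFun Config.toState z

omit [NeZero k] in
lemma toState_rep (hkn : k ≤ n) {z : State k} (hz : z ∈ states n k) :
    (rep n z).toState = z :=
  Function.invFun_eq (Config.exists_toState_eq hkn hz)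

/-- The path begins in `z`. -/
def visit (z : State k) (x : ℝ≥0 → State k) : ℝ≥0∞ := Set.indicator {z} 1 (x 0)

variable (n μ₀ μ₁ lam p) in
/-- The transition function. -/
def transProb (t : ℝ≥0) (z z' : State k) : ℝ :=
  (expect μ₀ μ₁ lam p (visit z') t (rep n z)).toReal

omit [NeZero k] in
lemma indicator_one_le_one {α : Type*} (B : Set α) (z : α) :
    B.indicator (1 : α → ℝ≥0∞) z ≤ 1 :=
  Set.indicator_apply_le fun _ => le_rfl

lemma lumpEq_visit (h : Admissible n k lam μ₀ μ₁ p) (z : State k) :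
    LumpEq n μ₀ μ₁ lam p (visit z) (visit z) :=
  LumpEq.of_state h (indicator_one_le_one {z})

/-- By lumping, the representative chosen in the definition may be replaced by any snapshot with the
same aggregate state. -/
lemma ofReal_transProb (h : Admissible n k lam μ₀ μ₁ p) (t : ℝ≥0) {z : State k}
    (hz : z ∈ states n k) (z' : State k) {c : Config n k} (hc : c.toState = z) :
    ENNReal.ofReal (transProb n μ₀ μ₁ lam p t z z') = expect μ₀ μ₁ lam p (visit z') t c := by
  rw [transProb, ENNReal.ofReal_toReal]
  · exact (lumpEq_visit h z').eq h t ((toState_rep h.le hz).trans hc.symm)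
  · exact ((expect_le_one (lumpEq_visit h z').left t _).trans_lt ENNReal.one_lt_top).ne

/-- At time zero, both means vanish for snapshots not in state `z` and equal the transition
probability for those in `z`. This is the only input specific to the Markov property. -/
lemma lumpEq_transition (h : Admissible n k lam μ₀ μ₁ p) (t : ℝ≥0) {z : State k}
    (hz : z ∈ states n k) (z' : State k) :
    LumpEq n μ₀ μ₁ lam p (fun x => visit z x * visit z' (shiftPath t x))
      fun x => visit z x * ENNReal.ofReal (transProb n μ₀ μ₁ lam p t z z') := by
  have h1 : ENNReal.ofReal (transProb n μ₀ μ₁ lam p t z z') ≤ 1 := by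
    rw [ofReal_transProb h t hz z' (toState_rep h.le hz)]
    exact expect_le_one (lumpEq_visit h z').left t _
  have hl := (lumpEq_visit h z').left.shift t
  have hr : IsFunctional n μ₀ μ₁ (fun _ : ℝ≥0 → State k =>
      ENNReal.ofReal (transProb n μ₀ μ₁ lam p t z z')) := isFunctional_const h1
  refine ⟨hl.mul h.le (indicator_one_le_one {z}), hr.mul h.le (indicator_one_le_one {z}), ?_⟩
  intro c c' hc
  refine (expect_mul_zero h hl _ c).trans (Eq.trans ?_ (expect_mul_zero h hr _ c').symm)
  rw [expect_const, expect_shift, zero_add, ← hc]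
  by_cases hcz : c.toState = z
  · rw [ofReal_transProb h t hz z' hcz]
  · rw [Set.indicator_of_notMem (by simpa using hcz), zero_mul, zero_mul]

lemma expect_visit_zero (h : Admissible n k lam μ₀ μ₁ p) (z : State k) (c : Config n k) :
    expect μ₀ μ₁ lam p (visit z) 0 c = Set.indicator {z} 1 c.toState := by
  have h1 := expect_mul_zero h (isFunctional_const (n := n) (μ₀ := μ₀) (μ₁ := μ₁) (k := k) le_rfl)
    (Set.indicator {z} 1) c
  rw [expect_const, mul_one] at h1
  simp only [mul_one] at h1
  exact h1

/-- At a fixed time the aggregate state is almost surely a possible one. -/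
lemma ae_path_mem (h : Admissible n k lam μ₀ μ₁ p) (c : Config n k) (t : ℝ≥0) :
    ∀ᵐ e ∂noiseLaw n lam p, path μ₀ μ₁ c e t ∈ states n k := by
  -- Snapshots have aggregate states in `states`, so the indicator of the complement has mean `0` at
  -- time zero, and hence at all times.
  have h1 : LumpEq n μ₀ μ₁ lam p (fun x => (states n k)ᶜ.indicator 1 (x 0))
      fun _ : ℝ≥0 → State k => 0 := by
    refine ⟨(LumpEq.of_state h (indicator_one_le_one _)).left, isFunctional_const zero_le_one,
      fun c c' _ => ?_⟩
    have h2 := expect_mul_zero h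
      (isFunctional_const (n := n) (μ₀ := μ₀) (μ₁ := μ₁) (k := k) le_rfl)
      ((states n k)ᶜ.indicator 1) c
    simp only [mul_one] at h2
    rw [h2, expect_const, expect_const, Set.indicator_of_notMem (by simpa using c.toState_mem h.le), zero_mul]
  have h2 := h1.eq h t (c := c) rfl
  rw [expect_const, expect, lintegral_eq_zero_iff (h1.left.measurable_apply c t)] at h2
  filter_upwards [h2] with e he
  simp only [shiftPath_apply, add_zero] at he
  by_contra hn
  rw [Set.indicator_of_mem hn] at he
  simp at he

end

end ForkJoin

namespace ForkJoin

variable {n k : ℕ} {μ₀ μ₁ lam p : ℝ}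

/-! ### Properties of the transition function -/

lemma hasSum_of_tsum_ofReal {ι : Type*} {f : ι → ℝ} (hf : ∀ i, 0 ≤ f i) {a : ℝ} (ha : 0 ≤ a)
    (h : ∑' i, ENNReal.ofReal (f i) = ENNReal.ofReal a) : HasSum f a := by
  have h1 := ENNReal.hasSum_toReal (f := fun i => ENNReal.ofReal (f i))
    (by rw [h]; exact ENNReal.ofReal_ne_top)
  rw [← ENNReal.tsum_toReal_eq fun i => ENNReal.ofReal_ne_top, h, ENNReal.toReal_ofReal ha] at h1
  simpa only [ENNReal.toReal_ofReal (hf _)] using h1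

lemma tendsto_exp_sub_one_div (q : ℝ) :
    Tendsto (fun t : ℝ≥0 => (Real.exp (-(q * t)) - 1) / (t : ℝ)) (𝓝[>] 0) (𝓝 (-q)) := by
  have h1 : HasDerivAt (fun t : ℝ => Real.exp (-(q * t))) (-q) 0 := by
    have h2 : HasDerivAt (fun t : ℝ => -(q * t)) (-(q * 1)) 0 :=
      ((hasDerivAt_id (0 : ℝ)).const_mul q).neg
    simpa using h2.exp
  have h3 : Tendsto (fun t : ℝ≥0 => (t : ℝ)) (𝓝[>] 0) (𝓝[>] 0) := by
    refine tendsto_nhdsWithin_iff.2 ⟨?_, eventually_mem_nhdsWithin.mono fun t ht => ?_⟩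
    · exact (NNReal.continuous_coe.tendsto' 0 0 rfl).mono_left nhdsWithin_le_nhds
    · exact NNReal.coe_pos.2 ht
  refine (h1.tendsto_slope_zero_right.comp h3).congr fun t => ?_
  simp only [Function.comp_apply, zero_add, mul_zero, neg_zero, Real.exp_zero, smul_eq_mul]
  rw [div_eq_inv_mul]

variable [NeZero k] [IsProbabilityMeasure (expMeasure lam)] [IsProbabilityMeasure (coinLaw p)]

omit [NeZero k] [IsProbabilityMeasure (expMeasure lam)] [IsProbabilityMeasure (coinLaw p)] in
lemma transProb_nonneg (t : ℝ≥0) (z z' : State k) : 0 ≤ transProb n μ₀ μ₁ lam p t z z' :=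
  ENNReal.toReal_nonneg

lemma transProb_zero (h : Admissible n k lam μ₀ μ₁ p) {z : State k} (hz : z ∈ states n k)
    (z' : State k) : transProb n μ₀ μ₁ lam p 0 z z' = if z' = z then 1 else 0 := by
  rw [transProb, expect_visit_zero h, toState_rep h.le hz]
  by_cases hzz : z' = z
  · simp [hzz]
  · rw [Set.indicator_of_notMem (by simpa using Ne.symm hzz), if_neg hzz, ENNReal.toReal_zero]

lemma expect_eq_tsum (h : Admissible n k lam μ₀ μ₁ p) {g : State k → ℝ≥0∞} (c : Config n k)
    (t : ℝ≥0) : expect μ₀ μ₁ lam p (fun x => g (x 0)) t c =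
      ∑' y : states n k, g y * expect μ₀ μ₁ lam p (visit y) t c := by
  have hm : ∀ y : State k, Measurable fun e => visit y (shiftPath t (path μ₀ μ₁ c e)) := fun y =>
    (lumpEq_visit (lam := lam) (p := p) h y).left.measurable_apply c t
  simp only [expect]
  simp only [← lintegral_const_mul _ (hm _)]
  rw [← lintegral_tsum fun y => ((hm _).const_mul _).aemeasurable]
  refine lintegral_congr_ae ((ae_path_mem h c t).mono fun e he => ?_)
  simp only [visit, shiftPath_apply, add_zero]
  rw [tsum_eq_single ⟨_, he⟩]
  · simp
  · intro y hy
    rw [Set.indicator_of_notMem, mul_zero]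
    intro hmem
    exact hy (Subtype.ext (Set.mem_singleton_iff.1 hmem).symm)

lemma hasSum_transProb (h : Admissible n k lam μ₀ μ₁ p) (t : ℝ≥0) {z : State k}
    (hz : z ∈ states n k) :
    HasSum (fun y : states n k => transProb n μ₀ μ₁ lam p t z y) 1 := by
  refine hasSum_of_tsum_ofReal (fun _ => transProb_nonneg _ _ _) zero_le_one ?_
  have h1 := expect_eq_tsum h (g := fun _ => 1) (rep n z) t
  rw [expect_const] at h1
  rw [ENNReal.ofReal_one, h1]
  refine tsum_congr fun y => ?_
  rw [one_mul, ofReal_transProb h t hz y (toState_rep h.le hz)]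

/-- Visiting `z'` after time `t` and the function `P_t(·, z')` of the initial state have equal
lumped means; the identity follows by evaluating both at time `s` and summing over the state there.
-/
lemma chapmanKolmogorov (h : Admissible n k lam μ₀ μ₁ p) (s t : ℝ≥0) {z : State k}
    (hz : z ∈ states n k) (z' : State k) :
    HasSum (fun y : states n k => transProb n μ₀ μ₁ lam p s z y * transProb n μ₀ μ₁ lam p t y z')
      (transProb n μ₀ μ₁ lam p (s + t) z z') := by
  refine hasSum_of_tsum_ofReal
    (fun _ => mul_nonneg (transProb_nonneg _ _ _) (transProb_nonneg _ _ _))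
    (transProb_nonneg _ _ _) ?_
  set g : State k → ℝ≥0∞ := fun y => ENNReal.ofReal (transProb n μ₀ μ₁ lam p t y z') with hg
  have hvis := lumpEq_visit h z'
  have hg1 : ∀ y, g y ≤ 1 := fun y =>
    ENNReal.ofReal_toReal_le.trans (expect_le_one hvis.left t _)
  have h1 : LumpEq n μ₀ μ₁ lam p (fun x => visit z' (shiftPath t x)) fun x => g (x 0) := by
    refine ⟨hvis.left.shift t, (LumpEq.of_state h hg1).left, fun c c' hc => ?_⟩
    have h2 := expect_mul_zero h
      (isFunctional_const (n := n) (μ₀ := μ₀) (μ₁ := μ₁) (k := k) le_rfl) g c'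
    simp only [mul_one] at h2
    rw [h2, expect_const, mul_one, expect_shift, zero_add, ← hc,
      ← ofReal_transProb h t (c.toState_mem h.le) z' rfl]
  have h2 := h1.eq h s (c := rep n z) rfl
  rw [expect_shift, ← ofReal_transProb h (s + t) hz z' (toState_rep h.le hz),
    expect_eq_tsum h] at h2
  rw [h2]
  refine tsum_congr fun y => ?_
  rw [ENNReal.ofReal_mul (transProb_nonneg _ _ _), mul_comm,
    ofReal_transProb h s hz y (toState_rep h.le hz)]

/-- The short-time bounds squeeze the difference quotient between two functions with the limit `-q *
δ + J`, the jump rate corrected by the exit rate on the diagonal. -/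
lemma tendsto_transProb (h : Admissible n k lam μ₀ μ₁ p) {z z' : State k}
    (hz : z ∈ states n k) :
    Tendsto (fun t : ℝ≥0 => (transProb n μ₀ μ₁ lam p t z z' - transProb n μ₀ μ₁ lam p 0 z z') /
      (t : ℝ)) (𝓝[>] 0) (𝓝 (Q n lam μ₀ μ₁ p z z')) := by
  set J := jumpRate n μ₀ μ₁ lam p z z' with hJ
  set q := exitRate n lam μ₀ μ₁ z with hq
  set Λ := maxRate n μ₀ μ₁ lam with hΛ
  set δ : ℝ := if z' = z then 1 else 0 with hδ
  have hJ0 : 0 ≤ J :=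
    jumpRate_nonneg h.prob_nonneg h.prob_le_one h.low_pos h.high_pos h.lam_pos hz z'
  have hΛ0 : 0 < Λ := maxRate_pos h.low_pos h.lam_pos
  have hδ0 : 0 ≤ δ := by rw [hδ]; split_ifs <;> simp
  have hc := toState_rep h.le hz
  have hvis := (lumpEq_visit h z').left
  have hqc : totalRate μ₀ μ₁ lam (rep n z) = q := by rw [totalRate_eq_exitRate h.le, hc]
  have hzero : expect μ₀ μ₁ lam p (visit z') 0 (rep n z) = ENNReal.ofReal δ := by
    rw [← ofReal_transProb h 0 hz z' hc, transProb_zero h hz]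
  have hjump : jumpMean μ₀ μ₁ lam p (rep n z) (expect μ₀ μ₁ lam p (visit z') 0) =
      ENNReal.ofReal J := by
    rw [show expect μ₀ μ₁ lam p (visit z') 0 = fun c : Config n k =>
      Set.indicator {z'} 1 c.toState from funext fun c => expect_visit_zero h z' c,
      jumpMean_toState h.le h.prob_nonneg h.prob_le_one, hc,
      lumpMean_single h.prob_nonneg h.prob_le_one h.low_pos h.high_pos h.lam_pos hz]
  have hup : ∀ t : ℝ≥0, transProb n μ₀ μ₁ lam p t z z' ≤
      Real.exp (-(q * t)) * δ + (J + Λ * (Λ * t)) * t := by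
    intro t
    have h1 := expect_le_short h.le h.low_pos h.high_pos h.lam_pos hvis (rep n z) t (p := p)
    rw [hqc, hzero, hjump, ← ofReal_transProb h t hz z' hc, ← ENNReal.ofReal_mul (by positivity),
      ← ENNReal.ofReal_mul hΛ0.le, ← ENNReal.ofReal_add hJ0 (by positivity),
      ← ENNReal.ofReal_mul (by positivity), ← ENNReal.ofReal_add (by positivity) (by positivity),
      ENNReal.ofReal_le_ofReal_iff (by positivity)] at h1
    exact h1
  have hlo : ∀ t : ℝ≥0, Real.exp (-(q * t)) * δ +
      Real.exp (-(Λ * t)) * (Real.exp (-(Λ * t)) * J) * t ≤ transProb n μ₀ μ₁ lam p t z z' := by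
    intro t
    have h1 := le_expect_short h.le h.low_pos h.high_pos h.lam_pos hvis (rep n z) t (p := p)
    rw [hqc, hzero, hjump, ← ofReal_transProb h t hz z' hc, ← ENNReal.ofReal_mul (by positivity),
      ← ENNReal.ofReal_mul (by positivity), ← ENNReal.ofReal_mul (by positivity),
      ← ENNReal.ofReal_mul (by positivity), ← ENNReal.ofReal_add (by positivity) (by positivity),
      ENNReal.ofReal_le_ofReal_iff (transProb_nonneg _ _ _)] at h1
    exact h1
  have hQ : Q n lam μ₀ μ₁ p z z' = -q * δ + J := by
    rw [Q, hJ, jumpRate, hδ]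
    split_ifs <;> ring
  have hcoe : Tendsto (fun t : ℝ≥0 => (t : ℝ)) (𝓝[>] 0) (𝓝 0) :=
    (NNReal.continuous_coe.tendsto' 0 0 rfl).mono_left nhdsWithin_le_nhds
  have hexp : Tendsto (fun t : ℝ≥0 => Real.exp (-(Λ * t))) (𝓝[>] 0) (𝓝 1) := by
    have := (Real.continuous_exp.tendsto _).comp (hcoe.const_mul Λ).neg
    simp only [mul_zero, neg_zero, Real.exp_zero] at this
    exact this
  have hd := (tendsto_exp_sub_one_div q).mul_const δ
  have hlow : Tendsto (fun t : ℝ≥0 => (Real.exp (-(q * t)) - 1) / (t : ℝ) * δ +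
      Real.exp (-(Λ * t)) * (Real.exp (-(Λ * t)) * J)) (𝓝[>] 0) (𝓝 (-q * δ + J)) := by
    have := hd.add (hexp.mul (hexp.mul_const J))
    simpa only [one_mul] using this
  have hupp : Tendsto (fun t : ℝ≥0 => (Real.exp (-(q * t)) - 1) / (t : ℝ) * δ +
      (J + Λ * (Λ * t))) (𝓝[>] 0) (𝓝 (-q * δ + J)) := by
    have := hd.add (((hcoe.const_mul Λ).const_mul Λ).const_add J)
    simpa only [mul_zero, add_zero] using this
  rw [hQ]
  refine tendsto_of_tendsto_of_tendsto_of_le_of_le' hlow hupp ?_ ?_ <;>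
  · refine eventually_mem_nhdsWithin.mono fun t ht => ?_
    have ht0 : (0 : ℝ) < t := NNReal.coe_pos.2 ht
    rw [transProb_zero h hz, ← hδ]
    have h1 := hup t
    have h2 := hlo t
    first
    | rw [le_div_iff₀ ht0]
    | rw [div_le_iff₀ ht0]
    rw [add_mul, mul_right_comm, div_mul_cancel₀ _ ht0.ne']
    linarith

theorem isTransitionFunction (h : Admissible n k lam μ₀ μ₁ p) :
    IsTransitionFunction (states n k) (Q n lam μ₀ μ₁ p)
      (fun t x y => transProb n μ₀ μ₁ lam p t (x : State k) (y : State k)) where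
  nonneg _ _ _ := transProb_nonneg _ _ _
  sum_one t x := hasSum_transProb h t x.2
  zero_self x := by rw [transProb_zero h x.2, if_pos rfl]
  zero_ne x y hxy := by rw [transProb_zero h x.2, if_neg fun h => hxy (Subtype.ext h.symm)]
  chapman_kolmogorov s t x y := chapmanKolmogorov h s t x.2 y
  rates x y := tendsto_transProb h x.2

end ForkJoin

namespace ForkJoin

variable {n k : ℕ} {μ₀ μ₁ : ℝ}

/-! ### Regularity of the paths -/

namespace Input

/-- The arrival time of a later query is at least each gap summed in it, so a single gap exceeding
`T` bounds the number of queries. -/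
lemma finite_arrival_le {w : Input n k} (hpos : ∀ m, 0 < w.gap m)
    (hub : ∀ T : ℕ, ∃ m, (T : ℝ) < w.gap m) (T : ℝ) : {l | w.arrival l ≤ T}.Finite := by
  obtain ⟨N, hN⟩ := exists_nat_ge T
  obtain ⟨m, hm⟩ := hub N
  refine (Set.finite_lt_nat (w.initCount + m)).subset fun l hl => ?_
  by_contra hlm
  have h1 : w.initCount + m ≤ l := not_lt.1 hlm
  have h2 : w.gap m ≤ w.arrival l := by
    rw [arrival, if_neg (by omega)]
    exact Finset.single_le_sum (fun i _ => (hpos i).le) (Finset.mem_range.2 (by omega))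
  exact absurd (hl : w.arrival l ≤ T) (not_le.2 (hN.trans_lt (hm.trans_le h2)))

/-- The state depends on time only through comparisons with arrivals, starts, completions and
departures, and a query arriving after `T` is at no stage up to `T`. -/
lemma stateAt_congr {w : Input n k} {T t u : ℝ} (ht : t ≤ T) (hu : u ≤ T)
    (h : ∀ l, w.arrival l ≤ T → (w.arrival l ≤ u ↔ w.arrival l ≤ t) ∧
      (w.departure μ₀ μ₁ l ≤ u ↔ w.departure μ₀ μ₁ l ≤ t) ∧
      ∀ j, (w.start μ₀ μ₁ l j ≤ u ↔ w.start μ₀ μ₁ l j ≤ t) ∧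
        (w.completion μ₀ μ₁ l j ≤ u ↔ w.completion μ₀ μ₁ l j ≤ t)) :
    w.stateAt μ₀ μ₁ u = w.stateAt μ₀ μ₁ t := by
  have hstage : ∀ i l, w.atStage μ₀ μ₁ u i l ↔ w.atStage μ₀ μ₁ t i l := by
    intro i l
    by_cases hl : w.arrival l ≤ T
    · obtain ⟨h1, h2, h3⟩ := h l hl
      simp only [atStage, h1, ← not_le, h2, (h3 _).2]
    · exact iff_of_false (fun h' => hl (h'.1.trans hu)) fun h' => hl (h'.1.trans ht)
  have hserv : ∀ i j l, w.serving μ₀ μ₁ u j l ∧ w.atStage μ₀ μ₁ t i l ∧ w.isHigh j l = true ↔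
      w.serving μ₀ μ₁ t j l ∧ w.atStage μ₀ μ₁ t i l ∧ w.isHigh j l = true := by
    intro i j l
    refine and_congr_left fun h' => ?_
    obtain ⟨h1, h2, h3⟩ := h l (h'.1.1.trans ht)
    simp only [serving, ← not_le, h2, (h3 _).1, (h3 _).2]
  have hY : ∀ i, w.Y μ₀ μ₁ u i = w.Y μ₀ μ₁ t i := fun i => by
    simp only [Y, hstage]
  have hH : ∀ i, w.H μ₀ μ₁ u i = w.H μ₀ μ₁ t i := fun i => by
    simp only [H, hstage, hserv]
  funext i
  rw [stateAt, stateAt, hY, hH]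

/-- Here `P a` is the eventual truth value of `a ≤ u` along `F`: it will be `a ≤ t` from the right
and `a < t` from the left. Only finitely many instants matter, so all comparisons stabilise
together. -/
lemma exists_eventually_stateAt {w : Input n k} (hfin : ∀ T, {l | w.arrival l ≤ T}.Finite)
    {F : Filter ℝ≥0} {T : ℝ} (hT : ∀ᶠ u : ℝ≥0 in F, (u : ℝ) ≤ T) {P : ℝ → Prop}
    (hP : ∀ a : ℝ, ∀ᶠ u : ℝ≥0 in F, (a ≤ u ↔ P a)) :
    ∃ x, ∀ᶠ u : ℝ≥0 in F, w.stateAt μ₀ μ₁ u = x := by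
  -- The trivial filter does occur: it is the left neighbourhood of `0` in `ℝ≥0`.
  rcases F.eq_or_neBot with rfl | _
  · exact ⟨w.stateAt μ₀ μ₁ 0, eventually_bot⟩
  have h1 : ∀ᶠ u : ℝ≥0 in F, ∀ l ∈ {l | w.arrival l ≤ T}, (w.arrival l ≤ u ↔ P (w.arrival l)) ∧
      (w.departure μ₀ μ₁ l ≤ u ↔ P (w.departure μ₀ μ₁ l)) ∧
      ∀ j, (w.start μ₀ μ₁ l j ≤ u ↔ P (w.start μ₀ μ₁ l j)) ∧
        (w.completion μ₀ μ₁ l j ≤ u ↔ P (w.completion μ₀ μ₁ l j)) :=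
    (Set.Finite.eventually_all (hfin T)).2 fun l _ => (hP _).and ((hP _).and
      (eventually_all.2 fun j => (hP _).and (hP _)))
  obtain ⟨v, hv, hvT⟩ := (h1.and hT).exists
  refine ⟨w.stateAt μ₀ μ₁ v, ?_⟩
  filter_upwards [h1, hT] with u hu huT
  refine stateAt_congr hvT huT fun l hl => ?_
  obtain ⟨a1, a2, a3⟩ := hu l hl
  obtain ⟨b1, b2, b3⟩ := hv l hl
  exact ⟨a1.trans b1.symm, a2.trans b2.symm, fun j =>
    ⟨(a3 j).1.trans (b3 j).1.symm, (a3 j).2.trans (b3 j).2.symm⟩⟩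

lemma eventually_le_of_nhds (t : ℝ≥0) : ∀ᶠ u : ℝ≥0 in 𝓝 t, (u : ℝ) ≤ t + 1 :=
  ((NNReal.continuous_coe.tendsto t).eventually_lt_const (by linarith)).mono fun _ => le_of_lt

lemma eventually_stateAt_nhdsGE {w : Input n k} (hfin : ∀ T, {l | w.arrival l ≤ T}.Finite)
    (t : ℝ≥0) : ∀ᶠ u : ℝ≥0 in 𝓝[≥] t, w.stateAt μ₀ μ₁ u = w.stateAt μ₀ μ₁ t := by
  obtain ⟨x, hx⟩ := exists_eventually_stateAt (μ₀ := μ₀) (μ₁ := μ₁) hfin (F := 𝓝[≥] t)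
    ((eventually_le_of_nhds t).filter_mono nhdsWithin_le_nhds) (P := fun a => a ≤ t) fun a => by
      rcases le_or_gt a t with ha | ha
      · filter_upwards [eventually_mem_nhdsWithin] with u hu
        exact iff_of_true (ha.trans (NNReal.coe_le_coe.2 hu)) ha
      · filter_upwards [((NNReal.continuous_coe.tendsto t).eventually_lt_const ha).filter_mono
          nhdsWithin_le_nhds] with u hu
        exact iff_of_false (not_le.2 hu) (not_le.2 ha)
  have h1 : w.stateAt μ₀ μ₁ t = x := hx.self_of_nhdsWithin Set.self_mem_Ici
  rw [h1]
  exact hx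

lemma exists_eventually_stateAt_nhdsLT {w : Input n k}
    (hfin : ∀ T, {l | w.arrival l ≤ T}.Finite) (t : ℝ≥0) :
    ∃ x, ∀ᶠ u : ℝ≥0 in 𝓝[<] t, w.stateAt μ₀ μ₁ u = x := by
  refine exists_eventually_stateAt hfin
    ((eventually_le_of_nhds t).filter_mono nhdsWithin_le_nhds) (P := fun a => a < t) fun a => ?_
  rcases lt_or_ge a t with ha | ha
  · filter_upwards [((NNReal.continuous_coe.tendsto t).eventually_const_lt ha).filter_mono
      nhdsWithin_le_nhds] with u hu
    exact iff_of_true hu.le ha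
  · filter_upwards [eventually_mem_nhdsWithin] with u hu
    exact iff_of_false (not_le.2 ((NNReal.coe_lt_coe.2 hu).trans_le ha)) (not_lt.2 ha)

end Input

end ForkJoin

namespace ForkJoin

/-! ### Markov property from cylinder events -/

section

variable {Ω S : Type*} [MeasurableSpace Ω] [MeasurableSpace S]

lemma history_le {X : ℝ≥0 → Ω → S} (hX : ∀ t, Measurable (X t)) (s : ℝ≥0) :
    history X s ≤ ‹MeasurableSpace Ω› :=
  iSup_le fun u => (hX u).comap_le

/-- As functions of `A`, both sides are measures on the history; they agree on cylinders, which form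
a generating π-system, and in total mass, the case of the empty cylinder. -/
lemma measure_inter_eq_mul_of_cylinder {Pr : Measure Ω} [IsFiniteMeasure Pr] {X : ℝ≥0 → Ω → S}
    (hX : ∀ t, Measurable (X t)) (s : ℝ≥0) {E E' : Set Ω} {a : ℝ≥0∞}
    (h : ∀ (t : Finset ℝ≥0) (B : ℝ≥0 → Set S), (∀ u ∈ t, u ≤ s) →
      Pr ((⋂ u ∈ t, X u ⁻¹' B u) ∩ E') = a * Pr ((⋂ u ∈ t, X u ⁻¹' B u) ∩ E))
    {A : Set Ω} (hA : MeasurableSet[history X s] A) : Pr (A ∩ E') = a * Pr (A ∩ E) := by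
  have hle := history_le hX s
  have hval : ∀ F A, MeasurableSet[history X s] A →
      (Pr.restrict F).trim hle A = Pr (A ∩ F) := fun F A hA => by
    rw [trim_measurableSet_eq hle hA, Measure.restrict_apply (hle _ hA)]
  have hgen : history X s = MeasurableSpace.generateFrom (piiUnionInter
      (fun u => {A | MeasurableSet[MeasurableSpace.comap (X u) inferInstance] A}) (Set.Iic s)) := by
    have h1 := generateFrom_piiUnionInter_measurableSet
      (fun u => MeasurableSpace.comap (X u) inferInstance) (Set.Iic s)
    rw [iSup_subtype'] at h1
    exact h1.symm
  have heq : (Pr.restrict E').trim hle = a • (Pr.restrict E).trim hle := by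
    refine @ext_of_generate_finite _ (history X s) _ _ _ hgen
      (isPiSystem_piiUnionInter _ (fun u => @MeasurableSpace.isPiSystem_measurableSet _
        (MeasurableSpace.comap (X u) inferInstance)) _) _ ?_ ?_
    · rintro A ⟨t, ht, f, hf, rfl⟩
      have hf' : ∀ u, ∃ B, u ∈ t → X u ⁻¹' B = f u := fun u => by
        by_cases hu : u ∈ t
        · obtain ⟨B, -, hB⟩ := hf u hu
          exact ⟨B, fun _ => hB⟩
        · exact ⟨∅, fun hu' => absurd hu' hu⟩
      choose B hB using hf'
      have hm : MeasurableSet[history X s] (⋂ u ∈ t, f u) :=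
        Finset.measurableSet_biInter t fun u hu =>
          (le_iSup (fun u : Set.Iic s => MeasurableSpace.comap (X u) inferInstance)
            ⟨u, ht hu⟩ : _ ≤ history X s) _ (hf u hu)
      rw [Measure.smul_apply, hval _ _ hm, hval _ _ hm, smul_eq_mul,
        ← Set.iInter₂_congr hB]
      exact h t B fun u hu => ht hu
    · have h1 := h ∅ (fun _ => ∅) (by simp)
      rw [Measure.smul_apply, hval _ _ MeasurableSet.univ, hval _ _ MeasurableSet.univ, smul_eq_mul]
      simpa using h1
  have h2 := congrArg (fun μ => μ A) heq
  simp only [Measure.smul_apply, smul_eq_mul] at h2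
  rwa [hval _ _ hA, hval _ _ hA] at h2

end

/-! ### The law of the random input -/

variable {n k : ℕ} {μ₀ μ₁ lam p : ℝ} {Ω : Type*} [MeasurableSpace Ω] {Pr : Measure Ω}
  [IsProbabilityMeasure Pr] {W : Ω → Input n k}

/-- The noise of a realisation. -/
def Input.noise (w : Input n k) : Noise n := (w.gap, w.work, w.coin)

lemma Z_eq_path (w : Input n k) (t : ℝ≥0) : w.Z μ₀ μ₁ t = path μ₀ μ₁ w.init w.noise t := by
  rw [path]
  rfl

namespace IsRandomInput

omit [IsProbabilityMeasure Pr] in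
lemma measurable_noise (hW : IsRandomInput Pr lam p W) : Measurable fun ω => (W ω).noise :=
  (measurable_pi_iff.2 hW.measurable_gap).prodMk
    ((measurable_pi_iff.2 hW.measurable_work).prodMk (measurable_pi_iff.2 hW.measurable_coin))

lemma map_coin (hW : IsRandomInput Pr lam p W) (a : Fin n × ℕ) :
    Pr.map (fun ω => (W ω).coin a) = coinLaw p := by
  have hm := hW.measurable_coin a
  have h1 : Pr {ω | (W ω).coin a = true} = ENNReal.ofReal p := by
    rw [← hW.law_coin a, ofReal_measureReal]
  have h2 : Pr {ω | (W ω).coin a = false} = ENNReal.ofReal (1 - p) := by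
    have h3 : {ω | (W ω).coin a = false} = {ω | (W ω).coin a = true}ᶜ := by ext; simp
    have h4 : MeasurableSet {ω | (W ω).coin a = true} := hm (measurableSet_singleton true)
    rw [h3, ← hW.law_coin a, ← probReal_compl_eq_one_sub h4, ofReal_measureReal]
  refine Measure.ext_of_singleton fun b => ?_
  rw [Measure.map_apply hm (measurableSet_singleton b)]
  cases b
  · rw [coinLaw_false]; exact h2
  · rw [coinLaw_true]; exact h1

omit [IsProbabilityMeasure Pr] in
lemma map_gap (hW : IsRandomInput Pr lam p W) : Pr.map (fun ω => (W ω).gap) = gapLaw lam := by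
  have h1 := hW.indep_gap.map_fun_eq_infinitePi_map hW.measurable_gap
  simp only [hW.law_gap] at h1
  exact h1

omit [IsProbabilityMeasure Pr] in
lemma map_work (hW : IsRandomInput Pr lam p W) : Pr.map (fun ω => (W ω).work) = workLaw n := by
  have h1 := hW.indep_work.map_fun_eq_infinitePi_map hW.measurable_work
  simp only [hW.law_work] at h1
  exact h1

lemma map_coins (hW : IsRandomInput Pr lam p W) : Pr.map (fun ω => (W ω).coin) = coinsLaw n p := by
  have h1 := hW.indep_coin.map_fun_eq_infinitePi_map hW.measurable_coin
  simp only [hW.map_coin] at h1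
  exact h1

lemma map_noise (hW : IsRandomInput Pr lam p W) :
    Pr.map (fun ω => (W ω).noise) = noiseLaw n lam p := by
  have hg := measurable_pi_iff.2 hW.measurable_gap
  have hw := measurable_pi_iff.2 hW.measurable_work
  have hc := measurable_pi_iff.2 hW.measurable_coin
  have h1 := (indepFun_iff_map_prod_eq_prod_map_map hg.aemeasurable
    (hw.prodMk hc).aemeasurable).1 hW.indep_gap_rest
  have h2 := (indepFun_iff_map_prod_eq_prod_map_map hw.aemeasurable hc.aemeasurable).1
    hW.indep_work_coin
  rw [h2, hW.map_gap, hW.map_work, hW.map_coins] at h1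
  exact h1

lemma map_init_noise (hW : IsRandomInput Pr lam p W) :
    Pr.map (fun ω => ((W ω).init, (W ω).noise)) =
      (Pr.map fun ω => (W ω).init).prod (noiseLaw n lam p) := by
  have h1 := (indepFun_iff_map_prod_eq_prod_map_map hW.measurable_init.aemeasurable
    hW.measurable_noise.aemeasurable).1 hW.indep_init_rest
  rw [hW.map_noise] at h1
  exact h1

variable [NeZero k]

omit [IsProbabilityMeasure Pr] in
lemma measurable_Z (hkn : k ≤ n) (hW : IsRandomInput Pr lam p W) (t : ℝ≥0) :
    Measurable fun ω => (W ω).Z μ₀ μ₁ t := by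
  have h1 : Measurable fun q : Config n k × Noise n => path μ₀ μ₁ q.1 q.2 t :=
    measurable_from_prod_countable_right fun c =>
      (measurable_path (NeZero.pos k) hkn c).comp (measurable_const.prodMk measurable_id)
  simp only [Z_eq_path]
  exact h1.comp (hW.measurable_init.prodMk hW.measurable_noise)

variable [IsProbabilityMeasure (expMeasure lam)] [IsProbabilityMeasure (coinLaw p)]
  {Ψ Ψ' : (ℝ≥0 → State k) → ℝ≥0∞}

omit [NeZero k] in
lemma lintegral_functional (hW : IsRandomInput Pr lam p W) (hΨ : IsFunctional n μ₀ μ₁ Ψ) :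
    ∫⁻ ω, Ψ (fun t => (W ω).Z μ₀ μ₁ t) ∂Pr =
      ∫⁻ c, expect μ₀ μ₁ lam p Ψ 0 c ∂(Pr.map fun ω => (W ω).init) := by
  have h1 : Measurable fun q : Config n k × Noise n => Ψ (shiftPath 0 (path μ₀ μ₁ q.1 q.2)) :=
    measurable_from_prod_countable_right fun c => hΨ.measurable_apply c 0
  have h2 := lintegral_map (μ := Pr) h1 (hW.measurable_init.prodMk hW.measurable_noise)
  rw [hW.map_init_noise, lintegral_prod _ h1.aemeasurable] at h2
  simp only [expect]
  rw [h2]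
  refine lintegral_congr fun ω => ?_
  rw [shiftPath_zero]
  congr 1
  funext t
  exact Z_eq_path _ t

omit [NeZero k] in
lemma lintegral_eq_of_lumpEq (hW : IsRandomInput Pr lam p W) (H : LumpEq n μ₀ μ₁ lam p Ψ Ψ') :
    ∫⁻ ω, Ψ (fun t => (W ω).Z μ₀ μ₁ t) ∂Pr = ∫⁻ ω, Ψ' (fun t => (W ω).Z μ₀ μ₁ t) ∂Pr := by
  rw [hW.lintegral_functional H.left, hW.lintegral_functional H.right]
  exact lintegral_congr fun c => H.eq_zero c c rfl

lemma ae_Z_mem (h : Admissible n k lam μ₀ μ₁ p) (hW : IsRandomInput Pr lam p W) (t : ℝ≥0) :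
    ∀ᵐ ω ∂Pr, (W ω).Z μ₀ μ₁ t ∈ states n k := by
  have h1 : ∀ c : Config n k, ∀ᵐ e ∂noiseLaw n lam p, path μ₀ μ₁ c e t ∈ states n k :=
    fun c => ae_path_mem h c t
  have hm : MeasurableSet {q : Config n k × Noise n | path μ₀ μ₁ q.1 q.2 t ∈ states n k} := by
    have h2 : Measurable fun q : Config n k × Noise n => path μ₀ μ₁ q.1 q.2 t :=
      measurable_from_prod_countable_right fun c =>
        (measurable_path (NeZero.pos k) h.le c).comp (measurable_const.prodMk measurable_id)
    exact h2 MeasurableSet.of_discrete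
  have h3 : ∀ᵐ q ∂(Pr.map fun ω => (W ω).init).prod (noiseLaw n lam p),
      path μ₀ μ₁ q.1 q.2 t ∈ states n k :=
    (Measure.ae_prod_iff_ae_ae hm).2 (Eventually.of_forall h1)
  rw [← hW.map_init_noise] at h3
  filter_upwards [ae_of_ae_map
    (hW.measurable_init.prodMk hW.measurable_noise).aemeasurable h3] with ω hω
  rwa [Z_eq_path]

omit [NeZero k] [IsProbabilityMeasure Pr] [IsProbabilityMeasure (coinLaw p)] in
lemma ae_finite_arrival_le (h : Admissible n k lam μ₀ μ₁ p) (hW : IsRandomInput Pr lam p W) :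
    ∀ᵐ ω ∂Pr, ∀ T, {l | (W ω).arrival l ≤ T}.Finite := by
  have h1 := (ae_gapLaw_pos (lam := lam)).and (ae_gapLaw_unbounded h.lam_pos)
  rw [← hW.map_gap] at h1
  filter_upwards [ae_of_ae_map (measurable_pi_iff.2 hW.measurable_gap).aemeasurable h1] with ω hω
  exact Input.finite_arrival_le hω.1 hω.2

/-- The pair of `lumpEq_transition`, with the past inserted by `LumpEq.cylinder` from `r = 0`, is
averaged over the initial snapshot, which is independent of the noise; general events of the past
then follow from cylinders. -/
lemma markov_property (h : Admissible n k lam μ₀ μ₁ p) (hW : IsRandomInput Pr lam p W)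
    (s t : ℝ≥0) {A : Set Ω} (hA : MeasurableSet[history (fun t ω => (W ω).Z μ₀ μ₁ t) s] A)
    {z : State k} (hz : z ∈ states n k) (z' : State k) :
    Pr (A ∩ {ω | (W ω).Z μ₀ μ₁ s = z} ∩ {ω | (W ω).Z μ₀ μ₁ (s + t) = z'}) =
      ENNReal.ofReal (transProb n μ₀ μ₁ lam p t z z') * Pr (A ∩ {ω | (W ω).Z μ₀ μ₁ s = z}) := by
  have hZ := fun u => hW.measurable_Z (μ₀ := μ₀) (μ₁ := μ₁) h.le u
  rw [Set.inter_assoc]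
  refine measure_inter_eq_mul_of_cylinder hZ s (fun T B hT => ?_) hA
  have h1 := hW.lintegral_eq_of_lumpEq ((lumpEq_transition h t hz z').cylinder h (s := s)
    (fun u => (B u).indicator 1) (fun u => indicator_one_le_one (B u)) T 0
    (fun u hu => ⟨zero_le, hT u hu⟩) zero_le)
  have hE : MeasurableSet {ω | (W ω).Z μ₀ μ₁ s = z} := hZ s (measurableSet_singleton z)
  have hE' : MeasurableSet {ω | (W ω).Z μ₀ μ₁ (s + t) = z'} :=
    hZ (s + t) (measurableSet_singleton z')
  have hC : MeasurableSet (⋂ u ∈ T, (fun ω => (W ω).Z μ₀ μ₁ u) ⁻¹' B u) :=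
    Finset.measurableSet_biInter T fun u _ => hZ u MeasurableSet.of_discrete
  have hprod : ∀ ω, ∏ u ∈ T, (B u).indicator (1 : State k → ℝ≥0∞) ((W ω).Z μ₀ μ₁ u) =
      (⋂ u ∈ T, (fun ω => (W ω).Z μ₀ μ₁ u) ⁻¹' B u).indicator 1 ω := by
    intro ω
    by_cases hω : ω ∈ ⋂ u ∈ T, (fun ω => (W ω).Z μ₀ μ₁ u) ⁻¹' B u
    · rw [Set.indicator_of_mem hω]
      refine Finset.prod_eq_one fun u hu => Set.indicator_of_mem ?_ _
      exact Set.mem_iInter₂.1 hω u hu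
    · rw [Set.indicator_of_notMem hω]
      simp only [Set.mem_iInter, not_forall] at hω
      obtain ⟨u, hu, hn⟩ := hω
      exact Finset.prod_eq_zero hu (Set.indicator_of_notMem
        (show (W ω).Z μ₀ μ₁ u ∉ B u from hn) _)
  simp only [visit, shiftPath_apply, tsub_zero, add_zero, hprod] at h1
  have hl : ∀ ω, (⋂ u ∈ T, (fun ω => (W ω).Z μ₀ μ₁ u) ⁻¹' B u).indicator (1 : Ω → ℝ≥0∞) ω *
      (Set.indicator {z} 1 ((W ω).Z μ₀ μ₁ s) * Set.indicator {z'} 1 ((W ω).Z μ₀ μ₁ (s + t))) =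
      ((⋂ u ∈ T, (fun ω => (W ω).Z μ₀ μ₁ u) ⁻¹' B u) ∩ ({ω | (W ω).Z μ₀ μ₁ s = z} ∩
        {ω | (W ω).Z μ₀ μ₁ (s + t) = z'})).indicator 1 ω := fun ω => by
    rw [Set.inter_indicator_one, Set.inter_indicator_one]
    rfl
  have hr : ∀ ω, (⋂ u ∈ T, (fun ω => (W ω).Z μ₀ μ₁ u) ⁻¹' B u).indicator (1 : Ω → ℝ≥0∞) ω *
      (Set.indicator {z} 1 ((W ω).Z μ₀ μ₁ s) * ENNReal.ofReal (transProb n μ₀ μ₁ lam p t z z')) =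
      ENNReal.ofReal (transProb n μ₀ μ₁ lam p t z z') *
        ((⋂ u ∈ T, (fun ω => (W ω).Z μ₀ μ₁ u) ⁻¹' B u) ∩
          {ω | (W ω).Z μ₀ μ₁ s = z}).indicator 1 ω := fun ω => by
    rw [Set.inter_indicator_one, ← mul_assoc, mul_comm]
    rfl
  simp only [hl, hr] at h1
  rwa [lintegral_indicator_one (hC.inter (hE.inter hE')),
    lintegral_const_mul _ (measurable_one.indicator (hC.inter hE)),
    lintegral_indicator_one (hC.inter hE)] at h1

theorem isCTMC (h : Admissible n k lam μ₀ μ₁ p) (hW : IsRandomInput Pr lam p W) :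
    IsCTMC Pr (fun t ω => (W ω).Z μ₀ μ₁ t) (states n k) (Q n lam μ₀ μ₁ p) where
  countable := Set.to_countable _
  measurable t := hW.measurable_Z h.le t
  mem_states := by
    -- Membership at fixed times holds simultaneously on a countable dense set, and constancy just
    -- to the right of each `t` carries it to all times.
    obtain ⟨D, hD, hdense⟩ := TopologicalSpace.exists_countable_dense ℝ≥0
    filter_upwards [(ae_ball_iff hD).2 fun t _ => hW.ae_Z_mem h t,
      hW.ae_finite_arrival_le h] with ω hω hfin t
    have h1 : ∀ᶠ u : ℝ≥0 in 𝓝[>] t, (W ω).Z μ₀ μ₁ u = (W ω).Z μ₀ μ₁ t :=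
      (Input.eventually_stateAt_nhdsGE hfin t).filter_mono
        (nhdsWithin_mono t Set.Ioi_subset_Ici_self)
    obtain ⟨b, hb, hsub⟩ := mem_nhdsGT_iff_exists_Ioo_subset.1 h1
    obtain ⟨u, huD, hu⟩ := hdense.exists_between hb
    have h2 : (W ω).Z μ₀ μ₁ u = (W ω).Z μ₀ μ₁ t := hsub hu
    exact h2 ▸ hω u huD
  right_cont := (hW.ae_finite_arrival_le h).mono fun ω hfin t =>
    Input.eventually_stateAt_nhdsGE hfin t
  left_lim := (hW.ae_finite_arrival_le h).mono fun ω hfin t =>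
    Input.exists_eventually_stateAt_nhdsLT hfin t
  markov := by
    refine ⟨_, isTransitionFunction h, fun s t A hA x y => ?_⟩
    rw [measureReal_def, hW.markov_property h s t hA x.2 y, ENNReal.toReal_mul,
      ENNReal.toReal_ofReal (transProb_nonneg _ _ _), mul_comm]
    rfl

end IsRandomInput

end ForkJoin

end

theorem mainTheorem1 {Ω : Type*} [MeasurableSpace Ω] (Pr : MeasureTheory.Measure Ω)
    [MeasureTheory.IsProbabilityMeasure Pr] (n k : ℕ) [NeZero k] (hkn : k ≤ n)
    (lam μ₀ μ₁ p : ℝ) (hlam : 0 < lam) (hμ₀ : 0 < μ₀) (hμ₁ : 0 < μ₁) (hp₀ : 0 ≤ p) (hp₁ : p ≤ 1)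
    (W : Ω → ForkJoin.Input n k) (hW : ForkJoin.IsRandomInput Pr lam p W) :
    ForkJoin.IsCTMC Pr (fun t ω => (W ω).Z μ₀ μ₁ t) (ForkJoin.states n k)
      (ForkJoin.Q n lam μ₀ μ₁ p) := by
  have := ProbabilityTheory.isProbabilityMeasure_expMeasure hlam
  have := ForkJoin.isProbabilityMeasure_coinLaw hp₀ hp₁
  exact hW.isCTMC ⟨hkn, hlam, hμ₀, hμ₁, hp₀, hp₁⟩
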